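/- **Setting.** Let $d\ge 1$, let $\Omega\subset\mathbb R^d$ be a nonempty bounded open set with Lipschitz boundary, $T>0$, $I=(0,T)$, $U=L^2(I\times\Omega)$, $s\in(0,1)$, and let $W\subset L^2(\Omega)$ be one of the following four fractional Sobolev spaces, with its inner product $(\cdot,\cdot)_W$ and norm: * $H^s(\Omega)$, with $(u,w)_{H^s(\Omega)}=\int_\Omega uw\,dx+\frac{c_{d,s}}2\int_\Omega\int_\Omega\frac{(u(x)-u(y))(w(x)-w(y))}{|x-y|^{d+2s}}\,dy\,dx$, where $c_{d,s}=\frac{s2^{2s}\Gamma(s+d/2)}{\pi^{d/2}\Gamma(1-s)}$; * $H^s_0(\Omega)$, the closure of $C_c^\infty(\Omega)$ in $H^s(\Omega)$, with the same inner product; * $\tilde H^s(\Omega)$, the functions in $H^s(\mathbb R^d)$ vanishing outside $\Omega$, with the $H^s(\mathbb R^d)$ inner product; * the spectral space $\mathbb H^s(\Omega)=\{w=\sum_n w_n\phi_n\in L^2(\Omega):\sum_n\lambda_n^s w_n^2<\infty\}$, with inner product $\sum_n\lambda_n^s u_nw_n$, where $(\phi_n)$ is an $L^2$-orthonormal basis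 of eigenfunctions of the Dirichlet Laplacian on $\Omega$ with eigenvalues $\lambda_n$, and $w_n=\int_\Omega w\phi_n\,dx$. Let $f:U\to\mathbb R$ be weakly lower semicontinuous, bounded from below by a continuous affine function, and continuously Fréchet differentiable; let $\alpha,\beta,\gamma>0$ and $p\in(0,1)$. For $\epsilon\ge0$ and $t\ge 0$ put $\psi_\epsilon(t)=\frac p2\frac t{\epsilon^{2-p}}+(1-\frac p2)\epsilon^p$ if $t<\epsilon^2$ and $\psi_\epsilon(t)=t^{p/2}$ if $t\ge\epsilon^2$, and $$G_\epsilon(w)=\int_\Omega\psi_\epsilon(|w|^2)\,dx,\qquad \Phi_\epsilon(u,w)=f(u)+\frac\alpha2\|u\|_U^2+\frac\beta2\|w\|_W^2+\gamma G_\epsilon(w).$$ Let $K=\{(u,w)\in U\times W:\ |u(t,x)|\le w(x)\text{ for a.a. }(t,x)\in I\times\Omega\}$, and let $(\bar u,\bar w)\in K$ and $\rho>0$ be such that $\Phi_0(\bar u,\bar w)\le\Phi_0(u,w)$ for all $(u,w)\in K$ with $\|u-\bar u\|_U\le\rho$ and $\|w-\bar w\|_W\le\rho$. Write $v_-=\min(v,0)$.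 Let $\epsilon_k>0$ with $\epsilon_k\to0$, and for each $k$ let $(u_k,w_k)$ be a (global) solution of the auxiliary problem $$\min_{(u,w)\in U\times W}\ \Phi_{\epsilon_k}(u,w)+\tfrac12\|u-\bar u\|_U^2+\tfrac12\|w-\bar w\|_{L^2(\Omega)}^2+\tfrac1{2\epsilon_k}\|(w-u)_-\|_U^2+\tfrac1{2\epsilon_k}\|(w+u)_-\|_U^2$$ subject to $\|u-\bar u\|_U\le\rho$, $\|w-\bar w\|_W\le\rho$, where $w$ is extended to $I\times\Omega$ as constant in $t$. Let $\lambda_k=G_{\epsilon_k}'(w_k)$ be the Fréchet derivative of $G_{\epsilon_k}:L^2(\Omega)\to\mathbb R$ at $w_k$, regarded as a function in $L^2(\Omega)$ and as the functional $z\mapsto\int_\Omega\lambda_kz\,dx$ in $W^*$. **Theorem.** The sequence $(\lambda_k)$ is bounded in $L^1(\Omega)$. Moreover, if $\lambda_k\to\bar\lambda$ in $W^*$, then $\bar\lambda$ can be identified with a measure in $\mathcal M(\Omega)=C_0(\Omega)^*$: there is exactly one finite signed Borel measure $\nu$ on $\Omega$ such that $$\langle\bar\lambda,\varphi\rangle_W=\int_\Omega\varphi\,d\nu\qquad\text{for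 all }\varphi\in C_0(\Omega)\cap W .$$ -/

import Mathlib

open MeasureTheory Set Filter Topology
open scoped ContDiff ZeroAtInfty ENNReal

noncomputable section

namespace SparseControl

/-- Euclidean space `ℝᵈ`. -/
abbrev Space (d : ℕ) : Type := EuclideanSpace ℝ (Fin d)

variable {d : ℕ}

/-! ### Domains and Lebesgue spaces -/

/-- A nonempty bounded open set with Lipschitz boundary: near each boundary point, and in a suitable
direction `e`, the set is the strict epigraph of a Lipschitz function `g` of the component
orthogonal to `e`. -/
structure IsBoundedLipschitzDomain (Ω : Set (Space d)) : Prop where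
  nonempty : Ω.Nonempty
  isOpen : IsOpen Ω
  isBounded : Bornology.IsBounded Ω
  lipschitz_boundary : ∀ x₀ ∈ frontier Ω, ∃ r > 0, ∃ e : Space d, ‖e‖ = 1 ∧
    ∃ (L : NNReal) (g : Space d → ℝ), LipschitzWith L g ∧
      ∀ y ∈ Metric.ball x₀ r, y ∈ Ω ↔ g (y - inner ℝ e y • e) < inner ℝ e y

/-- `L²(Ω)`. -/
abbrev L2 (Ω : Set (Space d)) : Type := Lp ℝ 2 (volume.restrict Ω)

/-- Lebesgue measure on the cylinder `I × Ω`, `I = (0,T)`. -/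
abbrev cylMeasure (T : ℝ) (Ω : Set (Space d)) : Measure (ℝ × Space d) :=
  (volume.restrict (Ioo 0 T)).prod (volume.restrict Ω)

/-- `U = L²(I × Ω)`. -/
abbrev ControlSpace (T : ℝ) (Ω : Set (Space d)) : Type := Lp ℝ 2 (cylMeasure T Ω)

/-- Test functions: `v ∈ C_c^∞(Ω)`. -/
def IsTestFunction (Ω : Set (Space d)) (v : Space d → ℝ) : Prop :=
  ContDiff ℝ ∞ v ∧ HasCompactSupport v ∧ tsupport v ⊆ Ω

/-! ### Fractional Sobolev spaces -/

/-- The constant `c_{d,s}`. -/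
def sobolevConst (d : ℕ) (s : ℝ) : ℝ :=
  s * (2 : ℝ) ^ (2 * s) * Real.Gamma (s + d / 2) /
    (Real.pi ^ ((d : ℝ) / 2) * Real.Gamma (1 - s))

/-- The difference quotient `(x,y) ↦ (w(x) - w(y)) / |x - y|^(d/2+s)`. -/
def diffQuot (s : ℝ) (w : Space d → ℝ) (z : Space d × Space d) : ℝ :=
  (w z.1 - w z.2) / ‖z.1 - z.2‖ ^ ((d : ℝ) / 2 + s)

/-- Lebesgue measure on `A × A`. -/
abbrev sqMeasure (A : Set (Space d)) : Measure (Space d × Space d) :=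
  (volume.restrict A).prod (volume.restrict A)

/-- `w ∈ H^s(A)`. -/
def MemHs (A : Set (Space d)) (s : ℝ) (w : Space d → ℝ) : Prop :=
  MemLp w 2 (volume.restrict A) ∧ MemLp (diffQuot s w) 2 (sqMeasure A)

/-- The inner product of `H^s(A)`. -/
def hsInner (A : Set (Space d)) (s : ℝ) (u w : Space d → ℝ) : ℝ :=
  (∫ x in A, u x * w x) + sobolevConst d s / 2 *
    ∫ z, (u z.1 - u z.2) * (w z.1 - w z.2) / ‖z.1 - z.2‖ ^ ((d : ℝ) + 2 * s) ∂sqMeasure A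

/-- `w ∈ H^s_0(Ω)`: the closure of `C_c^∞(Ω)` in `H^s(Ω)`. Convergence in the norm of `H^s(Ω)` is
convergence to zero of both parts of the norm of the difference. -/
def MemHs0 (Ω : Set (Space d)) (s : ℝ) (w : Space d → ℝ) : Prop :=
  MemHs Ω s w ∧ ∃ v : ℕ → Space d → ℝ, (∀ n, IsTestFunction Ω (v n) ∧ MemHs Ω s (v n)) ∧
    Tendsto (fun n => eLpNorm (v n - w) 2 (volume.restrict Ω)) atTop (𝓝 0) ∧
    Tendsto (fun n => eLpNorm (diffQuot s (v n - w)) 2 (sqMeasure Ω)) atTop (𝓝 0)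

/-- `φ` belongs to `H^1_0(Ω)`, the closure of `C_c^∞(Ω)` in `H^1(Ω)`, and has weak gradient `g`. -/
def HasH01Gradient (Ω : Set (Space d)) (φ : L2 Ω) (g : Lp (Space d) 2 (volume.restrict Ω)) :
    Prop :=
  ∃ v : ℕ → Space d → ℝ, (∀ n, IsTestFunction Ω (v n)) ∧
    Tendsto (fun n => eLpNorm (fun x => v n x - φ x) 2 (volume.restrict Ω)) atTop (𝓝 0) ∧
    Tendsto (fun n => eLpNorm (fun x => gradient (v n) x - g x) 2 (volume.restrict Ω))
      atTop (𝓝 0)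

/-- `-Δφ = l φ` in `Ω`, `φ = 0` on `∂Ω`, in the weak sense (`φ = 0` is allowed). -/
def SolvesDirichletEigen (Ω : Set (Space d)) (l : ℝ) (φ : L2 Ω) : Prop :=
  ∃ g : Lp (Space d) 2 (volume.restrict Ω), HasH01Gradient Ω φ g ∧
    ∀ v : Space d → ℝ, IsTestFunction Ω v →
      ∫ x in Ω, inner ℝ (g x) (gradient v x) = l * ∫ x in Ω, φ x * v x

/-- The closed subspace of `L²(Ω)` of Dirichlet eigenfunctions to the eigenvalue `l` (zero if `l` is
not an eigenvalue). The solutions already form a closed subspace; span and closure only provide the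
structure. -/
def eigenspace (Ω : Set (Space d)) (l : ℝ) : Submodule ℝ (L2 Ω) :=
  (Submodule.span ℝ {φ | SolvesDirichletEigen Ω l φ}).topologicalClosure

/-- The orthogonal projection of `L²(Ω)` onto the Dirichlet eigenspace of `l`. If `(φₙ)` is an
orthonormal basis of eigenfunctions with eigenvalues `(λₙ)`, this is
`w ↦ ∑_{λₙ = l} (∫ w φₙ) φₙ`. -/
def eigenProj (Ω : Set (Space d)) (l : ℝ) : L2 Ω →L[ℝ] L2 Ω :=
  haveI : CompleteSpace (eigenspace Ω l) :=
    (Submodule.isClosed_topologicalClosure _).completeSpace_coe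
  (eigenspace Ω l).starProjection

lemma diffQuot_add (s : ℝ) (u w : Space d → ℝ) :
    diffQuot s (u + w) = diffQuot s u + diffQuot s w := by
  funext z; simp only [diffQuot, Pi.add_apply]; ring

lemma diffQuot_smul (s c : ℝ) (w : Space d → ℝ) :
    diffQuot s (c • w) = c • diffQuot s w := by
  funext z; simp only [diffQuot, Pi.smul_apply, smul_eq_mul]; ring

lemma diffQuot_congr {A : Set (Space d)} (s : ℝ) {u w : Space d → ℝ}
    (h : u =ᵐ[volume.restrict A] w) : diffQuot s u =ᵐ[sqMeasure A] diffQuot s w := by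
  have h1 : ∀ᵐ z ∂sqMeasure A, u z.1 = w z.1 := Measure.quasiMeasurePreserving_fst.ae h
  have h2 : ∀ᵐ z ∂sqMeasure A, u z.2 = w z.2 := Measure.quasiMeasurePreserving_snd.ae h
  filter_upwards [h1, h2] with z hz1 hz2
  simp only [diffQuot, hz1, hz2]

lemma MemHs.congr {A : Set (Space d)} {s : ℝ} {u w : Space d → ℝ} (hu : MemHs A s u)
    (h : u =ᵐ[volume.restrict A] w) : MemHs A s w :=
  ⟨hu.1.ae_eq h, hu.2.ae_eq (diffQuot_congr s h)⟩

lemma MemHs.add {A : Set (Space d)} {s : ℝ} {u w : Space d → ℝ} (hu : MemHs A s u)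
    (hw : MemHs A s w) : MemHs A s (u + w) :=
  ⟨hu.1.add hw.1, by rw [diffQuot_add]; exact hu.2.add hw.2⟩

lemma MemHs.smul {A : Set (Space d)} {s : ℝ} (c : ℝ) {w : Space d → ℝ} (hw : MemHs A s w) :
    MemHs A s (c • w) :=
  ⟨hw.1.const_smul c, by rw [diffQuot_smul]; exact hw.2.const_smul c⟩

lemma MemHs.zero (A : Set (Space d)) (s : ℝ) : MemHs A s 0 := by
  have h : diffQuot s (0 : Space d → ℝ) = 0 := by funext z; simp [diffQuot]
  exact ⟨MemLp.zero, by rw [h]; exact MemLp.zero⟩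

lemma IsTestFunction.add {Ω : Set (Space d)} {u v : Space d → ℝ} (hu : IsTestFunction Ω u)
    (hv : IsTestFunction Ω v) : IsTestFunction Ω (u + v) :=
  ⟨hu.1.add hv.1, hu.2.1.add hv.2.1,
    (tsupport_add u v).trans (union_subset hu.2.2 hv.2.2)⟩

lemma IsTestFunction.smul {Ω : Set (Space d)} (c : ℝ) {v : Space d → ℝ}
    (hv : IsTestFunction Ω v) : IsTestFunction Ω (c • v) :=
  ⟨contDiff_const.smul hv.1, hv.2.1.smul_left (f := fun _ => c),
    (tsupport_smul_subset_right (fun _ => c) v).trans hv.2.2⟩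

lemma IsTestFunction.zero (Ω : Set (Space d)) : IsTestFunction Ω 0 :=
  ⟨contDiff_const, HasCompactSupport.zero, by simp [tsupport]⟩

lemma MemHs0.congr {Ω : Set (Space d)} {s : ℝ} {u w : Space d → ℝ} (hu : MemHs0 Ω s u)
    (h : u =ᵐ[volume.restrict Ω] w) : MemHs0 Ω s w := by
  obtain ⟨hu, v, hv, h1, h2⟩ := hu
  have e (n : ℕ) : v n - u =ᵐ[volume.restrict Ω] v n - w := EventuallyEq.rfl.sub h
  refine ⟨hu.congr h, v, hv, ?_, ?_⟩
  · exact h1.congr fun n => eLpNorm_congr_ae (e n)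
  · exact h2.congr fun n => eLpNorm_congr_ae (diffQuot_congr s (e n))

lemma MemHs.sub {A : Set (Space d)} {s : ℝ} {u w : Space d → ℝ} (hu : MemHs A s u)
    (hw : MemHs A s w) : MemHs A s (u - w) := by
  have := hu.add (hw.smul (-1))
  rwa [neg_one_smul, ← sub_eq_add_neg] at this

lemma MemHs0.add {Ω : Set (Space d)} {s : ℝ} {u w : Space d → ℝ} (hu : MemHs0 Ω s u)
    (hw : MemHs0 Ω s w) : MemHs0 Ω s (u + w) := by
  obtain ⟨hu, a, ha, ha1, ha2⟩ := hu
  obtain ⟨hw, b, hb, hb1, hb2⟩ := hw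
  refine ⟨hu.add hw, fun n => a n + b n,
    fun n => ⟨(ha n).1.add (hb n).1, (ha n).2.add (hb n).2⟩, ?_, ?_⟩
  · refine tendsto_of_tendsto_of_tendsto_of_le_of_le tendsto_const_nhds
      (by simpa using ha1.add hb1) (fun _ => zero_le) fun n => ?_
    dsimp only
    rw [add_sub_add_comm]
    exact eLpNorm_add_le ((ha n).2.sub hu).1.1 ((hb n).2.sub hw).1.1 (by norm_num)
  · refine tendsto_of_tendsto_of_tendsto_of_le_of_le tendsto_const_nhds
      (by simpa using ha2.add hb2) (fun _ => zero_le) fun n => ?_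
    dsimp only
    rw [add_sub_add_comm, diffQuot_add]
    exact eLpNorm_add_le ((ha n).2.sub hu).2.1 ((hb n).2.sub hw).2.1 (by norm_num)

lemma MemHs0.smul {Ω : Set (Space d)} {s : ℝ} (c : ℝ) {w : Space d → ℝ} (hw : MemHs0 Ω s w) :
    MemHs0 Ω s (c • w) := by
  obtain ⟨hw, b, hb, hb1, hb2⟩ := hw
  refine ⟨hw.smul c, fun n => c • b n, fun n => ⟨(hb n).1.smul c, (hb n).2.smul c⟩, ?_, ?_⟩
  · have := ENNReal.Tendsto.const_mul (a := ‖c‖ₑ) hb1 (Or.inr (by simp))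
    rw [mul_zero] at this
    refine this.congr fun n => ?_
    rw [← smul_sub, eLpNorm_const_smul]
  · have := ENNReal.Tendsto.const_mul (a := ‖c‖ₑ) hb2 (Or.inr (by simp))
    rw [mul_zero] at this
    refine this.congr fun n => ?_
    rw [← smul_sub, diffQuot_smul, eLpNorm_const_smul]

lemma MemHs0.zero (Ω : Set (Space d)) (s : ℝ) : MemHs0 Ω s 0 := by
  have h : diffQuot s (0 : Space d → ℝ) = 0 := by funext z; simp [diffQuot]
  refine ⟨MemHs.zero Ω s, fun _ => 0, fun _ => ⟨IsTestFunction.zero Ω, MemHs.zero Ω s⟩, ?_, ?_⟩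
  · simp
  · simp [h]

/-- The subspace `H^s(Ω)` of `L²(Ω)`. -/
def spaceHs (Ω : Set (Space d)) (s : ℝ) : Submodule ℝ (L2 Ω) where
  carrier := {w | MemHs Ω s w}
  add_mem' hu hw := (MemHs.add hu hw).congr (Lp.coeFn_add _ _).symm
  zero_mem' := (MemHs.zero Ω s).congr (Lp.coeFn_zero _ _ _).symm
  smul_mem' c _ hw := (MemHs.smul c hw).congr (Lp.coeFn_smul _ _).symm

/-- The subspace `H^s_0(Ω)` of `L²(Ω)`. -/
def spaceHs0 (Ω : Set (Space d)) (s : ℝ) : Submodule ℝ (L2 Ω) where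
  carrier := {w | MemHs0 Ω s w}
  add_mem' hu hw := (MemHs0.add hu hw).congr (Lp.coeFn_add _ _).symm
  zero_mem' := (MemHs0.zero Ω s).congr (Lp.coeFn_zero _ _ _).symm
  smul_mem' c _ hw := (MemHs0.smul c hw).congr (Lp.coeFn_smul _ _).symm

/-- The space `H̃^s(Ω)` of functions in `H^s(ℝᵈ)` that vanish outside `Ω`, as a subspace of `L²(Ω)`:
those `w` that are the restriction of such a function `w'`. -/
def spaceHsTilde (Ω : Set (Space d)) (s : ℝ) : Submodule ℝ (L2 Ω) where
  carrier := {w | ∃ w' : Space d → ℝ, MemHs univ s w' ∧ w' =ᵐ[volume.restrict Ω] w ∧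
    w' =ᵐ[volume.restrict Ωᶜ] 0}
  add_mem' := by
    rintro u w ⟨u', hu, hu1, hu2⟩ ⟨w', hw, hw1, hw2⟩
    refine ⟨u' + w', hu.add hw, (hu1.add hw1).trans (Lp.coeFn_add _ _).symm, ?_⟩
    simpa using hu2.add hw2
  zero_mem' := ⟨0, MemHs.zero _ s, (Lp.coeFn_zero _ _ _).symm, EventuallyEq.rfl⟩
  smul_mem' := by
    rintro c w ⟨w', hw, hw1, hw2⟩
    refine ⟨c • w', hw.smul c, (hw1.const_smul c).trans (Lp.coeFn_smul _ _).symm, ?_⟩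
    simpa using hw2.const_smul c

/-- The spectral space `ℍ^s(Ω)`: those `w ∈ L²(Ω)` that are the sum of their eigenfunction expansion
and have a finite norm `∑ₙ λₙ^s wₙ²`. The expansion is grouped by the eigenvalue `l`, so that
`∑_{λₙ = l} wₙ φₙ` is `eigenProj Ω l w`; Dirichlet eigenvalues are positive. -/
def spaceSpectral (Ω : Set (Space d)) (s : ℝ) : Submodule ℝ (L2 Ω) where
  carrier := {w | HasSum (fun l : Ioi (0 : ℝ) => eigenProj Ω l w) w ∧
    Summable (fun l : Ioi (0 : ℝ) => (l : ℝ) ^ s * ‖eigenProj Ω l w‖ ^ 2)}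
  add_mem' := by
    rintro u w ⟨hu1, hu2⟩ ⟨hw1, hw2⟩
    refine ⟨by simpa using hu1.add hw1, ?_⟩
    refine Summable.of_nonneg_of_le
      (fun l => mul_nonneg (Real.rpow_nonneg l.2.le s) (sq_nonneg _)) (fun l => ?_)
      ((hu2.add hw2).mul_left 2)
    have hl : 0 ≤ (l : ℝ) ^ s := Real.rpow_nonneg l.2.le s
    have h1 : ‖eigenProj Ω l (u + w)‖ ^ 2
        ≤ 2 * (‖eigenProj Ω l u‖ ^ 2 + ‖eigenProj Ω l w‖ ^ 2) := by
      rw [map_add]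
      nlinarith [norm_add_le (eigenProj Ω l u) (eigenProj Ω l w),
        norm_nonneg (eigenProj Ω l u + eigenProj Ω l w),
        sq_nonneg (‖eigenProj Ω l u‖ - ‖eigenProj Ω l w‖)]
    nlinarith [mul_le_mul_of_nonneg_left h1 hl]
  zero_mem' := by
    refine ⟨?_, ?_⟩ <;> simp
  smul_mem' := by
    rintro c w ⟨hw1, hw2⟩
    refine ⟨by simpa using hw1.const_smul c, ?_⟩
    refine (hw2.mul_left (c ^ 2)).congr fun l => ?_
    rw [map_smul, norm_smul, mul_pow, Real.norm_eq_abs, sq_abs]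
    ring

/-- The four types of fractional Sobolev space: `H^s(Ω)`, `H^s_0(Ω)`, `H̃^s(Ω)`, `ℍ^s(Ω)`. -/
inductive SobolevType
  | full
  | zeroTrace
  | zeroExtension
  | spectral

/-- The fractional Sobolev space `W` of the given type, as a subspace of `L²(Ω)`. -/
def fracSobolev (Ω : Set (Space d)) (s : ℝ) : SobolevType → Submodule ℝ (L2 Ω)
  | .full => spaceHs Ω s
  | .zeroTrace => spaceHs0 Ω s
  | .zeroExtension => spaceHsTilde Ω s
  | .spectral => spaceSpectral Ω s

/-- The inner product `(u,w)_W`. -/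
def wInner (Ω : Set (Space d)) (s : ℝ) (κ : SobolevType) (u w : L2 Ω) : ℝ :=
  match κ with
  | .full => hsInner Ω s u w
  | .zeroTrace => hsInner Ω s u w
  | .zeroExtension => hsInner univ s (Ω.indicator u) (Ω.indicator w)
  | .spectral => ∑' l : Ioi (0 : ℝ), (l : ℝ) ^ s * inner ℝ (eigenProj Ω l u) (eigenProj Ω l w)

/-- The norm `‖w‖_W`. -/
def wNorm (Ω : Set (Space d)) (s : ℝ) (κ : SobolevType) (w : L2 Ω) : ℝ :=
  √(wInner Ω s κ w w)

/-- The norm of `W*` on linear functionals on `W`, with value `∞` for unbounded functionals. -/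
def dualNorm (Ω : Set (Space d)) (s : ℝ) (κ : SobolevType)
    (ℓ : Module.Dual ℝ (fracSobolev Ω s κ)) : ℝ≥0∞ :=
  ⨆ (z : fracSobolev Ω s κ) (_ : wNorm Ω s κ z ≤ 1), ‖ℓ z‖ₑ

/-! ### The optimization problem -/

/-- The admissible set `K`, in terms of `u` and of an element `w` of `L²(Ω)`. -/
def IsAdmissible (T : ℝ) (Ω : Set (Space d)) (s : ℝ) (κ : SobolevType)
    (u : ControlSpace T Ω) (w : L2 Ω) : Prop :=
  w ∈ fracSobolev Ω s κ ∧ ∀ᵐ z ∂cylMeasure T Ω, |u z| ≤ w z.2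

/-- Weak (sequential) lower semicontinuity: `f(v) ≤ liminf f(vₙ)` whenever `vₙ ⇀ v`. -/
def WeaklyLSC {H : Type*} [NormedAddCommGroup H] [InnerProductSpace ℝ H] (f : H → ℝ) : Prop :=
  ∀ (vs : ℕ → H) (v : H), (∀ h : H, Tendsto (fun n => inner ℝ (vs n) h) atTop (𝓝 (inner ℝ v h))) →
    (f v : EReal) ≤ liminf (fun n => (f (vs n) : EReal)) atTop

/-- The smoothing `ψ_ε` of `t ↦ t^(p/2)` on `[0,∞)`. -/
def psi (p ε t : ℝ) : ℝ :=
  if t < ε ^ 2 then p / 2 * (t / ε ^ (2 - p)) + (1 - p / 2) * ε ^ p else t ^ (p / 2)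

/-- `G_ε(w) = ∫_Ω ψ_ε(|w|²)`. -/
def smoothG (Ω : Set (Space d)) (p ε : ℝ) (w : L2 Ω) : ℝ :=
  ∫ x in Ω, psi p ε (|w x| ^ 2)

/-- The smoothed objective `Φ_ε`; `Φ_0` is the original objective. -/
def objective (T : ℝ) (Ω : Set (Space d)) (s : ℝ) (κ : SobolevType)
    (f : ControlSpace T Ω → ℝ) (α β γ p ε : ℝ) (u : ControlSpace T Ω) (w : L2 Ω) : ℝ :=
  f u + α / 2 * ‖u‖ ^ 2 + β / 2 * wNorm Ω s κ w ^ 2 + γ * smoothG Ω p ε w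

/-- `(ū,w̄)` is a local solution of the original problem, optimal among the admissible pairs within
distance `ρ` in `U` and in `W`. -/
def IsLocalSolution (T : ℝ) (Ω : Set (Space d)) (s : ℝ) (κ : SobolevType)
    (f : ControlSpace T Ω → ℝ) (α β γ p ρ : ℝ) (ubar : ControlSpace T Ω) (wbar : L2 Ω) : Prop :=
  IsAdmissible T Ω s κ ubar wbar ∧
    ∀ u w, IsAdmissible T Ω s κ u w → ‖u - ubar‖ ≤ ρ → wNorm Ω s κ (w - wbar) ≤ ρ →
      objective T Ω s κ f α β γ p 0 ubar wbar ≤ objective T Ω s κ f α β γ p 0 u w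

/-- The objective of the auxiliary problem. -/
def auxObjective (T : ℝ) (Ω : Set (Space d)) (s : ℝ) (κ : SobolevType)
    (f : ControlSpace T Ω → ℝ) (α β γ p ε : ℝ) (ubar : ControlSpace T Ω) (wbar : L2 Ω)
    (u : ControlSpace T Ω) (w : L2 Ω) : ℝ :=
  objective T Ω s κ f α β γ p ε u w + 1 / 2 * ‖u - ubar‖ ^ 2 + 1 / 2 * ‖w - wbar‖ ^ 2
    + 1 / (2 * ε) * (∫ z, min (w z.2 - u z) 0 ^ 2 ∂cylMeasure T Ω)
    + 1 / (2 * ε) * (∫ z, min (w z.2 + u z) 0 ^ 2 ∂cylMeasure T Ω)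

/-- The constraints of the auxiliary problem. -/
def AuxFeasible (T : ℝ) (Ω : Set (Space d)) (s : ℝ) (κ : SobolevType) (ρ : ℝ)
    (ubar : ControlSpace T Ω) (wbar : L2 Ω) (u : ControlSpace T Ω) (w : L2 Ω) : Prop :=
  w ∈ fracSobolev Ω s κ ∧ ‖u - ubar‖ ≤ ρ ∧ wNorm Ω s κ (w - wbar) ≤ ρ

/-- `(u,w)` is a (global) solution of the auxiliary problem. -/
def IsAuxSolution (T : ℝ) (Ω : Set (Space d)) (s : ℝ) (κ : SobolevType)
    (f : ControlSpace T Ω → ℝ) (α β γ p ε ρ : ℝ) (ubar : ControlSpace T Ω) (wbar : L2 Ω)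
    (u : ControlSpace T Ω) (w : L2 Ω) : Prop :=
  AuxFeasible T Ω s κ ρ ubar wbar u w ∧
    ∀ u' w', AuxFeasible T Ω s κ ρ ubar wbar u' w' →
      auxObjective T Ω s κ f α β γ p ε ubar wbar u w ≤
        auxObjective T Ω s κ f α β γ p ε ubar wbar u' w'

/-! ### Multipliers -/

/-- The multiplier `G_ε'(w)`, the Fréchet derivative of `G_ε` on `L²(Ω)`, as a function
in `L²(Ω)`. -/
def multiplier (Ω : Set (Space d)) (p ε : ℝ) (w : L2 Ω) : L2 Ω :=
  gradient (smoothG Ω p ε) w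

/-- The functional `z ↦ ∫_Ω g z` on `W`. -/
def toFunctional (Ω : Set (Space d)) (s : ℝ) (κ : SobolevType) (g : L2 Ω) :
    Module.Dual ℝ (fracSobolev Ω s κ) :=
  (innerₗ (L2 Ω) g).comp (fracSobolev Ω s κ).subtype

/-- The functional `ℓ` on `W` is identified with the finite signed Borel measure `ν` on `Ω`: both
agree on `C₀(Ω) ∩ W`, that is, `ℓ(z) = ∫ φ dν` for all `φ ∈ C₀(Ω)` and `z ∈ W` with `z = φ`
almost everywhere. -/
def IsIdentifiedWith (Ω : Set (Space d)) (s : ℝ) (κ : SobolevType)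
    (ℓ : Module.Dual ℝ (fracSobolev Ω s κ)) (ν : SignedMeasure Ω) : Prop :=
  ∀ (φ : C₀(Ω, ℝ)) (z : fracSobolev Ω s κ),
    (∀ᵐ x ∂volume.restrict Ω, ∀ hx : x ∈ Ω, (z : L2 Ω) x = φ ⟨x, hx⟩) →
      ℓ z = ∫ᵛ x, φ x ∂<•ν

end SparseControl

end

noncomputable section

namespace SparseControl

/-! ### Weak convergence in Hilbert spaces -/

section Hilbert

variable {H : Type*} [NormedAddCommGroup H] [InnerProductSpace ℝ H]

/-- Weak convergence of a sequence in a Hilbert space. -/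
def WeakTendsto (x : ℕ → H) (y : H) : Prop :=
  ∀ h : H, Tendsto (fun n => inner ℝ (x n) h) atTop (𝓝 (inner ℝ y h))

lemma WeakTendsto.comp {x : ℕ → H} {y : H} (h : WeakTendsto x y) {φ : ℕ → ℕ}
    (hφ : StrictMono φ) : WeakTendsto (x ∘ φ) y :=
  fun g => (h g).comp hφ.tendsto_atTop

lemma WeakTendsto.of_tendsto {x : ℕ → H} {y : H} (h : Tendsto x atTop (𝓝 y)) :
    WeakTendsto x y :=
  fun _ => h.inner tendsto_const_nhds

lemma WeakTendsto.unique {x : ℕ → H} {y z : H} (hy : WeakTendsto x y) (hz : WeakTendsto x z) :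
    y = z :=
  ext_inner_right ℝ fun h => tendsto_nhds_unique (hy h) (hz h)

lemma WeakTendsto.sub {x x' : ℕ → H} {y y' : H} (h : WeakTendsto x y) (h' : WeakTendsto x' y') :
    WeakTendsto (fun n => x n - x' n) (y - y') := by
  intro g
  simp only [inner_sub_left]
  exact (h g).sub (h' g)

lemma WeakTendsto.norm_le {x : ℕ → H} {y : H} (h : WeakTendsto x y) {M : ℝ}
    (hM : ∀ n, ‖x n‖ ≤ M) : ‖y‖ ≤ M := by
  have h1 : inner ℝ y y ≤ M * ‖y‖ := le_of_tendsto (h y) <| Eventually.of_forall fun n =>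
    (real_inner_le_norm _ _).trans (mul_le_mul_of_nonneg_right (hM n) (norm_nonneg _))
  rw [real_inner_self_eq_norm_mul_norm] at h1
  rcases (norm_nonneg y).eq_or_lt with h0 | h0
  · rw [← h0]; exact (norm_nonneg _).trans (hM 0)
  · exact le_of_mul_le_mul_right h1 h0

variable [CompleteSpace H]

lemma exists_weakTendsto_of_separable [TopologicalSpace.SeparableSpace H] {x : ℕ → H} {M : ℝ}
    (hM : ∀ n, ‖x n‖ ≤ M) : ∃ φ : ℕ → ℕ, StrictMono φ ∧ ∃ y : H, WeakTendsto (x ∘ φ) y := by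
  let e := InnerProductSpace.toDual ℝ H
  have hx (n : ℕ) : StrongDual.toWeakDual (e (x n)) ∈
      (WeakDual.toStrongDual ⁻¹' Metric.closedBall (0 : StrongDual ℝ H) M) := by
    simp only [mem_preimage, mem_closedBall_zero_iff]
    change ‖e (x n)‖ ≤ M
    rw [LinearIsometryEquiv.norm_map]; exact hM n
  obtain ⟨g, -, φ, hφ, hg⟩ := WeakDual.isSeqCompact_closedBall ℝ H 0 M hx
  refine ⟨φ, hφ, e.symm (WeakDual.toStrongDual g), fun h => ?_⟩
  have := ((WeakDual.eval_continuous h).tendsto g).comp hg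
  have h2 : inner ℝ (e.symm (WeakDual.toStrongDual g)) h = g h :=
    InnerProductSpace.toDual_symm_apply
  rw [h2]
  exact this

/-- Bounded sequences in a Hilbert space have weakly convergent subsequences. -/
lemma exists_weakTendsto {x : ℕ → H} {M : ℝ} (hM : ∀ n, ‖x n‖ ≤ M) :
    ∃ φ : ℕ → ℕ, StrictMono φ ∧ ∃ y : H, WeakTendsto (x ∘ φ) y := by
  let S : Submodule ℝ H := (Submodule.span ℝ (range x)).topologicalClosure
  have hS : IsClosed (S : Set H) := Submodule.isClosed_topologicalClosure _
  have : CompleteSpace S := hS.completeSpace_coe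
  have hsep : TopologicalSpace.IsSeparable (S : Set H) :=
    ((countable_range x).isSeparable.span (R := ℝ)).closure
  have : TopologicalSpace.SeparableSpace S := hsep.separableSpace
  have hx (n : ℕ) : x n ∈ S :=
    Submodule.le_topologicalClosure _ (Submodule.subset_span (mem_range_self n))
  obtain ⟨φ, hφ, y, hy⟩ := exists_weakTendsto_of_separable (H := S)
    (x := fun n => ⟨x n, hx n⟩) (M := M) (fun n => hM n)
  refine ⟨φ, hφ, y, fun h => ?_⟩
  have h1 (z : S) : inner ℝ (z : H) h = inner ℝ z (S.orthogonalProjectionOnto h) := 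
    (Submodule.inner_orthogonalProjectionOnto_eq_of_mem_left z h).symm
  rw [h1]
  exact (hy (S.orthogonalProjectionOnto h)).congr fun n => (h1 _).symm

lemma WeakTendsto.mem_of_isClosed {S : Submodule ℝ H} (hS : IsClosed (S : Set H)) {x : ℕ → H}
    {y : H} (h : WeakTendsto x y) (hx : ∀ n, x n ∈ S) : y ∈ S := by
  have : CompleteSpace S := hS.completeSpace_coe
  rw [← Submodule.orthogonal_orthogonal S, Submodule.mem_orthogonal']
  intro u hu
  refine tendsto_nhds_unique (h u) ?_
  rw [Submodule.mem_orthogonal] at hu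
  simp [hu _ (hx _)]

variable {X : Type*} [NormedAddCommGroup X] [InnerProductSpace ℝ X] [CompleteSpace X]

/-- Weak sequential compactness for a closed linear operator `J` defined on a subspace `W`. -/
lemma exists_weakTendsto_of_closed {W : Submodule ℝ X} {J : W →ₗ[ℝ] H}
    (hcl : ∀ (x : ℕ → W) (w : X) (y : H), Tendsto (fun n => (x n : X)) atTop (𝓝 w) →
      Tendsto (fun n => J (x n)) atTop (𝓝 y) → ∃ z : W, (z : X) = w ∧ J z = y)
    {x : ℕ → W} {M N : ℝ} (hM : ∀ n, ‖(x n : X)‖ ≤ M) (hN : ∀ n, ‖J (x n)‖ ≤ N) :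
    ∃ φ : ℕ → ℕ, StrictMono φ ∧ ∃ z : W, WeakTendsto (fun n => (x (φ n) : X)) z ∧
      WeakTendsto (fun n => J (x (φ n))) (J z) := by
  obtain ⟨φ, hφ, w, hw⟩ := exists_weakTendsto (x := fun n => (x n : X)) hM
  obtain ⟨χ, hχ, y, hy⟩ := exists_weakTendsto (x := fun n => J (x (φ n))) (fun n => hN _)
  let G : Submodule ℝ (WithLp 2 (X × H)) :=
    LinearMap.range ((WithLp.linearEquiv 2 ℝ (X × H)).symm.toLinearMap ∘ₗ
      (W.subtype.prod J))
  have hmem (z : W) : WithLp.toLp 2 ((z : X), J z) ∈ G := ⟨z, rfl⟩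
  have hG : IsClosed (G : Set (WithLp 2 (X × H))) := by
    refine IsSeqClosed.isClosed fun p q hp hq => ?_
    choose z hz using hp
    have h1 : Tendsto (fun n => (z n : X)) atTop (𝓝 q.fst) := by
      have : Continuous (fun p : WithLp 2 (X × H) => p.fst) := by fun_prop
      refine ((this.tendsto q).comp hq).congr fun n => ?_
      rw [Function.comp, ← hz n]; rfl
    have h2 : Tendsto (fun n => J (z n)) atTop (𝓝 q.snd) := by
      have : Continuous (fun p : WithLp 2 (X × H) => p.snd) := by fun_prop
      refine ((this.tendsto q).comp hq).congr fun n => ?_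
      rw [Function.comp, ← hz n]; rfl
    obtain ⟨z', hz1, hz2⟩ := hcl z _ _ h1 h2
    refine ⟨z', ?_⟩
    change WithLp.toLp 2 ((z' : X), J z') = q
    rw [hz1, hz2]; rfl
  have hlim : WeakTendsto (fun n => WithLp.toLp 2 ((x (φ (χ n)) : X), J (x (φ (χ n)))))
      (WithLp.toLp 2 (w, y)) := by
    intro h
    simp only [WithLp.prod_inner_apply]
    exact (((hw.comp hχ) h.fst).add (hy h.snd))
  obtain ⟨z, hz⟩ := hlim.mem_of_isClosed hG fun n => hmem _
  have hz' : WithLp.toLp 2 ((z : X), J z) = WithLp.toLp 2 (w, y) := hz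
  have e1 : (z : X) = w := congrArg WithLp.fst hz'
  have e2 : J z = y := congrArg WithLp.snd hz'
  refine ⟨φ ∘ χ, hφ.comp hχ, z, ?_, ?_⟩
  · rw [e1]; exact hw.comp hχ
  · rw [e2]; exact hy

end Hilbert

end SparseControl
end

noncomputable section

namespace SparseControl

/-! ### The smoothing function and its derivative -/

section Psi

variable {p ε : ℝ}

lemma psi_zero {t : ℝ} (ht : 0 ≤ t) : psi p 0 t = t ^ (p / 2) := by
  simp [psi, not_lt.mpr ht]

lemma rpow_le_psi (hp0 : 0 < p) (hp1 : p < 1) (hε : 0 < ε) {t : ℝ} (ht : 0 ≤ t) :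
    t ^ (p / 2) ≤ psi p ε t := by
  unfold psi
  split_ifs with h
  · have h1 := Real.geom_mean_le_arith_mean2_weighted (w₁ := p / 2) (w₂ := 1 - p / 2)
      (p₁ := t / ε ^ (2 - p)) (p₂ := ε ^ p) (by linarith) (by linarith) (by positivity)
      (by positivity) (by ring)
    refine le_trans (le_of_eq ?_) h1
    rw [Real.div_rpow ht (by positivity), ← Real.rpow_mul hε.le, ← Real.rpow_mul hε.le,
      div_mul_eq_mul_div, mul_div_assoc, ← Real.rpow_sub hε]
    ring_nf; simp
  · exact le_rfl

lemma psi_le_rpow_add (hp0 : 0 < p) (hε : 0 < ε) {t : ℝ} (ht : 0 ≤ t) :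
    psi p ε t ≤ t ^ (p / 2) + ε ^ p := by
  unfold psi
  split_ifs with h
  · have h1 : t / ε ^ (2 - p) ≤ ε ^ p := by
      rw [div_le_iff₀ (by positivity), ← Real.rpow_add hε]
      simpa using h.le
    have h2 : 0 ≤ t ^ (p / 2) := by positivity
    nlinarith
  · have : 0 ≤ ε ^ p := by positivity
    linarith

lemma psi_nonneg (hp0 : 0 < p) (hp1 : p < 1) (hε : 0 < ε) {t : ℝ} (ht : 0 ≤ t) :
    0 ≤ psi p ε t :=
  le_trans (by positivity) (rpow_le_psi hp0 hp1 hε ht)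

lemma sq_rpow_half_sub_one (hε : 0 < ε) : (ε ^ 2) ^ (p / 2 - 1) = (ε ^ (2 - p))⁻¹ := by
  rw [← Real.rpow_natCast, ← Real.rpow_mul hε.le, ← Real.rpow_neg hε.le]
  congr 1; push_cast; ring

lemma hasDerivAt_psi (hε : 0 < ε) (t : ℝ) :
    HasDerivAt (psi p ε) (p / 2 * max t (ε ^ 2) ^ (p / 2 - 1)) t := by
  have hε2 : 0 < ε ^ 2 := by positivity
  have hkink : ε ^ p = (ε ^ 2) ^ (p / 2) := by
    rw [← Real.rpow_natCast, ← Real.rpow_mul hε.le]; congr 1; push_cast; ring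
  have hval : p / 2 * (ε ^ 2 / ε ^ (2 - p)) + (1 - p / 2) * ε ^ p = (ε ^ 2) ^ (p / 2) := by
    have : ε ^ 2 / ε ^ (2 - p) = ε ^ p := by
      rw [← Real.rpow_natCast, ← Real.rpow_sub hε]; congr 1; push_cast; ring
    rw [this, ← hkink]; ring
  have key : ∀ y ≠ ε ^ 2, HasDerivAt (psi p ε) (p / 2 * max y (ε ^ 2) ^ (p / 2 - 1)) y := by
    intro y hy
    rcases lt_or_gt_of_ne hy with h | h
    · rw [max_eq_right h.le, sq_rpow_half_sub_one hε]
      have h1 : HasDerivAt (fun t => p / 2 * (t / ε ^ (2 - p)) + (1 - p / 2) * ε ^ p)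
          (p / 2 * (1 / ε ^ (2 - p))) y :=
        (((hasDerivAt_id y).div_const _).const_mul _).add_const _
      rw [one_div] at h1
      refine h1.congr_of_eventuallyEq ?_
      filter_upwards [gt_mem_nhds h] with z hz
      simp [psi, hz]
    · rw [max_eq_left h.le]
      refine (Real.hasDerivAt_rpow_const (Or.inl (hε2.trans h).ne')).congr_of_eventuallyEq ?_
      filter_upwards [lt_mem_nhds h] with z hz
      simp [psi, not_lt.mpr hz.le]
  rcases eq_or_ne t (ε ^ 2) with rfl | ht
  · refine hasDerivAt_of_hasDerivAt_of_ne (g := fun y => p / 2 * max y (ε ^ 2) ^ (p / 2 - 1))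
      key ?_ ?_
    · have hc : Continuous (psi p ε) := by
        have h0 : psi p ε = fun t => if ε ^ 2 ≤ t then t ^ (p / 2)
            else p / 2 * (t / ε ^ (2 - p)) + (1 - p / 2) * ε ^ p := by
          funext t
          simp only [psi, ← not_le, ite_not]
        rw [h0]
        refine continuous_if_le continuous_const continuous_id ?_ (by fun_prop) ?_
        · exact continuousOn_id.rpow_const fun x hx => Or.inl (hε2.trans_le hx).ne'
        · rintro x rfl
          exact hval.symm
      exact hc.continuousAt
    · refine ContinuousAt.mul continuousAt_const (ContinuousAt.rpow_const (by fun_prop) ?_)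
      left; positivity
  · exact key t ht

/-- The derivative of `r ↦ ψ_ε(r²)`. -/
def dpsi (p ε r : ℝ) : ℝ := p * r * max (r ^ 2) (ε ^ 2) ^ (p / 2 - 1)

/-- A Lipschitz constant of `dpsi p ε`. -/
def dpsiLip (p ε : ℝ) : ℝ := 3 * (p * (ε ^ 2) ^ (p / 2 - 1))

lemma hasDerivAt_psi_sq (hε : 0 < ε) (r : ℝ) :
    HasDerivAt (fun r => psi p ε (|r| ^ 2)) (dpsi p ε r) r := by
  simp only [sq_abs]
  have h := (hasDerivAt_psi (p := p) hε (r ^ 2)).comp r (hasDerivAt_pow 2 r)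
  refine h.congr_deriv ?_
  simp only [dpsi]; push_cast; ring

lemma continuous_dpsi (hε : 0 < ε) : Continuous (dpsi p ε) := by
  unfold dpsi
  refine Continuous.mul (by fun_prop) (Continuous.rpow_const (by fun_prop) fun r => ?_)
  left; positivity

lemma dpsi_nonneg_of_nonneg (hp0 : 0 < p) {r : ℝ} (hr : 0 ≤ r) : 0 ≤ dpsi p ε r := by
  unfold dpsi; positivity

lemma dpsi_neg (r : ℝ) : dpsi p ε (-r) = -dpsi p ε r := by
  simp [dpsi]

lemma dpsi_eq_sign_mul_abs (hp0 : 0 < p) (r : ℝ) :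
    dpsi p ε r * SignType.sign r = |dpsi p ε r| := by
  rcases lt_trichotomy r 0 with h | rfl | h
  · have := dpsi_nonneg_of_nonneg (ε := ε) hp0 (neg_nonneg.mpr h.le)
    rw [dpsi_neg] at this
    rw [abs_of_nonpos (by linarith)]
    simp [h]
  · simp [dpsi]
  · simp [h, abs_of_nonneg (dpsi_nonneg_of_nonneg (ε := ε) hp0 h.le)]

lemma max_rpow_le (hε : 0 < ε) (hp1 : p < 1) (r : ℝ) :
    max (r ^ 2) (ε ^ 2) ^ (p / 2 - 1) ≤ (ε ^ 2) ^ (p / 2 - 1) :=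
  Real.rpow_le_rpow_of_nonpos (by positivity) (le_max_right _ _) (by linarith)

lemma abs_dpsi_le (hp0 : 0 < p) (hp1 : p < 1) (hε : 0 < ε) (r : ℝ) :
    |dpsi p ε r| ≤ p * (ε ^ 2) ^ (p / 2 - 1) * |r| := by
  have h := max_rpow_le (p := p) hε hp1 r
  have h0 : 0 ≤ max (r ^ 2) (ε ^ 2) ^ (p / 2 - 1) := by positivity
  rw [dpsi, abs_mul, abs_mul, abs_of_pos hp0, abs_of_nonneg h0]
  nlinarith [mul_le_mul_of_nonneg_left h (mul_nonneg hp0.le (abs_nonneg r))]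

lemma abs_dpsi_sub_le_of_abs_le (hp0 : 0 < p) (hp1 : p < 1) (hε : 0 < ε) {r r' : ℝ}
    (h : |r'| ≤ |r|) : |dpsi p ε r - dpsi p ε r'| ≤ dpsiLip p ε * |r - r'| := by
  set b := max (r ^ 2) (ε ^ 2) with hb
  set b' := max (r' ^ 2) (ε ^ 2) with hb'
  set q := p / 2 - 1 with hq
  set c := (ε ^ 2) ^ q with hc
  have hε2 : 0 < ε ^ 2 := by positivity
  have hb0 : 0 < b := hε2.trans_le (le_max_right _ _)
  have hb'0 : 0 < b' := hε2.trans_le (le_max_right _ _)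
  have hr2 : r' ^ 2 ≤ r ^ 2 := sq_le_sq.mpr h
  have hbb : b' ≤ b := max_le_max_right _ hr2
  have hbc : b ^ q ≤ c := max_rpow_le hε hp1 r
  have hb'c : b' ^ q ≤ c := max_rpow_le hε hp1 r'
  have hbq0 : 0 < b ^ q := by positivity
  have hb'q0 : 0 < b' ^ q := by positivity
  have hmono : b ^ q ≤ b' ^ q := Real.rpow_le_rpow_of_nonpos hb'0 hbb (by linarith)
  -- the increment of `b ↦ b ^ q` is controlled because `-1 ≤ q ≤ 0`
  have hx : b' ^ q * (b' / b) ≤ b ^ q := by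
    have hx1 : b' / b ≤ 1 := (div_le_one hb0).mpr hbb
    have h1 : b' / b ≤ (b' / b) ^ (-q) := by
      conv_lhs => rw [← Real.rpow_one (b' / b)]
      exact Real.rpow_le_rpow_of_exponent_ge (by positivity) hx1 (by linarith)
    calc b' ^ q * (b' / b) ≤ b' ^ q * (b' / b) ^ (-q) := by gcongr
      _ = b ^ q := by
        rw [Real.div_rpow hb'0.le hb0.le, Real.rpow_neg hb'0.le, Real.rpow_neg hb0.le]
        field_simp
  have hdiff : b' ^ q - b ^ q ≤ b' ^ q * ((b - b') / b) := by
    rw [sub_div, div_self hb0.ne', mul_sub, mul_one]; linarith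
  have hbd : |r'| * ((b - b') / b) ≤ 2 * |r - r'| := by
    rw [mul_div_assoc', div_le_iff₀ hb0]
    have hd0 : 0 ≤ |r - r'| := abs_nonneg _
    have h3 : |r| - |r'| ≤ |r - r'| := abs_sub_abs_le_abs_sub r r'
    have h4 : b - b' ≤ r ^ 2 - r' ^ 2 := by
      rcases le_total (r' ^ 2) (ε ^ 2) with h5 | h5
      · rcases le_total (r ^ 2) (ε ^ 2) with h6 | h6
        · rw [hb, hb', max_eq_right h5, max_eq_right h6]; linarith
        · rw [hb, hb', max_eq_right h5, max_eq_left h6]; linarith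
      · rw [hb, hb', max_eq_left h5, max_eq_left (h5.trans hr2)]
    have h5 : r ^ 2 - r' ^ 2 = (|r| - |r'|) * (|r| + |r'|) := by
      rw [← sq_abs r, ← sq_abs r']; ring
    have h6 : r ^ 2 ≤ b := le_max_left _ _
    have h7 : 0 ≤ |r'| := abs_nonneg _
    calc |r'| * (b - b') ≤ |r'| * ((|r| - |r'|) * (|r| + |r'|)) := by rw [← h5]; gcongr
      _ ≤ |r| * (|r - r'| * (|r| + |r|)) := by gcongr
      _ = 2 * |r - r'| * r ^ 2 := by rw [← sq_abs r]; ring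
      _ ≤ 2 * |r - r'| * b := by gcongr
  have e : dpsi p ε r - dpsi p ε r' = p * ((r - r') * b ^ q - r' * (b' ^ q - b ^ q)) := by
    simp only [dpsi]; ring
  rw [e, abs_mul, abs_of_pos hp0, dpsiLip]
  have h8 : |(r - r') * b ^ q - r' * (b' ^ q - b ^ q)|
      ≤ |r - r'| * b ^ q + |r'| * (b' ^ q - b ^ q) := by
    refine (abs_sub _ _).trans (le_of_eq ?_)
    rw [abs_mul, abs_mul, abs_of_pos hbq0, abs_of_nonneg (sub_nonneg.mpr hmono)]
  have h9 : |r'| * (b' ^ q - b ^ q) ≤ 2 * |r - r'| * c := by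
    calc |r'| * (b' ^ q - b ^ q) ≤ |r'| * (b' ^ q * ((b - b') / b)) := by gcongr
      _ = b' ^ q * (|r'| * ((b - b') / b)) := by ring
      _ ≤ c * (2 * |r - r'|) := by
        refine mul_le_mul hb'c hbd ?_ (hb'q0.le.trans hb'c)
        have : 0 ≤ b - b' := sub_nonneg.mpr hbb
        positivity
      _ = 2 * |r - r'| * c := by ring
  have h10 : |r - r'| * b ^ q ≤ |r - r'| * c := by gcongr
  calc p * |(r - r') * b ^ q - r' * (b' ^ q - b ^ q)|
      ≤ p * (|r - r'| * c + 2 * |r - r'| * c) := by gcongr; linarith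
    _ = 3 * (p * c) * |r - r'| := by ring

lemma abs_dpsi_sub_le (hp0 : 0 < p) (hp1 : p < 1) (hε : 0 < ε) (r r' : ℝ) :
    |dpsi p ε r - dpsi p ε r'| ≤ dpsiLip p ε * |r - r'| := by
  rcases le_total |r'| |r| with h | h
  · exact abs_dpsi_sub_le_of_abs_le hp0 hp1 hε h
  · rw [abs_sub_comm, abs_sub_comm r]
    exact abs_dpsi_sub_le_of_abs_le hp0 hp1 hε h

lemma dpsiLip_nonneg (hp0 : 0 < p) : 0 ≤ dpsiLip p ε := by
  unfold dpsiLip; positivity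

lemma abs_psi_taylor_le (hp0 : 0 < p) (hp1 : p < 1) (hε : 0 < ε) (r q : ℝ) :
    |psi p ε (|r + q| ^ 2) - psi p ε (|r| ^ 2) - dpsi p ε r * q| ≤ dpsiLip p ε * q ^ 2 := by
  have hd (t : ℝ) : HasDerivAt (fun t => psi p ε (|r + t| ^ 2) - dpsi p ε r * t)
      (dpsi p ε (r + t) - dpsi p ε r) t := by
    have h1 := (hasDerivAt_psi_sq (p := p) hε (r + t)).comp_const_add r t
    have h2 := h1.sub ((hasDerivAt_id t).const_mul (dpsi p ε r))
    rw [mul_one] at h2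
    exact h2
  have h := (convex_uIcc (0 : ℝ) q).norm_image_sub_le_of_norm_hasDerivWithin_le
    (C := dpsiLip p ε * |q|) (fun t _ => (hd t).hasDerivWithinAt) (fun t ht => ?_)
    left_mem_uIcc right_mem_uIcc
  · simp only [mul_zero, sub_zero, add_zero, Real.norm_eq_abs] at h
    rw [mul_assoc, abs_mul_abs_self, ← sq] at h
    refine le_trans (le_of_eq ?_) h
    congr 1; ring
  · rw [Real.norm_eq_abs]
    refine (abs_dpsi_sub_le hp0 hp1 hε _ _).trans ?_
    have h2 : |t| ≤ |q| := by simpa using abs_sub_left_of_mem_uIcc ht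
    simp only [add_sub_cancel_left]
    exact mul_le_mul_of_nonneg_left h2 (dpsiLip_nonneg hp0)

end Psi

section SmoothG

variable {d : ℕ} {Ω : Set (Space d)} {p ε : ℝ}

lemma continuous_psi_sq (hε : 0 < ε) : Continuous fun r : ℝ => psi p ε (|r| ^ 2) :=
  continuous_iff_continuousAt.mpr fun r => (hasDerivAt_psi_sq hε r).continuousAt

lemma smoothG_zero (w : L2 Ω) : smoothG Ω p 0 w = ∫ x in Ω, (|w x| ^ 2) ^ (p / 2) := by
  unfold smoothG
  exact integral_congr_ae (Eventually.of_forall fun x => psi_zero (by positivity))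

lemma memLp_dpsi (hp0 : 0 < p) (hp1 : p < 1) (hε : 0 < ε) (w : L2 Ω) :
    MemLp (fun x => dpsi p ε (w x)) 2 (volume.restrict Ω) := by
  refine MemLp.of_le_mul (Lp.memLp w)
    ((continuous_dpsi hε).comp_aestronglyMeasurable (Lp.aestronglyMeasurable w))
    (c := p * (ε ^ 2) ^ (p / 2 - 1)) (Eventually.of_forall fun x => ?_)
  exact abs_dpsi_le hp0 hp1 hε _

variable [IsFiniteMeasure (volume.restrict Ω)]

lemma integrable_rpow (hp0 : 0 < p) (hp1 : p < 1) (w : L2 Ω) :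
    Integrable (fun x => (|w x| ^ 2) ^ (p / 2)) (volume.restrict Ω) := by
  have h2 : Integrable (fun x => (w x) ^ 2) (volume.restrict Ω) := (Lp.memLp w).integrable_sq
  refine Integrable.mono' (h2.add (integrable_const 1)) ?_ (Eventually.of_forall fun x => ?_)
  · exact (((Lp.aestronglyMeasurable w).aemeasurable.norm.pow_const 2).pow_const _
      ).aestronglyMeasurable
  · have h0 : 0 ≤ (|w x| ^ 2) ^ (p / 2) := by positivity
    rw [Real.norm_of_nonneg h0]
    simp only [sq_abs, Pi.add_apply]
    rcases le_total ((w x) ^ 2) 1 with h | h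
    · have := Real.rpow_le_one (sq_nonneg (w x)) h (by positivity : 0 ≤ p / 2)
      nlinarith [sq_nonneg (w x)]
    · have := Real.rpow_le_rpow_of_exponent_le h (by linarith : p / 2 ≤ 1)
      rw [Real.rpow_one] at this; linarith

lemma integrable_psi (hp0 : 0 < p) (hp1 : p < 1) (hε : 0 < ε) (w : L2 Ω) :
    Integrable (fun x => psi p ε (|w x| ^ 2)) (volume.restrict Ω) := by
  refine Integrable.mono' ((integrable_rpow hp0 hp1 w).add (integrable_const (ε ^ p))) ?_
    (Eventually.of_forall fun x => ?_)
  · exact (continuous_psi_sq hε).comp_aestronglyMeasurable (Lp.aestronglyMeasurable w)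
  · rw [Real.norm_of_nonneg (psi_nonneg hp0 hp1 hε (by positivity))]
    exact psi_le_rpow_add hp0 hε (by positivity)

lemma smoothG_zero_le (hp0 : 0 < p) (hp1 : p < 1) (hε : 0 < ε) (w : L2 Ω) :
    smoothG Ω p 0 w ≤ smoothG Ω p ε w := by
  rw [smoothG_zero]
  exact integral_mono (integrable_rpow hp0 hp1 w) (integrable_psi hp0 hp1 hε w)
    fun x => rpow_le_psi hp0 hp1 hε (by positivity)

lemma smoothG_le (hp0 : 0 < p) (hp1 : p < 1) (hε : 0 < ε) (w : L2 Ω) :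
    smoothG Ω p ε w ≤ smoothG Ω p 0 w + ε ^ p * volume.real Ω := by
  rw [smoothG_zero]
  refine (integral_mono (integrable_psi hp0 hp1 hε w)
    ((integrable_rpow hp0 hp1 w).add (integrable_const (ε ^ p)))
    fun x => psi_le_rpow_add hp0 hε (by positivity)).trans (le_of_eq ?_)
  simp only [Pi.add_apply]
  rw [integral_add (integrable_rpow hp0 hp1 w) (integrable_const _)]
  simp [mul_comm]

lemma norm_sq_eq_integral {X : Type*} [MeasurableSpace X] {μ : Measure X} (w : Lp ℝ 2 μ) :
    ‖w‖ ^ 2 = ∫ x, (w x) ^ 2 ∂μ := by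
  rw [← real_inner_self_eq_norm_sq, L2.inner_def]
  simp [sq]

lemma inner_toLp_eq_integral {X : Type*} [MeasurableSpace X] {μ : Measure X} {g : X → ℝ}
    (hg : MemLp g 2 μ) (w : Lp ℝ 2 μ) : inner ℝ (hg.toLp g) w = ∫ x, g x * w x ∂μ := by
  rw [L2.inner_def]
  refine integral_congr_ae ?_
  filter_upwards [hg.coeFn_toLp] with x hx
  simp [hx, mul_comm]

lemma abs_smoothG_taylor_le (hp0 : 0 < p) (hp1 : p < 1) (hε : 0 < ε) (w q : L2 Ω) :
    |smoothG Ω p ε (w + q) - smoothG Ω p ε w - inner ℝ ((memLp_dpsi hp0 hp1 hε w).toLp _) q|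
      ≤ dpsiLip p ε * ‖q‖ ^ 2 := by
  have hi : Integrable (fun x => dpsi p ε (w x) * q x) (volume.restrict Ω) :=
    (memLp_dpsi hp0 hp1 hε w).integrable_mul (Lp.memLp q)
  have h0 : smoothG Ω p ε (w + q) = ∫ x in Ω, psi p ε (|w x + q x| ^ 2) := by
    refine integral_congr_ae ?_
    filter_upwards [Lp.coeFn_add w q] with x hx
    rw [hx, Pi.add_apply]
  have hi' : Integrable (fun x => psi p ε (|w x + q x| ^ 2)) (volume.restrict Ω) := by
    refine (integrable_psi hp0 hp1 hε (w + q)).congr ?_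
    filter_upwards [Lp.coeFn_add w q] with x hx
    rw [hx, Pi.add_apply]
  rw [inner_toLp_eq_integral, h0, smoothG, ← integral_sub hi' (integrable_psi hp0 hp1 hε w),
    ← integral_sub (by exact hi'.sub (integrable_psi hp0 hp1 hε w)) hi, norm_sq_eq_integral,
    ← integral_const_mul]
  refine abs_integral_le_integral_abs.trans (integral_mono_of_nonneg
    (Eventually.of_forall fun x => abs_nonneg _) ((Lp.memLp q).integrable_sq.const_mul _)
    (Eventually.of_forall fun x => abs_psi_taylor_le hp0 hp1 hε _ _))

lemma multiplier_eq (hp0 : 0 < p) (hp1 : p < 1) (hε : 0 < ε) (w : L2 Ω) :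
    multiplier Ω p ε w = (memLp_dpsi hp0 hp1 hε w).toLp _ := by
  refine HasGradientAt.gradient ?_
  rw [hasGradientAt_iff_isLittleO]
  have hO : (fun w' => smoothG Ω p ε w' - smoothG Ω p ε w
      - inner ℝ ((memLp_dpsi hp0 hp1 hε w).toLp _) (w' - w)) =O[𝓝 w]
      fun w' => ‖w' - w‖ ^ 2 := by
    refine Asymptotics.IsBigO.of_bound (dpsiLip p ε) (Eventually.of_forall fun w' => ?_)
    have := abs_smoothG_taylor_le hp0 hp1 hε w (w' - w)
    rw [add_sub_cancel] at this
    simpa using this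
  refine hO.trans_isLittleO ?_
  have : Tendsto (fun w' : L2 Ω => ‖w' - w‖) (𝓝 w) (𝓝 0) := by
    have hc : Continuous fun w' : L2 Ω => ‖w' - w‖ := by fun_prop
    simpa using hc.tendsto w
  rw [← Asymptotics.isLittleO_norm_right]
  simp only [sq]
  simpa using ((Asymptotics.isLittleO_one_iff ℝ).mpr this).mul_isBigO
    (Asymptotics.isBigO_refl (fun w' : L2 Ω => ‖w' - w‖) (𝓝 w))

lemma multiplier_ae (hp0 : 0 < p) (hp1 : p < 1) (hε : 0 < ε) (w : L2 Ω) :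
    multiplier Ω p ε w =ᵐ[volume.restrict Ω] fun x => dpsi p ε (w x) := by
  rw [multiplier_eq hp0 hp1 hε]
  exact MemLp.coeFn_toLp _

lemma abs_smoothG_multiplier_le (hp0 : 0 < p) (hp1 : p < 1) (hε : 0 < ε) (w q : L2 Ω) :
    |smoothG Ω p ε (w + q) - smoothG Ω p ε w - inner ℝ (multiplier Ω p ε w) q|
      ≤ dpsiLip p ε * ‖q‖ ^ 2 := by
  rw [multiplier_eq hp0 hp1 hε]
  exact abs_smoothG_taylor_le hp0 hp1 hε w q

end SmoothG

end SparseControl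
end

noncomputable section

namespace SparseControl

variable {d : ℕ}

/-! ### Hilbert space models of the fractional Sobolev spaces -/

/-- `J` identifies the subspace `W` of `L²(Ω)` with a closed subspace of a Hilbert space; the norm
`z ↦ ‖J z‖` is stronger than that of `L²(Ω)`, bounded sequences are compact with respect to
convergence almost everywhere, normal contractions operate on `W`, and `W` contains the test
functions. -/
structure EnergyModel {Ω : Set (Space d)} (W : Submodule ℝ (L2 Ω)) {H : Type*}
    [NormedAddCommGroup H] [InnerProductSpace ℝ H] (J : W →ₗ[ℝ] H) : Prop where
  closed : ∀ (x : ℕ → W) (w : L2 Ω) (y : H), Tendsto (fun n => (x n : L2 Ω)) atTop (𝓝 w) →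
    Tendsto (fun n => J (x n)) atTop (𝓝 y) → ∃ z : W, (z : L2 Ω) = w ∧ J z = y
  bound : ∃ C : ℝ, ∀ z : W, ‖(z : L2 Ω)‖ ≤ C * ‖J z‖
  compact : ∀ (x : ℕ → W) (z : W) (M : ℝ), (∀ n, ‖J (x n)‖ ≤ M) →
    WeakTendsto (fun n => (x n : L2 Ω)) z → ∃ φ : ℕ → ℕ, StrictMono φ ∧
      ∀ᵐ a ∂volume.restrict Ω, Tendsto (fun n => (x (φ n) : L2 Ω) a) atTop (𝓝 ((z : L2 Ω) a))
  contract : ∀ T : ℝ → ℝ, ContDiff ℝ ∞ T → T 0 = 0 → (∀ r, |deriv T r| ≤ 1) → ∀ z : W,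
    ∃ z' : W, (z' : L2 Ω) =ᵐ[volume.restrict Ω] (fun a => T ((z : L2 Ω) a)) ∧ ‖J z'‖ ≤ ‖J z‖
  test : ∀ v : Space d → ℝ, IsTestFunction Ω v →
    ∃ z : W, (z : L2 Ω) =ᵐ[volume.restrict Ω] v

/-! ### Negative parts in `L²` -/

section NegPart

variable {X : Type*} [MeasurableSpace X] {μ : Measure X}

lemma memLp_min_zero (v : Lp ℝ 2 μ) : MemLp (fun x => min (v x) 0) 2 μ := by
  refine (Lp.memLp v).mono ?_ (Eventually.of_forall fun x => ?_)
  · exact ((Lp.aestronglyMeasurable v).aemeasurable.min aemeasurable_const).aestronglyMeasurable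
  · simp only [Real.norm_eq_abs]
    rcases le_total (v x) 0 with h | h
    · rw [min_eq_left h]
    · rw [min_eq_right h]; simp

/-- The nonpositive function `min(v,0)`. -/
def negP (v : Lp ℝ 2 μ) : Lp ℝ 2 μ := (memLp_min_zero v).toLp _

lemma negP_ae (v : Lp ℝ 2 μ) : negP v =ᵐ[μ] fun x => min (v x) 0 := MemLp.coeFn_toLp _

lemma norm_negP_sq (v : Lp ℝ 2 μ) : ‖negP v‖ ^ 2 = ∫ x, min (v x) 0 ^ 2 ∂μ := by
  rw [norm_sq_eq_integral]
  refine integral_congr_ae ?_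
  filter_upwards [negP_ae v] with x hx
  rw [hx]

lemma inner_eq_integral (v w : Lp ℝ 2 μ) : inner ℝ v w = ∫ x, v x * w x ∂μ := by
  rw [L2.inner_def]
  simp [mul_comm]

lemma integrable_mul_Lp (v w : Lp ℝ 2 μ) : Integrable (fun x => v x * w x) μ :=
  (Lp.memLp v).integrable_mul (Lp.memLp w)

lemma min_zero_sq_add_le (r q : ℝ) :
    min (r + q) 0 ^ 2 ≤ min r 0 ^ 2 + 2 * (min r 0 * q) + q ^ 2 := by
  rcases le_total r 0 with h | h <;> rcases le_total (r + q) 0 with h' | h' <;>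
    simp only [min_eq_left, min_eq_right, h, h'] <;> nlinarith

lemma norm_negP_add_sq_le (v h : Lp ℝ 2 μ) :
    ‖negP (v + h)‖ ^ 2 ≤ ‖negP v‖ ^ 2 + 2 * inner ℝ (negP v) h + ‖h‖ ^ 2 := by
  have e : ‖negP (v + h)‖ ^ 2 = ∫ x, min (v x + h x) 0 ^ 2 ∂μ := by
    rw [norm_negP_sq]
    refine integral_congr_ae ?_
    filter_upwards [Lp.coeFn_add v h] with x hx
    rw [hx, Pi.add_apply]
  have i1 : Integrable (fun x => min (v x) 0 ^ 2) μ := (memLp_min_zero v).integrable_sq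
  have i2 : Integrable (fun x => min (v x) 0 * h x) μ :=
    (memLp_min_zero v).integrable_mul (Lp.memLp h)
  have i3 : Integrable (fun x => (h x) ^ 2) μ := (Lp.memLp h).integrable_sq
  have e2 : inner ℝ (negP v) h = ∫ x, min (v x) 0 * h x ∂μ := inner_toLp_eq_integral _ _
  rw [e, norm_negP_sq, e2, norm_sq_eq_integral, ← integral_const_mul, ← integral_add i1
    (i2.const_mul 2), ← integral_add (by exact i1.add (i2.const_mul 2)) i3]
  exact integral_mono_of_nonneg (Eventually.of_forall fun x => sq_nonneg _)
    ((i1.add (i2.const_mul 2)).add i3) (Eventually.of_forall fun x => min_zero_sq_add_le _ _)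

lemma inner_negP_eq (v : Lp ℝ 2 μ) : inner ℝ (negP v) v = ‖negP v‖ ^ 2 := by
  rw [norm_negP_sq, negP, inner_toLp_eq_integral]
  refine integral_congr_ae (Eventually.of_forall fun x => ?_)
  change min (v x) 0 * v x = min (v x) 0 ^ 2
  rcases le_total (v x) 0 with h | h
  · rw [min_eq_left h]; ring
  · rw [min_eq_right h]; ring

lemma inner_negP_le (v w : Lp ℝ 2 μ) :
    inner ℝ (negP v) (negP w) ≥ inner ℝ v (negP w) := by
  rw [inner_eq_integral, inner_eq_integral]
  refine integral_mono_ae (integrable_mul_Lp _ _) (integrable_mul_Lp _ _) ?_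
  filter_upwards [negP_ae v, negP_ae w] with x hx hy
  simp only [hx, hy]
  exact mul_le_mul_of_nonpos_right (min_le_left _ _) (min_le_right _ _)

/-- Weak limits of functions whose negative parts tend to zero are nonnegative. -/
lemma nonneg_of_weakTendsto {v : ℕ → Lp ℝ 2 μ} {v' : Lp ℝ 2 μ} (h : WeakTendsto v v')
    (h0 : Tendsto (fun n => ‖negP (v n)‖) atTop (𝓝 0)) : ∀ᵐ x ∂μ, 0 ≤ v' x := by
  have h1 : Tendsto (fun n => ‖negP (v n)‖ * ‖negP v'‖) atTop (𝓝 0) := by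
    simpa using h0.mul_const ‖negP v'‖
  have h2 : inner ℝ v' (negP v') ≤ 0 := le_of_tendsto_of_tendsto' (h (negP v')) h1 fun n =>
    (inner_negP_le _ _).trans (real_inner_le_norm _ _)
  rw [real_inner_comm, inner_negP_eq] at h2
  have h3 : negP v' = 0 := by
    have := sq_nonneg ‖negP v'‖
    rw [← norm_eq_zero]
    exact pow_eq_zero_iff (two_ne_zero) |>.mp (le_antisymm h2 this)
  filter_upwards [negP_ae v', Lp.coeFn_zero ℝ 2 μ, (by rw [h3] : negP v' =ᵐ[μ] (0 : Lp ℝ 2 μ))]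
    with x hx hx0 hx1
  rw [hx1, hx0] at hx
  exact min_eq_right_iff.mp hx.symm

end NegPart

/-! ### Extension constant in time -/

section Cylinder

variable (T : ℝ) (Ω : Set (Space d))

lemma memLp_comp_snd (w : L2 Ω) : MemLp (fun z : ℝ × Space d => w z.2) 2 (cylMeasure T Ω) :=
  (Lp.memLp w).comp_snd _

/-- The extension of functions on `Ω` to `I × Ω`, constant in time. -/
def liftCyl : L2 Ω →L[ℝ] ControlSpace T Ω :=
  LinearMap.mkContinuous
    { toFun := fun w => (memLp_comp_snd T Ω w).toLp _
      map_add' := fun u w => by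
        rw [← MemLp.toLp_add, MemLp.toLp_eq_toLp_iff]
        exact Measure.quasiMeasurePreserving_snd.ae_eq (Lp.coeFn_add u w)
      map_smul' := fun c w => by
        rw [RingHom.id_apply, ← MemLp.toLp_const_smul, MemLp.toLp_eq_toLp_iff]
        exact Measure.quasiMeasurePreserving_snd.ae_eq (Lp.coeFn_smul c w) }
    (((volume.restrict (Ioo 0 T)) univ) ^ (1 / 2 : ℝ)).toReal (by
      intro w
      have h : eLpNorm (fun z : ℝ × Space d => w z.2) 2 (cylMeasure T Ω)
          = ((volume.restrict (Ioo 0 T)) univ) ^ (1 / 2 : ℝ)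
            * eLpNorm w 2 (volume.restrict Ω) := by
        have h1 := eLpNorm_map_measure (p := 2) (μ := cylMeasure T Ω) (f := Prod.snd) (g := w)
          (by
            rw [Measure.map_snd_prod]
            exact (Lp.aestronglyMeasurable w).smul_measure _) measurable_snd.aemeasurable
        rw [Measure.map_snd_prod, eLpNorm_smul_measure_of_ne_top (by simp)] at h1
        rw [← Function.comp_def, ← h1]
        simp
      change ‖(memLp_comp_snd T Ω w).toLp _‖ ≤ _
      rw [Lp.norm_toLp, h, ENNReal.toReal_mul, Lp.norm_def])

lemma liftCyl_ae (w : L2 Ω) : liftCyl T Ω w =ᵐ[cylMeasure T Ω] fun z => w z.2 :=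
  (memLp_comp_snd T Ω w).coeFn_toLp

lemma weakTendsto_liftCyl {w : ℕ → L2 Ω} {w' : L2 Ω} (h : WeakTendsto w w') :
    WeakTendsto (fun n => liftCyl T Ω (w n)) (liftCyl T Ω w') := by
  intro g
  simpa only [ContinuousLinearMap.adjoint_inner_right] using
    h (ContinuousLinearMap.adjoint (liftCyl T Ω) g)

lemma liftCyl_sub_ae (u : ControlSpace T Ω) (w : L2 Ω) :
    (liftCyl T Ω w - u : ControlSpace T Ω) =ᵐ[cylMeasure T Ω] fun z => w z.2 - u z := by
  filter_upwards [Lp.coeFn_sub (liftCyl T Ω w) u, liftCyl_ae T Ω w] with z h1 h2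
  rw [h1, Pi.sub_apply, h2]

lemma liftCyl_add_ae (u : ControlSpace T Ω) (w : L2 Ω) :
    (liftCyl T Ω w + u : ControlSpace T Ω) =ᵐ[cylMeasure T Ω] fun z => w z.2 + u z := by
  filter_upwards [Lp.coeFn_add (liftCyl T Ω w) u, liftCyl_ae T Ω w] with z h1 h2
  rw [h1, Pi.add_apply, h2]

variable {T Ω}

lemma auxObjective_eq (s : ℝ) (κ : SobolevType) (f : ControlSpace T Ω → ℝ) (α β γ p ε : ℝ)
    (ubar u : ControlSpace T Ω) (wbar w : L2 Ω) :
    auxObjective T Ω s κ f α β γ p ε ubar wbar u w =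
      objective T Ω s κ f α β γ p ε u w + 1 / 2 * ‖u - ubar‖ ^ 2 + 1 / 2 * ‖w - wbar‖ ^ 2
      + 1 / (2 * ε) * ‖negP (liftCyl T Ω w - u)‖ ^ 2
      + 1 / (2 * ε) * ‖negP (liftCyl T Ω w + u)‖ ^ 2 := by
  have h1 : ‖negP (liftCyl T Ω w - u)‖ ^ 2
      = ∫ z, min (w z.2 - u z) 0 ^ 2 ∂cylMeasure T Ω := by
    rw [norm_negP_sq]
    refine integral_congr_ae ?_
    filter_upwards [liftCyl_sub_ae T Ω u w] with z h
    rw [h]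
  have h2 : ‖negP (liftCyl T Ω w + u)‖ ^ 2
      = ∫ z, min (w z.2 + u z) 0 ^ 2 ∂cylMeasure T Ω := by
    rw [norm_negP_sq]
    refine integral_congr_ae ?_
    filter_upwards [liftCyl_add_ae T Ω u w] with z h
    rw [h]
  rw [auxObjective, h1, h2]

lemma auxObjective_of_admissible {s : ℝ} {κ : SobolevType} (f : ControlSpace T Ω → ℝ)
    (α β γ p ε : ℝ) {u : ControlSpace T Ω} {w : L2 Ω} (h : IsAdmissible T Ω s κ u w) :
    auxObjective T Ω s κ f α β γ p ε u w u w = objective T Ω s κ f α β γ p ε u w := by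
  have h1 : ∫ z, min (w z.2 - u z) 0 ^ 2 ∂cylMeasure T Ω = 0 := by
    refine integral_eq_zero_of_ae ?_
    filter_upwards [h.2] with z hz
    rw [min_eq_right (by linarith [le_abs_self (u z)])]; simp
  have h2 : ∫ z, min (w z.2 + u z) 0 ^ 2 ∂cylMeasure T Ω = 0 := by
    refine integral_eq_zero_of_ae ?_
    filter_upwards [h.2] with z hz
    rw [min_eq_right (by linarith [neg_abs_le (u z)])]; simp
  simp [auxObjective, h1, h2]

end Cylinder

/-! ### Lower semicontinuity -/

lemma WeaklyLSC.eventually_le {H : Type*} [NormedAddCommGroup H] [InnerProductSpace ℝ H]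
    {f : H → ℝ} (hf : WeaklyLSC f) {x : ℕ → H} {y : H} (h : WeakTendsto x y) {η : ℝ}
    (hη : 0 < η) : ∀ᶠ n in atTop, f y - η ≤ f (x n) := by
  have h1 : ((f y - η : ℝ) : EReal) < liminf (fun n => (f (x n) : EReal)) atTop :=
    lt_of_lt_of_le (by exact_mod_cast sub_lt_self _ hη) (hf x y h)
  filter_upwards [eventually_lt_of_lt_liminf h1] with n hn
  exact le_of_lt (by exact_mod_cast hn)

lemma smoothG_zero_eventually_le {Ω : Set (Space d)} [IsFiniteMeasure (volume.restrict Ω)] {p : ℝ}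
    (hp0 : 0 < p) (hp1 : p < 1) {w : ℕ → L2 Ω} {w' : L2 Ω}
    (h : ∀ᵐ a ∂volume.restrict Ω, Tendsto (fun n => w n a) atTop (𝓝 (w' a))) {η : ℝ}
    (hη : 0 < η) : ∀ᶠ n in atTop, smoothG Ω p 0 w' - η ≤ smoothG Ω p 0 (w n) := by
  have hc : Continuous fun r : ℝ => (|r| ^ 2) ^ (p / 2) :=
    Continuous.rpow_const (by fun_prop) fun r => Or.inr (by positivity)
  have hG (v : L2 Ω) : ENNReal.ofReal (smoothG Ω p 0 v)
      = ∫⁻ a in Ω, ENNReal.ofReal ((|v a| ^ 2) ^ (p / 2)) := by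
    rw [smoothG_zero, ofReal_integral_eq_lintegral_ofReal (integrable_rpow hp0 hp1 v)
      (Eventually.of_forall fun a => by positivity)]
  have h0 (v : L2 Ω) : 0 ≤ smoothG Ω p 0 v := by
    rw [smoothG_zero]; exact integral_nonneg fun a => by positivity
  have hF : ENNReal.ofReal (smoothG Ω p 0 w')
      ≤ liminf (fun n => ENNReal.ofReal (smoothG Ω p 0 (w n))) atTop := by
    simp only [hG]
    refine le_trans (le_of_eq ?_) (lintegral_liminf_le' fun n => ?_)
    · refine lintegral_congr_ae ?_
      filter_upwards [h] with a ha
      exact (((ENNReal.continuous_ofReal.comp hc).tendsto _).comp ha).liminf_eq.symm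
    · exact ((ENNReal.continuous_ofReal.comp hc).comp_aestronglyMeasurable
        (Lp.aestronglyMeasurable (w n))).aemeasurable
  rcases lt_or_ge (smoothG Ω p 0 w' - η) 0 with hneg | hpos
  · exact Eventually.of_forall fun n => hneg.le.trans (h0 _)
  · have h1 : ENNReal.ofReal (smoothG Ω p 0 w' - η)
        < liminf (fun n => ENNReal.ofReal (smoothG Ω p 0 (w n))) atTop :=
      lt_of_lt_of_le ((ENNReal.ofReal_lt_ofReal_iff_of_nonneg hpos).mpr (by linarith)) hF
    filter_upwards [eventually_lt_of_lt_liminf h1] with n hn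
    exact ((ENNReal.ofReal_lt_ofReal_iff_of_nonneg hpos).mp hn).le

end SparseControl
end

noncomputable section

namespace SparseControl

variable {d : ℕ}

/-! ### Convergence of the solutions of the auxiliary problems -/

section Convergence

variable {T : ℝ} {Ω : Set (Space d)} [IsFiniteMeasure (volume.restrict Ω)] {s : ℝ}
  {κ : SobolevType} {H : Type*} [NormedAddCommGroup H] [InnerProductSpace ℝ H] [CompleteSpace H]
  {J : fracSobolev Ω s κ →ₗ[ℝ] H} {f : ControlSpace T Ω → ℝ} {α β γ p ρ : ℝ}
  {ubar : ControlSpace T Ω} {wbar : L2 Ω} {ε : ℕ → ℝ} {u : ℕ → ControlSpace T Ω} {w : ℕ → L2 Ω}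

lemma WeakTendsto.eventually_norm_sub_sq_le {E : Type*} [NormedAddCommGroup E]
    [InnerProductSpace ℝ E] {x : ℕ → E} {y : E} (h : WeakTendsto x y) {η : ℝ} (hη : 0 < η) :
    ∀ᶠ n in atTop, ‖x n - y‖ ^ 2 ≤ ‖x n‖ ^ 2 - ‖y‖ ^ 2 + 2 * η := by
  have h1 := h y
  rw [real_inner_self_eq_norm_sq] at h1
  filter_upwards [h1.eventually (lt_mem_nhds (sub_lt_self (‖y‖ ^ 2) hη))] with n hn
  rw [norm_sub_sq_real]; linarith

lemma tendsto_zero_of_sq_le {a S : ℕ → ℝ} {c : ℝ} (hc : 0 < c) (ha : ∀ n, 0 ≤ a n)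
    (h : ∀ n, c * a n ^ 2 ≤ S n) (hS : Tendsto S atTop (𝓝 0)) : Tendsto a atTop (𝓝 0) := by
  have h1 : Tendsto (fun n => √(S n / c)) atTop (𝓝 0) := by
    have := (Real.continuous_sqrt.tendsto _).comp (hS.div_const c)
    simpa [Function.comp_def] using this
  refine squeeze_zero ha (fun n => ?_) h1
  refine Real.le_sqrt_of_sq_le ?_
  rw [le_div_iff₀ hc, mul_comm]
  exact h n

/-- Weak subsequential limits of the solutions of the auxiliary problems: the objective values are
controlled in the limit, and the limit is admissible. -/
lemma exists_subseq_tendsto (hJ : EnergyModel (fracSobolev Ω s κ) J)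
    (hn : ∀ z : fracSobolev Ω s κ, wNorm Ω s κ z = ‖J z‖)
    (hf_lsc : WeaklyLSC f)
    (hf_below : ∃ (g : StrongDual ℝ (ControlSpace T Ω)) (c : ℝ), ∀ u, g u + c ≤ f u)
    (hα : 0 < α) (hβ : 0 < β) (hγ : 0 < γ) (hp0 : 0 < p) (hp1 : p < 1)
    (hloc : IsLocalSolution T Ω s κ f α β γ p ρ ubar wbar)
    (hε_pos : ∀ k, 0 < ε k) (hε_lim : Tendsto ε atTop (𝓝 0))
    (hsol : ∀ k, IsAuxSolution T Ω s κ f α β γ p (ε k) ρ ubar wbar (u k) (w k)) :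
    ∃ φ : ℕ → ℕ, Tendsto (fun n => ‖u (φ n) - ubar‖ + wNorm Ω s κ (w (φ n) - wbar)) atTop
      (𝓝 0) := by
  obtain ⟨hadm, hmin⟩ := hloc
  have hρ : 0 ≤ ρ := (norm_nonneg _).trans (hsol 0).1.2.1
  let z (k : ℕ) : fracSobolev Ω s κ := ⟨w k, (hsol k).1.1⟩
  let zb : fracSobolev Ω s κ := ⟨wbar, hadm.1⟩
  have hzb (k : ℕ) : ‖J (z k - zb)‖ ≤ ρ := by
    rw [← hn]; exact (hsol k).1.2.2
  have hzJ (k : ℕ) : ‖J (z k)‖ ≤ ρ + ‖J zb‖ := by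
    have h1 := norm_add_le (J (z k - zb)) (J zb)
    rw [← map_add, sub_add_cancel] at h1
    linarith [hzb k]
  have hzL : ∃ M, ∀ k, ‖(z k : L2 Ω)‖ ≤ M := by
    obtain ⟨C, hC⟩ := hJ.bound
    refine ⟨|C| * (ρ + ‖J zb‖), fun k => (hC _).trans ?_⟩
    calc C * ‖J (z k)‖ ≤ |C| * ‖J (z k)‖ := by gcongr; exact le_abs_self C
      _ ≤ _ := by gcongr; exact hzJ k
  obtain ⟨M, hM⟩ := hzL
  have hu (k : ℕ) : ‖u k‖ ≤ ρ + ‖ubar‖ := by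
    have h1 := norm_add_le (u k - ubar) ubar
    rw [sub_add_cancel] at h1
    linarith [(hsol k).1.2.1]
  obtain ⟨φ₁, hφ₁, zh, hz1, hz2⟩ := exists_weakTendsto_of_closed hJ.closed hM hzJ
  obtain ⟨φ₂, hφ₂, uh, hu2⟩ := exists_weakTendsto (x := fun n => u (φ₁ n)) (fun n => hu _)
  obtain ⟨φ₃, hφ₃, hae⟩ := hJ.compact (fun n => z (φ₁ (φ₂ n))) zh _ (fun n => hzJ _)
    (hz1.comp hφ₂)
  set φ : ℕ → ℕ := fun n => φ₁ (φ₂ (φ₃ n)) with hφdef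
  have hφ : StrictMono φ := hφ₁.comp (hφ₂.comp hφ₃)
  have hzw : WeakTendsto (fun n => w (φ n)) (zh : L2 Ω) := hz1.comp (hφ₂.comp hφ₃)
  have hzJw : WeakTendsto (fun n => J (z (φ n))) (J zh) := hz2.comp (hφ₂.comp hφ₃)
  have huw : WeakTendsto (fun n => u (φ n)) uh := hu2.comp hφ₃
  have hεφ : Tendsto (fun n => ε (φ n)) atTop (𝓝 0) := hε_lim.comp hφ.tendsto_atTop
  -- comparison with the local solution
  have hcmp (k : ℕ) : auxObjective T Ω s κ f α β γ p (ε k) ubar wbar (u k) (w k)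
      ≤ objective T Ω s κ f α β γ p 0 ubar wbar + γ * (ε k ^ p * volume.real Ω) := by
    have h1 := (hsol k).2 ubar wbar ⟨hadm.1, by simpa using hρ, by
      have := hn (0 : fracSobolev Ω s κ)
      rw [sub_self]
      simp only [ZeroMemClass.coe_zero, map_zero, norm_zero] at this
      rw [this]; exact hρ⟩
    rw [auxObjective_of_admissible f α β γ p (ε k) hadm] at h1
    refine h1.trans ?_
    unfold objective
    have := smoothG_le hp0 hp1 (hε_pos k) wbar
    nlinarith
  have hG0 (v : L2 Ω) : 0 ≤ smoothG Ω p 0 v := by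
    rw [smoothG_zero]; exact integral_nonneg fun a => by positivity
  obtain ⟨g, c, hg⟩ := hf_below
  have hfb (k : ℕ) : -(‖g‖ * (ρ + ‖ubar‖)) + c ≤ f (u k) := by
    refine le_trans ?_ (hg (u k))
    have h1 : ‖g (u k)‖ ≤ ‖g‖ * (ρ + ‖ubar‖) :=
      (g.le_opNorm _).trans (by gcongr; exact hu k)
    rw [Real.norm_eq_abs] at h1
    linarith [neg_abs_le (g (u k))]
  have hεp : Tendsto (fun k => ε k ^ p) atTop (𝓝 0) := by
    have := (Real.continuousAt_rpow_const 0 p (Or.inr hp0.le)).tendsto.comp hε_lim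
    simpa [Function.comp_def, Real.zero_rpow hp0.ne'] using this
  -- the penalty terms tend to zero
  have hpen : ∃ B : ℝ, ∀ k, 1 / (2 * ε k) * ‖negP (liftCyl T Ω (w k) - u k)‖ ^ 2
      + 1 / (2 * ε k) * ‖negP (liftCyl T Ω (w k) + u k)‖ ^ 2 ≤ B := by
    obtain ⟨B, hB⟩ := hεp.bddAbove_range
    refine ⟨objective T Ω s κ f α β γ p 0 ubar wbar + γ * (B * volume.real Ω)
      + ‖g‖ * (ρ + ‖ubar‖) - c, fun k => ?_⟩
    have h1 := hcmp k
    rw [auxObjective_eq] at h1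
    have h2 : ε k ^ p ≤ B := hB (mem_range_self k)
    have h3 : γ * (ε k ^ p * volume.real Ω) ≤ γ * (B * volume.real Ω) := by gcongr
    have h4 : 0 ≤ smoothG Ω p (ε k) (w k) :=
      (hG0 _).trans (smoothG_zero_le hp0 hp1 (hε_pos k) _)
    have h5 := hfb k
    have h6 : f (u k) ≤ objective T Ω s κ f α β γ p (ε k) (u k) (w k) := by
      unfold objective
      have : 0 ≤ γ * smoothG Ω p (ε k) (w k) := by positivity
      have : 0 ≤ α / 2 * ‖u k‖ ^ 2 := by positivity
      have : 0 ≤ β / 2 * wNorm Ω s κ (w k) ^ 2 := by positivity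
      linarith
    have h7 := sq_nonneg ‖u k - ubar‖
    have h8 := sq_nonneg ‖w k - wbar‖
    linarith
  obtain ⟨B, hB⟩ := hpen
  have hpen0 (a : ℕ → ℝ) (ha : ∀ k, 0 ≤ a k) (h : ∀ k, 1 / (2 * ε k) * a k ^ 2 ≤ B) :
      Tendsto (fun n => a (φ n)) atTop (𝓝 0) := by
    refine tendsto_zero_of_sq_le one_pos (fun n => ha _) (S := fun n => 2 * ε (φ n) * B)
      (fun n => ?_) ?_
    · have h1 := h (φ n)
      rw [div_mul_eq_mul_div, div_le_iff₀ (by linarith [hε_pos (φ n)])] at h1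
      linarith
    · simpa using (hεφ.const_mul 2).mul_const B
  have hn1 := hpen0 (fun k => ‖negP (liftCyl T Ω (w k) - u k)‖) (fun k => norm_nonneg _)
    fun k => by
      have : 0 ≤ 1 / (2 * ε k) * ‖negP (liftCyl T Ω (w k) + u k)‖ ^ 2 := by
        have := hε_pos k
        positivity
      linarith [hB k]
  have hn2 := hpen0 (fun k => ‖negP (liftCyl T Ω (w k) + u k)‖) (fun k => norm_nonneg _)
    fun k => by
      have : 0 ≤ 1 / (2 * ε k) * ‖negP (liftCyl T Ω (w k) - u k)‖ ^ 2 := by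
        have := hε_pos k
        positivity
      linarith [hB k]
  have hlift := weakTendsto_liftCyl T Ω hzw
  have hpos1 := nonneg_of_weakTendsto (hlift.sub huw) hn1
  have hlim2 : WeakTendsto (fun n => liftCyl T Ω (w (φ n)) + u (φ n)) (liftCyl T Ω zh + uh) := by
    intro h
    simp only [inner_add_left]
    exact (hlift h).add (huw h)
  have hpos2 := nonneg_of_weakTendsto hlim2 hn2
  have hadmh : IsAdmissible T Ω s κ uh zh := by
    refine ⟨zh.2, ?_⟩
    filter_upwards [hpos1, hpos2, liftCyl_sub_ae T Ω uh zh, liftCyl_add_ae T Ω uh zh]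
      with x h1 h2 h3 h4
    rw [h3] at h1
    rw [h4] at h2
    exact abs_le.mpr ⟨by linarith, by linarith⟩
  have hlow : objective T Ω s κ f α β γ p 0 ubar wbar ≤ objective T Ω s κ f α β γ p 0 uh zh := by
    refine hmin uh zh hadmh ?_ ?_
    · refine WeakTendsto.norm_le (huw.sub (WeakTendsto.of_tendsto tendsto_const_nhds))
        fun n => (hsol _).1.2.1
    · have := hn (zh - zb)
      rw [show ((zh - zb : fracSobolev Ω s κ) : L2 Ω) = zh - wbar from rfl] at this
      rw [this, map_sub]
      refine WeakTendsto.norm_le (hzJw.sub (WeakTendsto.of_tendsto tendsto_const_nhds))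
        (x := fun n => J (z (φ n)) - J zb) fun n => ?_
      rw [← map_sub]
      exact hzb _
  -- all quadratic remainders tend to zero
  set S : ℕ → ℝ := fun n => α / 2 * ‖u (φ n) - uh‖ ^ 2 + β / 2 * ‖J (z (φ n)) - J zh‖ ^ 2
    + 1 / 2 * ‖u (φ n) - ubar‖ ^ 2 + 1 / 2 * ‖w (φ n) - wbar‖ ^ 2 with hS
  have hS0 (n : ℕ) : 0 ≤ S n := by positivity
  have hSle : ∀ η : ℝ, 0 < η → ∀ᶠ n in atTop, S n ≤ (2 + α + β + γ) * η := by
    intro η hη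
    have e1 := hf_lsc.eventually_le huw hη
    have e2 := smoothG_zero_eventually_le (w := fun n => w (φ n)) hp0 hp1 hae hη
    have e3 := huw.eventually_norm_sub_sq_le hη
    have e4 := hzJw.eventually_norm_sub_sq_le hη
    have e5 : ∀ᶠ n in atTop, γ * (ε (φ n) ^ p * volume.real Ω) < η := by
      have : Tendsto (fun n => γ * (ε (φ n) ^ p * volume.real Ω)) atTop (𝓝 0) := by
        simpa using ((hεp.comp hφ.tendsto_atTop).mul_const (volume.real Ω)).const_mul γ
      exact this.eventually (gt_mem_nhds hη)
    filter_upwards [e1, e2, e3, e4, e5] with n h1 h2 h3 h4 h5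
    have h6 := hcmp (φ n)
    rw [auxObjective_eq] at h6
    have h7 : objective T Ω s κ f α β γ p 0 (u (φ n)) (w (φ n))
        ≤ objective T Ω s κ f α β γ p (ε (φ n)) (u (φ n)) (w (φ n)) := by
      unfold objective
      have := smoothG_zero_le hp0 hp1 (hε_pos (φ n)) (w (φ n))
      nlinarith
    have h8 : 0 ≤ 1 / (2 * ε (φ n)) := by
      have := hε_pos (φ n)
      positivity
    have h9 := mul_nonneg h8 (sq_nonneg ‖negP (liftCyl T Ω (w (φ n)) - u (φ n))‖)
    have h10 := mul_nonneg h8 (sq_nonneg ‖negP (liftCyl T Ω (w (φ n)) + u (φ n))‖)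
    have h11 : objective T Ω s κ f α β γ p 0 (u (φ n)) (w (φ n)) = f (u (φ n))
        + α / 2 * ‖u (φ n)‖ ^ 2 + β / 2 * ‖J (z (φ n))‖ ^ 2
        + γ * smoothG Ω p 0 (w (φ n)) := by
      rw [← hn]; rfl
    have h12 : objective T Ω s κ f α β γ p 0 uh zh = f uh
        + α / 2 * ‖uh‖ ^ 2 + β / 2 * ‖J zh‖ ^ 2 + γ * smoothG Ω p 0 zh := by
      rw [← hn]; rfl
    have h13 := mul_le_mul_of_nonneg_left h2 hγ.le
    have h14 := mul_le_mul_of_nonneg_left h3 (half_pos hα).le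
    have h15 := mul_le_mul_of_nonneg_left h4 (half_pos hβ).le
    simp only [hS]
    linarith
  have hSt : Tendsto S atTop (𝓝 0) := by
    rw [Metric.tendsto_atTop']
    intro δ hδ
    have hc : 0 < 2 + α + β + γ := by positivity
    obtain ⟨N, hN⟩ := eventually_atTop.mp (hSle (δ / (2 * (2 + α + β + γ))) (by positivity))
    refine ⟨N, fun n hnN => ?_⟩
    rw [Real.dist_eq, sub_zero, abs_of_nonneg (hS0 n)]
    have h1 := hN n hnN.le
    have h2 : (2 + α + β + γ) * (δ / (2 * (2 + α + β + γ))) = δ / 2 := by field_simp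
    linarith
  have t1 : Tendsto (fun n => ‖u (φ n) - ubar‖) atTop (𝓝 0) :=
    tendsto_zero_of_sq_le one_half_pos (fun n => norm_nonneg _) (fun n => by
      simp only [hS]
      have : 0 ≤ α / 2 * ‖u (φ n) - uh‖ ^ 2 + β / 2 * ‖J (z (φ n)) - J zh‖ ^ 2
        + 1 / 2 * ‖w (φ n) - wbar‖ ^ 2 := by positivity
      linarith) hSt
  have t2 : Tendsto (fun n => ‖w (φ n) - wbar‖) atTop (𝓝 0) :=
    tendsto_zero_of_sq_le one_half_pos (fun n => norm_nonneg _) (fun n => by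
      simp only [hS]
      have : 0 ≤ α / 2 * ‖u (φ n) - uh‖ ^ 2 + β / 2 * ‖J (z (φ n)) - J zh‖ ^ 2
        + 1 / 2 * ‖u (φ n) - ubar‖ ^ 2 := by positivity
      linarith) hSt
  have t3 : Tendsto (fun n => ‖J (z (φ n)) - J zh‖) atTop (𝓝 0) :=
    tendsto_zero_of_sq_le (half_pos hβ) (fun n => norm_nonneg _) (fun n => by
      simp only [hS]
      have : 0 ≤ α / 2 * ‖u (φ n) - uh‖ ^ 2 + 1 / 2 * ‖w (φ n) - wbar‖ ^ 2
        + 1 / 2 * ‖u (φ n) - ubar‖ ^ 2 := by positivity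
      linarith) hSt
  have hzh : zh = zb := Subtype.ext
    (hzw.unique (WeakTendsto.of_tendsto (tendsto_iff_norm_sub_tendsto_zero.mpr t2)))
  refine ⟨φ, ?_⟩
  have h0 : (fun n => ‖u (φ n) - ubar‖ + wNorm Ω s κ (w (φ n) - wbar))
      = fun n => ‖u (φ n) - ubar‖ + ‖J (z (φ n)) - J zh‖ := by
    funext n
    rw [hzh, ← map_sub, ← hn]; rfl
  rw [h0]
  simpa using t1.add t3

/-- The solutions of the auxiliary problems converge to the local solution. -/
lemma tendsto_auxSolution (hJ : EnergyModel (fracSobolev Ω s κ) J)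
    (hn : ∀ z : fracSobolev Ω s κ, wNorm Ω s κ z = ‖J z‖)
    (hf_lsc : WeaklyLSC f)
    (hf_below : ∃ (g : StrongDual ℝ (ControlSpace T Ω)) (c : ℝ), ∀ u, g u + c ≤ f u)
    (hα : 0 < α) (hβ : 0 < β) (hγ : 0 < γ) (hp0 : 0 < p) (hp1 : p < 1)
    (hloc : IsLocalSolution T Ω s κ f α β γ p ρ ubar wbar)
    (hε_pos : ∀ k, 0 < ε k) (hε_lim : Tendsto ε atTop (𝓝 0))
    (hsol : ∀ k, IsAuxSolution T Ω s κ f α β γ p (ε k) ρ ubar wbar (u k) (w k)) :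
    Tendsto (fun k => ‖u k - ubar‖ + wNorm Ω s κ (w k - wbar)) atTop (𝓝 0) :=
  tendsto_of_subseq_tendsto fun ns hns =>
    exists_subseq_tendsto (u := fun k => u (ns k)) (w := fun k => w (ns k)) hJ hn hf_lsc hf_below
      hα hβ hγ hp0 hp1 hloc (fun k => hε_pos (ns k)) (hε_lim.comp hns) (fun k => hsol (ns k))

end Convergence

end SparseControl
end

noncomputable section

namespace SparseControl

variable {d : ℕ}

/-! ### Optimality conditions and the bound in `L¹` -/

lemma le_deriv_add_of_eventually_le {F : ℝ → ℝ} {D a b c : ℝ} (hF : HasDerivAt F D 0)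
    (h : ∀ᶠ η in 𝓝[>] (0 : ℝ), η * a ≤ F η - F 0 + η * b + η ^ 2 * c) : a ≤ D + b := by
  have h1 : Tendsto (fun η : ℝ => η⁻¹ • (F (0 + η) - F 0)) (𝓝[>] 0) (𝓝 D) :=
    (hasDerivAt_iff_tendsto_slope_zero.mp hF).mono_left
      (nhdsWithin_mono _ fun x hx => ne_of_gt hx)
  have h2 : Tendsto (fun η : ℝ => η * c) (𝓝[>] 0) (𝓝 0) := by
    have : Tendsto (fun η : ℝ => η * c) (𝓝 0) (𝓝 (0 * c)) := tendsto_id.mul_const c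
    rw [zero_mul] at this
    exact this.mono_left nhdsWithin_le_nhds
  have h3 : Tendsto (fun η : ℝ => η⁻¹ • (F (0 + η) - F 0) + b + η * c) (𝓝[>] 0) (𝓝 (D + b)) := by
    simpa using (h1.add_const b).add h2
  refine ge_of_tendsto h3 ?_
  filter_upwards [h, self_mem_nhdsWithin] with η hη hpos
  have hpos : 0 < η := hpos
  simp only [zero_add, smul_eq_mul]
  have e : η⁻¹ * (F η - F 0) + b + η * c = (F η - F 0 + η * b + η ^ 2 * c) / η := by
    field_simp
  rw [e, le_div_iff₀ hpos]
  linarith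

section Optimality

variable {T : ℝ} {Ω : Set (Space d)} [IsFiniteMeasure (volume.restrict Ω)] {s : ℝ}
  {κ : SobolevType} {H : Type*} [NormedAddCommGroup H] [InnerProductSpace ℝ H]
  {J : fracSobolev Ω s κ →ₗ[ℝ] H} {f : ControlSpace T Ω → ℝ} {α β γ p ρ : ℝ}
  {ubar : ControlSpace T Ω} {wbar : L2 Ω} {ε : ℝ} {u : ControlSpace T Ω} {w : L2 Ω}

/-- The multiplier of the penalized control constraints. -/
def penaltyMultiplier (ε : ℝ) (u : ControlSpace T Ω) (w : L2 Ω) : ControlSpace T Ω :=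
  ε⁻¹ • (negP (liftCyl T Ω w - u) - negP (liftCyl T Ω w + u))

omit [IsFiniteMeasure (volume.restrict Ω)] in
lemma inner_penaltyMultiplier_le (hε : 0 < ε) (hf : Differentiable ℝ f)
    (hsol : IsAuxSolution T Ω s κ f α β γ p ε ρ ubar wbar u w) (hu : ‖u - ubar‖ < ρ)
    (h : ControlSpace T Ω) :
    inner ℝ (penaltyMultiplier ε u w) h ≤
      fderiv ℝ f u h + (α * inner ℝ u h + inner ℝ (u - ubar) h) := by
  have hF := (hf u).hasFDerivAt.hasLineDerivAt h
  refine le_deriv_add_of_eventually_le (c := (α / 2 + 1 / 2 + 1 / ε) * ‖h‖ ^ 2) hF ?_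
  have hfeas : ∀ᶠ η in 𝓝[>] (0 : ℝ), ‖u + η • h - ubar‖ < ρ := by
    have hc : Continuous fun η : ℝ => ‖u + η • h - ubar‖ := by fun_prop
    have : ∀ᶠ η in 𝓝 (0 : ℝ), ‖u + η • h - ubar‖ < ρ :=
      (hc.tendsto 0).eventually (gt_mem_nhds (by simpa using hu))
    exact this.filter_mono nhdsWithin_le_nhds
  filter_upwards [hfeas] with η hη
  have h1 := hsol.2 (u + η • h) w ⟨hsol.1.1, hη.le, hsol.1.2.2⟩
  rw [auxObjective_eq, auxObjective_eq, objective, objective] at h1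
  have n1 : ‖u + η • h‖ ^ 2 = ‖u‖ ^ 2 + 2 * (η * inner ℝ u h) + η ^ 2 * ‖h‖ ^ 2 := by
    rw [norm_add_sq_real, inner_smul_right, norm_smul, mul_pow, Real.norm_eq_abs, sq_abs]
  have n2 : ‖u + η • h - ubar‖ ^ 2
      = ‖u - ubar‖ ^ 2 + 2 * (η * inner ℝ (u - ubar) h) + η ^ 2 * ‖h‖ ^ 2 := by
    rw [add_sub_right_comm, norm_add_sq_real, inner_smul_right, norm_smul, mul_pow,
      Real.norm_eq_abs, sq_abs]
  have n3 : ‖negP (liftCyl T Ω w - (u + η • h))‖ ^ 2 ≤ ‖negP (liftCyl T Ω w - u)‖ ^ 2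
      - 2 * (η * inner ℝ (negP (liftCyl T Ω w - u)) h) + η ^ 2 * ‖h‖ ^ 2 := by
    have := norm_negP_add_sq_le (liftCyl T Ω w - u) (-(η • h))
    rw [inner_neg_right, inner_smul_right, norm_neg, norm_smul, mul_pow, Real.norm_eq_abs,
      sq_abs] at this
    rw [← sub_sub, sub_eq_add_neg (liftCyl T Ω w - u)]
    linarith
  have n4 : ‖negP (liftCyl T Ω w + (u + η • h))‖ ^ 2 ≤ ‖negP (liftCyl T Ω w + u)‖ ^ 2
      + 2 * (η * inner ℝ (negP (liftCyl T Ω w + u)) h) + η ^ 2 * ‖h‖ ^ 2 := by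
    have := norm_negP_add_sq_le (liftCyl T Ω w + u) (η • h)
    rw [inner_smul_right, norm_smul, mul_pow, Real.norm_eq_abs, sq_abs] at this
    rw [← add_assoc]
    linarith
  have hε' : 0 < 1 / (2 * ε) := by positivity
  have n3' := mul_le_mul_of_nonneg_left n3 hε'.le
  have n4' := mul_le_mul_of_nonneg_left n4 hε'.le
  rw [n1, n2] at h1
  have e1 : η * inner ℝ (penaltyMultiplier ε u w) h
      = 1 / (2 * ε) * (2 * (η * inner ℝ (negP (liftCyl T Ω w - u)) h))
        - 1 / (2 * ε) * (2 * (η * inner ℝ (negP (liftCyl T Ω w + u)) h)) := by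
    rw [penaltyMultiplier, inner_smul_left, inner_sub_left]
    simp only [conj_trivial]
    field_simp
  have e2 : η ^ 2 * ((α / 2 + 1 / 2 + 1 / ε) * ‖h‖ ^ 2)
      = α / 2 * (η ^ 2 * ‖h‖ ^ 2) + 1 / 2 * (η ^ 2 * ‖h‖ ^ 2)
        + 1 / (2 * ε) * (η ^ 2 * ‖h‖ ^ 2) + 1 / (2 * ε) * (η ^ 2 * ‖h‖ ^ 2) := by
    field_simp; ring
  rw [e1, e2]
  simp only [zero_smul, add_zero]
  linarith

omit [IsFiniteMeasure (volume.restrict Ω)] in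
lemma norm_penaltyMultiplier_le (hε : 0 < ε) (hα : 0 < α) (hf : Differentiable ℝ f)
    (hsol : IsAuxSolution T Ω s κ f α β γ p ε ρ ubar wbar u w) (hu : ‖u - ubar‖ < ρ) :
    ‖penaltyMultiplier ε u w‖ ≤ ‖fderiv ℝ f u‖ + α * ‖u‖ + ‖u - ubar‖ := by
  set q := penaltyMultiplier ε u w with hq
  have h := inner_penaltyMultiplier_le hε hf hsol hu q
  rw [← hq, real_inner_self_eq_norm_sq] at h
  have h1 : fderiv ℝ f u q ≤ ‖fderiv ℝ f u‖ * ‖q‖ :=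
    (le_abs_self _).trans ((fderiv ℝ f u).le_opNorm q)
  have h2 : α * inner ℝ u q ≤ α * (‖u‖ * ‖q‖) :=
    mul_le_mul_of_nonneg_left (real_inner_le_norm _ _) hα.le
  have h3 := real_inner_le_norm (u - ubar) q
  rcases (norm_nonneg q).eq_or_lt with h0 | h0
  · rw [← h0]; positivity
  · refine le_of_mul_le_mul_right ?_ h0
    rw [← sq]
    linarith

lemma inner_multiplier_le (hn : ∀ z : fracSobolev Ω s κ, wNorm Ω s κ z = ‖J z‖)
    (hε : 0 < ε) (hβ : 0 < β) (hp0 : 0 < p) (hp1 : p < 1) (hγ : 0 < γ)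
    (hadm : wbar ∈ fracSobolev Ω s κ)
    (hsol : IsAuxSolution T Ω s κ f α β γ p ε ρ ubar wbar u w)
    (hw : wNorm Ω s κ (w - wbar) < ρ) (y : fracSobolev Ω s κ) {η₀ : ℝ} (hη₀ : 0 < η₀)
    (hy : ∀ η, 0 < η → η ≤ η₀ → ‖J (⟨w, hsol.1.1⟩ - η • y)‖ ≤ ‖J ⟨w, hsol.1.1⟩‖) :
    γ * inner ℝ (multiplier Ω p ε w) (y : L2 Ω) ≤ -inner ℝ (w - wbar) (y : L2 Ω)
      - ε⁻¹ * inner ℝ (negP (liftCyl T Ω w - u) + negP (liftCyl T Ω w + u))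
        (liftCyl T Ω y) := by
  set z : fracSobolev Ω s κ := ⟨w, hsol.1.1⟩ with hz
  set zb : fracSobolev Ω s κ := ⟨wbar, hadm⟩ with hzb
  have hfeas : ∀ᶠ η in 𝓝[>] (0 : ℝ), ‖J (z - zb) - η • J y‖ < ρ := by
    have hc : Continuous fun η : ℝ => ‖J (z - zb) - η • J y‖ := by fun_prop
    have : ∀ᶠ η in 𝓝 (0 : ℝ), ‖J (z - zb) - η • J y‖ < ρ :=
      (hc.tendsto 0).eventually (gt_mem_nhds (by
        rw [zero_smul, sub_zero, ← hn]; exact hw))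
    exact this.filter_mono nhdsWithin_le_nhds
  have key := le_deriv_add_of_eventually_le (F := fun _ => (0 : ℝ)) (D := 0)
    (a := γ * inner ℝ (multiplier Ω p ε w) (y : L2 Ω))
    (b := -inner ℝ (w - wbar) (y : L2 Ω)
      - ε⁻¹ * inner ℝ (negP (liftCyl T Ω w - u) + negP (liftCyl T Ω w + u)) (liftCyl T Ω y))
    (c := γ * (dpsiLip p ε * ‖(y : L2 Ω)‖ ^ 2) + 1 / 2 * ‖(y : L2 Ω)‖ ^ 2
      + ε⁻¹ * ‖liftCyl T Ω y‖ ^ 2) (hasDerivAt_const 0 0) ?_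
  · simpa using key
  filter_upwards [hfeas, self_mem_nhdsWithin, Ioc_mem_nhdsGT hη₀] with η hη hpos hη1
  have hpos : 0 < η := hpos
  have hcoe : ((z - η • y : fracSobolev Ω s κ) : L2 Ω) = w - η • (y : L2 Ω) := rfl
  have h1 := hsol.2 u (w - η • (y : L2 Ω)) ⟨(z - η • y).2, hsol.1.2.1, by
    have e := hn (z - η • y - zb)
    have e1 : ((z - η • y - zb : fracSobolev Ω s κ) : L2 Ω) = w - η • (y : L2 Ω) - wbar := rfl
    rw [e1] at e
    rw [e, sub_right_comm, map_sub J (z - zb), map_smul]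
    exact hη.le⟩
  rw [auxObjective_eq, auxObjective_eq, objective, objective, ← hcoe, hn, hcoe,
    show wNorm Ω s κ w = ‖J z‖ from hn z] at h1
  have h2 : ‖J (z - η • y)‖ ^ 2 ≤ ‖J z‖ ^ 2 := by
    have := hy η hpos hη1.2
    gcongr
  have n1 : smoothG Ω p ε (w - η • (y : L2 Ω)) ≤ smoothG Ω p ε w
      - η * inner ℝ (multiplier Ω p ε w) (y : L2 Ω)
      + dpsiLip p ε * (η ^ 2 * ‖(y : L2 Ω)‖ ^ 2) := by
    have := (abs_le.mp (abs_smoothG_multiplier_le hp0 hp1 hε w (-(η • (y : L2 Ω))))).2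
    rw [inner_neg_right, inner_smul_right, norm_neg, norm_smul, mul_pow, Real.norm_eq_abs,
      sq_abs, ← sub_eq_add_neg] at this
    linarith
  have n2 : ‖w - η • (y : L2 Ω) - wbar‖ ^ 2 = ‖w - wbar‖ ^ 2
      - 2 * (η * inner ℝ (w - wbar) (y : L2 Ω)) + η ^ 2 * ‖(y : L2 Ω)‖ ^ 2 := by
    rw [sub_right_comm, norm_sub_sq_real, inner_smul_right, norm_smul, mul_pow,
      Real.norm_eq_abs, sq_abs]
  have n3 (v : ControlSpace T Ω) : ‖negP (v - η • liftCyl T Ω y)‖ ^ 2 ≤ ‖negP v‖ ^ 2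
      - 2 * (η * inner ℝ (negP v) (liftCyl T Ω y)) + η ^ 2 * ‖liftCyl T Ω y‖ ^ 2 := by
    have := norm_negP_add_sq_le v (-(η • liftCyl T Ω y))
    rw [inner_neg_right, inner_smul_right, norm_neg, norm_smul, mul_pow, Real.norm_eq_abs,
      sq_abs] at this
    rw [sub_eq_add_neg]
    linarith
  have hε' : 0 < 1 / (2 * ε) := by positivity
  have n3' := mul_le_mul_of_nonneg_left (n3 (liftCyl T Ω w - u)) hε'.le
  have n4' := mul_le_mul_of_nonneg_left (n3 (liftCyl T Ω w + u)) hε'.le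
  have l1 : liftCyl T Ω (w - η • (y : L2 Ω)) - u
      = liftCyl T Ω w - u - η • liftCyl T Ω y := by
    rw [map_sub, map_smul, sub_right_comm]
  have l2 : liftCyl T Ω (w - η • (y : L2 Ω)) + u
      = liftCyl T Ω w + u - η • liftCyl T Ω y := by
    rw [map_sub, map_smul, sub_add_eq_add_sub]
  rw [l1, l2, n2] at h1
  have h3 := mul_le_mul_of_nonneg_left h2 (half_pos hβ).le
  have h4 := mul_le_mul_of_nonneg_left n1 hγ.le
  have e1 : η * (ε⁻¹ * inner ℝ (negP (liftCyl T Ω w - u) + negP (liftCyl T Ω w + u))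
        (liftCyl T Ω y))
      = 1 / (2 * ε) * (2 * (η * inner ℝ (negP (liftCyl T Ω w - u)) (liftCyl T Ω y)))
        + 1 / (2 * ε) * (2 * (η * inner ℝ (negP (liftCyl T Ω w + u)) (liftCyl T Ω y))) := by
    rw [inner_add_left]
    field_simp
  have e2 : η ^ 2 * (ε⁻¹ * ‖liftCyl T Ω y‖ ^ 2)
      = 1 / (2 * ε) * (η ^ 2 * ‖liftCyl T Ω y‖ ^ 2)
        + 1 / (2 * ε) * (η ^ 2 * ‖liftCyl T Ω y‖ ^ 2) := by
    field_simp; ring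
  simp only [sub_self, zero_add, mul_add, mul_sub, e2] at e1 ⊢
  linarith

lemma abs_le_one_add_sq (r : ℝ) : |r| ≤ 1 + r ^ 2 := by
  rw [← sq_abs r]
  nlinarith [sq_nonneg (|r| - 1)]

lemma integral_abs_le {X : Type*} [MeasurableSpace X] {μ : Measure X} [IsFiniteMeasure μ]
    (v : Lp ℝ 2 μ) : ∫ x, |v x| ∂μ ≤ μ.real univ + ‖v‖ ^ 2 := by
  have i1 : Integrable (fun x => (v x) ^ 2) μ := (Lp.memLp v).integrable_sq
  calc ∫ x, |v x| ∂μ ≤ ∫ x, (1 + (v x) ^ 2) ∂μ :=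
        integral_mono_of_nonneg (Eventually.of_forall fun x => abs_nonneg _)
          ((integrable_const 1).add i1) (Eventually.of_forall fun x => abs_le_one_add_sq _)
    _ = μ.real univ + ‖v‖ ^ 2 := by
        rw [integral_add (integrable_const 1) i1, norm_sq_eq_integral]; simp

lemma integrable_Lp {X : Type*} [MeasurableSpace X] {μ : Measure X} [IsFiniteMeasure μ]
    (v : Lp ℝ 2 μ) : Integrable v μ := (Lp.memLp v).integrable (by norm_num)

/-- Pointwise estimate of the penalty terms tested with a function of the same sign as `w`. -/
lemma neg_penalty_mul_le {r q y : ℝ} (hy : |y| ≤ 2) (hry : 0 ≤ r → 0 ≤ y) (hry' : r ≤ 0 → y ≤ 0) :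
    -((min (r - q) 0 + min (r + q) 0) * y) ≤ 2 * |min (r - q) 0 - min (r + q) 0| := by
  obtain ⟨h1, h2⟩ := abs_le.mp hy
  rcases le_total 0 r with h | h
  · have hy0 := hry h
    rcases le_total 0 q with hq | hq
    · have e : min (r + q) 0 = 0 := min_eq_right (by linarith)
      have e1 : min (r - q) 0 ≤ 0 := min_le_right _ _
      rw [e, add_zero, sub_zero, abs_of_nonpos e1]
      nlinarith
    · have e : min (r - q) 0 = 0 := min_eq_right (by linarith)
      have e1 : min (r + q) 0 ≤ 0 := min_le_right _ _
      rw [e, zero_add, zero_sub, abs_neg, abs_of_nonpos e1]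
      nlinarith
  · have hy0 := hry' h
    have e1 : min (r - q) 0 ≤ 0 := min_le_right _ _
    have e2 : min (r + q) 0 ≤ 0 := min_le_right _ _
    have := abs_nonneg (min (r - q) 0 - min (r + q) 0)
    nlinarith

lemma abs_arctan_le_two (r : ℝ) : |Real.arctan r| ≤ 2 := by
  have h1 := Real.arctan_lt_pi_div_two r
  have h2 := Real.neg_pi_div_two_lt_arctan r
  have h3 := Real.pi_le_four
  exact abs_le.mpr ⟨by linarith, by linarith⟩

omit [IsFiniteMeasure (volume.restrict Ω)] in
/-- The functions `arctan(n w)` are admissible test functions that do not increase the energy. -/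
lemma exists_arctan_direction (hJ : EnergyModel (fracSobolev Ω s κ) J) (z : fracSobolev Ω s κ)
    {n : ℝ} (hn0 : 0 < n) : ∃ y : fracSobolev Ω s κ,
      (y : L2 Ω) =ᵐ[volume.restrict Ω] (fun a => Real.arctan (n * (z : L2 Ω) a)) ∧
      ∀ η, 0 < η → η ≤ n⁻¹ → ‖J (z - η • y)‖ ≤ ‖J z‖ := by
  have hex (η : ℝ) (h0 : 0 < η) (h1 : η ≤ n⁻¹) : ∃ z' : fracSobolev Ω s κ,
      (z' : L2 Ω) =ᵐ[volume.restrict Ω]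
        (fun a => (z : L2 Ω) a - η * Real.arctan (n * (z : L2 Ω) a)) ∧ ‖J z'‖ ≤ ‖J z‖ := by
    refine hJ.contract (fun r => r - η * Real.arctan (n * r)) ?_ (by simp) (fun r => ?_) z
    · exact contDiff_id.sub (contDiff_const.mul
        (Real.contDiff_arctan.comp (contDiff_const.mul contDiff_id)))
    · have hd : HasDerivAt (fun r => r - η * Real.arctan (n * r))
          (1 - η * (1 / (1 + (n * r) ^ 2) * (n * 1))) r :=
        (hasDerivAt_id r).sub ((((hasDerivAt_id r).const_mul n).arctan).const_mul η)
      rw [hd.deriv]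
      have h2 : η * n ≤ 1 := by
        calc η * n ≤ n⁻¹ * n := by gcongr
          _ = 1 := inv_mul_cancel₀ hn0.ne'
      have h3 : 0 ≤ 1 / (1 + (n * r) ^ 2) := by positivity
      have h4 : 1 / (1 + (n * r) ^ 2) ≤ 1 := by
        rw [div_le_one (by positivity)]
        nlinarith [sq_nonneg (n * r)]
      have h5 : 0 ≤ η * n := by positivity
      have e : η * (1 / (1 + (n * r) ^ 2) * (n * 1)) = (η * n) * (1 / (1 + (n * r) ^ 2)) := by ring
      rw [e]
      exact abs_le.mpr ⟨by nlinarith, by nlinarith [mul_nonneg h5 h3]⟩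
  obtain ⟨z₁, hz₁, -⟩ := hex n⁻¹ (by positivity) le_rfl
  have hy : ((n • (z - z₁) : fracSobolev Ω s κ) : L2 Ω) =ᵐ[volume.restrict Ω]
      (fun a => Real.arctan (n * (z : L2 Ω) a)) := by
    have e : ((n • (z - z₁) : fracSobolev Ω s κ) : L2 Ω) = n • ((z : L2 Ω) - (z₁ : L2 Ω)) := rfl
    rw [e]
    filter_upwards [Lp.coeFn_smul n ((z : L2 Ω) - (z₁ : L2 Ω)),
      Lp.coeFn_sub (z : L2 Ω) (z₁ : L2 Ω), hz₁]
      with a h1 h2 h3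
    rw [h1, Pi.smul_apply, h2, Pi.sub_apply, h3, smul_eq_mul]
    field_simp; ring
  refine ⟨n • (z - z₁), hy, fun η h0 h1 => ?_⟩
  obtain ⟨z', hz', hle⟩ := hex η h0 h1
  have : z - η • (n • (z - z₁)) = z' := by
    refine Subtype.ext (Lp.ext ?_)
    have e : ((z - η • (n • (z - z₁)) : fracSobolev Ω s κ) : L2 Ω)
        = (z : L2 Ω) - η • ((n • (z - z₁) : fracSobolev Ω s κ) : L2 Ω) := rfl
    rw [e]
    filter_upwards [Lp.coeFn_sub (z : L2 Ω) (η • ((n • (z - z₁) : fracSobolev Ω s κ) : L2 Ω)),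
      Lp.coeFn_smul η ((n • (z - z₁) : fracSobolev Ω s κ) : L2 Ω), hy, hz'] with a h1 h2 h3 h4
    rw [h1, Pi.sub_apply, h2, Pi.smul_apply, h3, h4, smul_eq_mul]
  rw [this]
  exact hle

lemma tendsto_arctan_nat_mul (r : ℝ) :
    Tendsto (fun n : ℕ => Real.arctan (((n : ℝ) + 1) * r)) atTop
      (𝓝 (Real.pi / 2 * SignType.sign r)) := by
  have hn : Tendsto (fun n : ℕ => (n : ℝ) + 1) atTop atTop :=
    tendsto_atTop_add_const_right _ _ tendsto_natCast_atTop_atTop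
  rcases lt_trichotomy r 0 with h | rfl | h
  · have h1 := (Real.tendsto_arctan_atBot.mono_right nhdsWithin_le_nhds).comp
      (hn.atTop_mul_const_of_neg h)
    simpa [h, Function.comp_def] using h1
  · simp
  · have h1 := (Real.tendsto_arctan_atTop.mono_right nhdsWithin_le_nhds).comp
      (hn.atTop_mul_const h)
    simpa [h, Function.comp_def] using h1

/-- The bound of the multiplier in `L¹(Ω)`, if the constraints of the auxiliary problem are
inactive. -/
lemma integral_abs_multiplier_le (hJ : EnergyModel (fracSobolev Ω s κ) J)
    (hn : ∀ z : fracSobolev Ω s κ, wNorm Ω s κ z = ‖J z‖)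
    (hε : 0 < ε) (hβ : 0 < β) (hp0 : 0 < p) (hp1 : p < 1) (hγ : 0 < γ)
    (hadm : wbar ∈ fracSobolev Ω s κ)
    (hsol : IsAuxSolution T Ω s κ f α β γ p ε ρ ubar wbar u w)
    (hw : wNorm Ω s κ (w - wbar) < ρ) :
    γ * (Real.pi / 2) * ∫ x in Ω, |multiplier Ω p ε w x| ≤
      2 * (volume.real Ω + ‖w - wbar‖ ^ 2)
      + 2 * ((cylMeasure T Ω).real univ + ‖penaltyMultiplier ε u w‖ ^ 2) := by
  set lam := multiplier Ω p ε w with hlam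
  set z : fracSobolev Ω s κ := ⟨w, hsol.1.1⟩ with hz
  have hbound (n : ℕ) : γ * ∫ x in Ω, lam x * Real.arctan (((n : ℝ) + 1) * w x) ≤
      2 * (volume.real Ω + ‖w - wbar‖ ^ 2)
      + 2 * ((cylMeasure T Ω).real univ + ‖penaltyMultiplier ε u w‖ ^ 2) := by
    have hn0 : (0 : ℝ) < (n : ℝ) + 1 := by positivity
    obtain ⟨y, hy, hdec⟩ := exists_arctan_direction hJ z hn0
    have h1 := inner_multiplier_le hn hε hβ hp0 hp1 hγ hadm hsol hw y (inv_pos.mpr hn0) hdec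
    have e1 : inner ℝ lam (y : L2 Ω) = ∫ x in Ω, lam x * Real.arctan (((n : ℝ) + 1) * w x) := by
      rw [inner_eq_integral]
      refine integral_congr_ae ?_
      filter_upwards [hy] with x hx
      rw [hx]
    have e2 : -inner ℝ (w - wbar) (y : L2 Ω) ≤ 2 * ∫ x in Ω, |(w - wbar) x| := by
      rw [inner_eq_integral, ← integral_neg, ← integral_const_mul]
      refine integral_mono_ae (integrable_mul_Lp _ _).neg
        ((integrable_Lp (w - wbar)).abs.const_mul 2) ?_
      filter_upwards [hy] with x hx
      rw [hx]
      have h2 := abs_arctan_le_two (((n : ℝ) + 1) * w x)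
      calc -((w - wbar) x * Real.arctan (((n : ℝ) + 1) * w x))
          ≤ |(w - wbar) x * Real.arctan (((n : ℝ) + 1) * w x)| := neg_le_abs _
        _ = |(w - wbar) x| * |Real.arctan (((n : ℝ) + 1) * w x)| := abs_mul _ _
        _ ≤ |(w - wbar) x| * 2 := by gcongr
        _ = 2 * |(w - wbar) x| := by ring
    have e3 : -(ε⁻¹ * inner ℝ (negP (liftCyl T Ω w - u) + negP (liftCyl T Ω w + u))
        (liftCyl T Ω y)) ≤ 2 * ∫ x, |penaltyMultiplier ε u w x| ∂cylMeasure T Ω := by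
      rw [inner_eq_integral, ← integral_const_mul, ← integral_neg, ← integral_const_mul]
      refine integral_mono_ae ((integrable_mul_Lp _ _).const_mul _).neg
        ((integrable_Lp (penaltyMultiplier ε u w)).abs.const_mul 2) ?_
      have hy' := (Measure.quasiMeasurePreserving_snd
        (μ := volume.restrict (Ioo 0 T)) (ν := volume.restrict Ω)).ae_eq hy
      filter_upwards [hy', liftCyl_ae T Ω y, liftCyl_sub_ae T Ω u w, liftCyl_add_ae T Ω u w,
        negP_ae (liftCyl T Ω w - u), negP_ae (liftCyl T Ω w + u),
        Lp.coeFn_add (negP (liftCyl T Ω w - u)) (negP (liftCyl T Ω w + u)),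
        Lp.coeFn_sub (negP (liftCyl T Ω w - u)) (negP (liftCyl T Ω w + u)),
        Lp.coeFn_smul ε⁻¹ (negP (liftCyl T Ω w - u) - negP (liftCyl T Ω w + u))]
        with x a1 a2 a3 a4 a5 a6 a7 a8 a9
      simp only [Function.comp] at a1
      rw [a7, penaltyMultiplier, a9, Pi.smul_apply, a8, Pi.add_apply, Pi.sub_apply, a5, a6, a3, a4,
        a2, a1, smul_eq_mul, abs_mul, abs_of_pos (inv_pos.mpr hε)]
      have := neg_penalty_mul_le (r := w x.2) (q := u x)
        (y := Real.arctan (((n : ℝ) + 1) * w x.2)) (abs_arctan_le_two _)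
        (fun h => Real.arctan_nonneg.mpr (by positivity))
        (fun h => by
          rw [← neg_nonneg, ← Real.arctan_neg]
          refine Real.arctan_nonneg.mpr ?_
          nlinarith)
      have h5 := mul_le_mul_of_nonneg_left this (inv_pos.mpr hε).le
      calc _ = ε⁻¹ * -((min (w x.2 - u x) 0 + min (w x.2 + u x) 0)
              * Real.arctan (((n : ℝ) + 1) * w x.2)) := by simp only [hz]; ring
        _ ≤ _ := h5
        _ = _ := by ring
    have e4 := integral_abs_le (w - wbar)
    have e5 := integral_abs_le (penaltyMultiplier ε u w)
    rw [measureReal_restrict_apply_univ] at e4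
    rw [← e1]
    linarith
  have hlim : Tendsto (fun n : ℕ => ∫ x in Ω, lam x * Real.arctan (((n : ℝ) + 1) * w x)) atTop
      (𝓝 (∫ x in Ω, lam x * (Real.pi / 2 * SignType.sign (w x)))) := by
    refine tendsto_integral_of_dominated_convergence (fun x => |lam x| * 2) (fun n => ?_)
      ((integrable_Lp lam).abs.mul_const 2) (fun n => Eventually.of_forall fun x => ?_)
      (Eventually.of_forall fun x => (tendsto_arctan_nat_mul _).const_mul _)
    · exact (Lp.aestronglyMeasurable lam).mul (Real.continuous_arctan.comp_aestronglyMeasurable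
        ((Lp.aestronglyMeasurable w).const_mul _))
    · rw [Real.norm_eq_abs, abs_mul]
      gcongr
      exact abs_arctan_le_two _
  have hfin : ∫ x in Ω, lam x * (Real.pi / 2 * SignType.sign (w x))
      = Real.pi / 2 * ∫ x in Ω, |lam x| := by
    rw [← integral_const_mul]
    refine integral_congr_ae ?_
    filter_upwards [multiplier_ae hp0 hp1 hε w] with x hx
    rw [hlam, hx, ← dpsi_eq_sign_mul_abs hp0]; ring
  rw [mul_assoc, ← hfin]
  exact le_of_tendsto (hlim.const_mul γ) (Eventually.of_forall hbound)

end Optimality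

end SparseControl
end

noncomputable section

namespace SparseControl

variable {d : ℕ}

/-! ### Weak-* compactness of bounded sequences of measures -/

section WeakStar

open scoped CompactlySupported

variable {X : Type*} [TopologicalSpace X]

lemma integrable_of_bounded [MeasurableSpace X] [BorelSpace X] {μ : Measure X} [IsFiniteMeasure μ] {g : X → ℝ} (hg : Continuous g)
    {B : ℝ} (hB : ∀ x, |g x| ≤ B) : Integrable g μ :=
  Integrable.of_bound hg.aestronglyMeasurable B (Eventually.of_forall hB)

lemma abs_integral_le_of_bounded {X : Type*} [MeasurableSpace X] {μ : Measure X} [IsFiniteMeasure μ] {C : ℝ}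
    (hC : μ.real univ ≤ C) {g : X → ℝ} {B : ℝ} (hB0 : 0 ≤ B) (hB : ∀ x, |g x| ≤ B) :
    |∫ x, g x ∂μ| ≤ B * C := by
  refine (norm_integral_le_of_norm_le_const (f := g) (C := B) (Eventually.of_forall fun x => hB x)).trans ?_
  gcongr

variable [T2Space X] [LocallyCompactSpace X]

lemma exists_compactlySupported_near (φ : C₀(X, ℝ)) {η : ℝ} (hη : 0 < η) :
    ∃ g : C_c(X, ℝ), ∀ x, |φ x - g x| ≤ η := by
  have h0 : ∀ᶠ x in cocompact X, |φ x| < η := by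
    have := (zero_at_infty φ).norm
    rw [norm_zero] at this
    exact this.eventually (gt_mem_nhds hη)
  obtain ⟨K, hK, hKη⟩ := mem_cocompact.mp h0
  obtain ⟨χ, hχ1, hχc, hχ⟩ := exists_continuousMap_one_of_isCompact_subset_isOpen hK
    isOpen_univ (subset_univ K)
  refine ⟨⟨⟨fun x => χ x * φ x, by fun_prop⟩, HasCompactSupport.mul_right (f := χ) hχc⟩, fun x => ?_⟩
  change |φ x - χ x * φ x| ≤ η
  by_cases hx : x ∈ K
  · simp [hχ1 hx, hη.le]
  · have h1 : |φ x| < η := hKη hx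
    have h2 : |1 - χ x| ≤ 1 := by
      have := (hχ.2 x)
      exact abs_le.mpr ⟨by linarith [this.2], by linarith [this.1]⟩
    calc |φ x - χ x * φ x| = |1 - χ x| * |φ x| := by rw [← abs_mul]; ring_nf
      _ ≤ 1 * η := by gcongr
      _ = η := one_mul η

variable [MeasurableSpace X] [BorelSpace X]

/-- A bounded sequence of finite measures has a limit along every ultrafilter, in the weak-*
topology of the dual of `C₀(X)`. -/
lemma exists_weakStar_limit (𝒰 : Ultrafilter ℕ) (μ : ℕ → Measure X) [∀ k, IsFiniteMeasure (μ k)]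
    {C : ℝ} (hC : ∀ k, (μ k).real univ ≤ C) :
    ∃ ν : Measure X, IsFiniteMeasure ν ∧
      ∀ φ : C₀(X, ℝ), Tendsto (fun k => ∫ x, φ x ∂μ k) 𝒰 (𝓝 (∫ x, φ x ∂ν)) := by
  have hC0 : 0 ≤ C := measureReal_nonneg.trans (hC 0)
  have hbdd (g : C_c(X, ℝ)) : ∃ B : ℝ, 0 ≤ B ∧ ∀ x, |g x| ≤ B := by
    obtain ⟨B, hB⟩ := g.hasCompactSupport.exists_bound_of_continuous g.continuous
    exact ⟨|B|, abs_nonneg _, fun x => (hB x).trans (le_abs_self B)⟩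
  have hlim (g : C_c(X, ℝ)) : ∃ a, Tendsto (fun k => ∫ x, g x ∂μ k) 𝒰 (𝓝 a) := by
    obtain ⟨B, hB0, hB⟩ := hbdd g
    have hmem : ∀ k, ∫ x, g x ∂μ k ∈ Icc (-(B * C)) (B * C) := fun k =>
      abs_le.mp (abs_integral_le_of_bounded (hC k) hB0 hB)
    obtain ⟨a, -, ha⟩ := isCompact_Icc.ultrafilter_le_nhds
      (𝒰.map (fun k => ∫ x, g x ∂μ k)) (by
        rw [le_principal_iff]
        exact Filter.mem_map.mpr (Filter.univ_mem' hmem))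
    exact ⟨a, ha⟩
  choose L hL using hlim
  let Λ₀ : C_c(X, ℝ) →ₗ[ℝ] ℝ :=
    { toFun := L
      map_add' := fun g h => by
        refine tendsto_nhds_unique (hL (g + h)) (((hL g).add (hL h)).congr fun k => ?_)
        exact (integral_add g.integrable h.integrable).symm
      map_smul' := fun c g => by
        refine tendsto_nhds_unique (hL (c • g)) (((hL g).const_mul c).congr fun k => ?_)
        exact (integral_const_mul c _).symm }
  let Λ : C_c(X, ℝ) →ₚ[ℝ] ℝ := PositiveLinearMap.mk₀ Λ₀ fun g hg =>
    ge_of_tendsto' (hL g) fun k => integral_nonneg fun x => hg x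
  have hΛ (g : C_c(X, ℝ)) : Λ g = L g := rfl
  set ν := RealRMK.rieszMeasure Λ with hν
  have hmass : ν univ ≤ ENNReal.ofReal C := by
    rw [isOpen_univ.measure_eq_iSup_isCompact]
    refine iSup₂_le fun K _ => iSup_le fun hK => ?_
    obtain ⟨χ, hχ1, hχc, hχ⟩ := exists_continuousMap_one_of_isCompact_subset_isOpen hK
      isOpen_univ (subset_univ K)
    let g : C_c(X, ℝ) := ⟨χ, hχc⟩
    refine (RealRMK.rieszMeasure_le_of_eq_one Λ (f := g) (fun x => (hχ.2 x).1) hK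
      (fun x hx => hχ1 hx)).trans (ENNReal.ofReal_le_ofReal ?_)
    refine le_of_tendsto' (hL g) fun k => ?_
    have := abs_integral_le_of_bounded (g := χ) (hC k) zero_le_one fun x =>
      abs_le.mpr ⟨by linarith [(hχ.2 x).1], (hχ.2 x).2⟩
    rw [one_mul] at this
    exact (le_abs_self _).trans this
  have hfin : IsFiniteMeasure ν := ⟨hmass.trans_lt ENNReal.ofReal_lt_top⟩
  refine ⟨ν, hfin, fun φ => ?_⟩
  have hφb : ∃ B : ℝ, ∀ x, |φ x| ≤ B := ⟨‖φ‖, fun x => φ.toBCF.norm_coe_le_norm x⟩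
  obtain ⟨B, hB⟩ := hφb
  have hνC : ν.real univ ≤ C := by
    rw [measureReal_def]
    exact ENNReal.toReal_le_of_le_ofReal hC0 hmass
  rw [Metric.tendsto_nhds]
  intro δ hδ
  set η := δ / (3 * (C + 1)) with hη
  have hη0 : 0 < η := by positivity
  have hηC : η * C < δ / 3 := by
    rw [hη, div_mul_eq_mul_div, div_lt_div_iff₀ (by positivity) (by norm_num)]
    nlinarith
  obtain ⟨g, hg⟩ := exists_compactlySupported_near φ hη0
  have happrox (m : Measure X) [IsFiniteMeasure m] (hm : m.real univ ≤ C) :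
      |∫ x, φ x ∂m - ∫ x, g x ∂m| ≤ η * C := by
    obtain ⟨B', -, hB'⟩ := hbdd g
    have hgi : Integrable g m := integrable_of_bounded (map_continuous g) hB'
    rw [← integral_sub (integrable_of_bounded (map_continuous φ) hB) hgi]
    exact abs_integral_le_of_bounded hm hη0.le hg
  have hLg := hL g
  rw [← hΛ, ← RealRMK.integral_rieszMeasure Λ g, ← hν] at hLg
  filter_upwards [Metric.tendsto_nhds.mp hLg (δ / 3) (by positivity)] with k hk
  rw [Real.dist_eq] at hk ⊢
  have h1 := happrox (μ k) (hC k)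
  have h2 := happrox ν hνC
  rw [abs_lt] at hk ⊢
  rw [abs_le] at h1 h2
  constructor <;> linarith [h1.1, h1.2, h2.1, h2.2, hk.1, hk.2]

end WeakStar

/-! ### Signed measures and test functions -/

section Signed

variable {X : Type*} [MeasurableSpace X]

lemma integral_toSignedMeasure_sub {μ ν : Measure X} [IsFiniteMeasure μ] [IsFiniteMeasure ν]
    {φ : X → ℝ} (hμ : Integrable φ μ) (hν : Integrable φ ν) :
    ∫ᵛ x, φ x ∂<•(μ.toSignedMeasure - ν.toSignedMeasure) = ∫ x, φ x ∂μ - ∫ x, φ x ∂ν := by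
  rw [VectorMeasure.integral_sub_vectorMeasure (by
      rw [VectorMeasure.Integrable, Measure.variation_toSignedMeasure]; exact hμ) (by
      rw [VectorMeasure.Integrable, Measure.variation_toSignedMeasure]; exact hν),
    VectorMeasure.integral_toSignedMeasure, VectorMeasure.integral_toSignedMeasure]

/-- Smooth functions separating a compact set from the complement of an open set. -/
lemma exists_testFunction_one_on {K V : Set (Space d)} (hK : IsCompact K) (hV : IsOpen V)
    (hKV : K ⊆ V) : ∃ v : Space d → ℝ, IsTestFunction V v ∧ EqOn v 1 K ∧
      ∀ x, v x ∈ Icc (0 : ℝ) 1 := by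
  obtain ⟨K', hK', hKK', hK'V⟩ := exists_compact_between hK hV hKV
  obtain ⟨f, hf0, hf1, hf⟩ := exists_contMDiffMap_zero_one_of_isClosed (n := (⊤ : ℕ∞))
    (modelWithCornersSelf ℝ (Space d)) (s := (interior K')ᶜ) (t := K)
    isOpen_interior.isClosed_compl hK.isClosed
    (disjoint_compl_left_iff_subset.mpr hKK')
  have hsupp : tsupport f ⊆ K' := by
    refine closure_minimal (fun x hx => ?_) hK'.isClosed
    by_contra hxK
    exact hx (hf0 fun h => hxK (interior_subset h))
  exact ⟨f, ⟨f.contMDiff.contDiff, hK'.of_isClosed_subset (isClosed_tsupport _) hsupp,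
    hsupp.trans hK'V⟩, hf1, hf⟩

lemma IsTestFunction.mono {V Ω : Set (Space d)} (h : V ⊆ Ω) {v : Space d → ℝ}
    (hv : IsTestFunction V v) : IsTestFunction Ω v := ⟨hv.1, hv.2.1, hv.2.2.trans h⟩

lemma measure_le_of_testFunctions {Ω : Set (Space d)} (hΩ : IsOpen Ω)
    {μ ν : Measure (Space d)} [IsFiniteMeasure μ] [IsFiniteMeasure ν]
    (h : ∀ v, IsTestFunction Ω v → ∫ x, v x ∂μ = ∫ x, v x ∂ν) {K : Set (Space d)}
    (hK : IsCompact K) (hKΩ : K ⊆ Ω) : μ K ≤ ν K := by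
  refine ENNReal.le_of_forall_pos_le_add fun ε hε _ => ?_
  obtain ⟨V₀, hKV₀, hV₀, hνV₀⟩ := K.exists_isOpen_le_add ν (ENNReal.coe_pos.mpr hε).ne'
  set V := V₀ ∩ Ω
  have hV : IsOpen V := hV₀.inter hΩ
  obtain ⟨v, hv, hv1, hv01⟩ := exists_testFunction_one_on hK hV (subset_inter hKV₀ hKΩ)
  have hvint (m : Measure (Space d)) [IsFiniteMeasure m] : Integrable v m :=
    Integrable.of_bound hv.1.continuous.aestronglyMeasurable 1
      (Eventually.of_forall fun x => abs_le.mpr ⟨by linarith [(hv01 x).1], (hv01 x).2⟩)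
  have h1 : μ.real K ≤ ∫ x, v x ∂μ := by
    rw [← integral_indicator_one hK.measurableSet]
    refine integral_mono ((integrable_const (1 : ℝ)).indicator hK.measurableSet) (hvint μ)
      fun x => ?_
    by_cases hx : x ∈ K
    · simp [hx, hv1 hx]
    · simp [hx, (hv01 x).1]
  have h2 : ∫ x, v x ∂ν ≤ ν.real V := by
    rw [← integral_indicator_one hV.measurableSet]
    refine integral_mono (hvint ν) ((integrable_const (1 : ℝ)).indicator hV.measurableSet)
      fun x => ?_
    by_cases hx : x ∈ V
    · simp [hx, (hv01 x).2]
    · have : v x = 0 := image_eq_zero_of_notMem_tsupport fun h => hx (hv.2.2 h)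
      simp [hx, this]
  have h3 : μ.real K ≤ ν.real V := h1.trans ((h v (hv.mono inter_subset_right)).le.trans h2)
  have h4 : μ K ≤ ν V := by
    rw [measureReal_def, measureReal_def,
      ENNReal.toReal_le_toReal (measure_ne_top _ _) (measure_ne_top _ _)] at h3
    exact h3
  exact h4.trans ((measure_mono inter_subset_left).trans hνV₀)

/-- Finite measures on an open set are determined by the integrals of test functions. -/
lemma measure_ext_of_testFunctions {Ω : Set (Space d)} (hΩ : IsOpen Ω)
    {μ ν : Measure Ω} [IsFiniteMeasure μ] [IsFiniteMeasure ν]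
    (h : ∀ v, IsTestFunction Ω v → ∫ x : Ω, v x ∂μ = ∫ x : Ω, v x ∂ν) : μ = ν := by
  have he : MeasurableEmbedding (Subtype.val : Ω → Space d) :=
    MeasurableEmbedding.subtype_coe hΩ.measurableSet
  have h' : ∀ v, IsTestFunction Ω v →
      ∫ x, v x ∂(μ.map Subtype.val) = ∫ x, v x ∂(ν.map Subtype.val) := fun v hv => by
    rw [he.integral_map, he.integral_map, h v hv]
  have hres (m : Measure Ω) (U : Set (Space d)) (hU : IsOpen U) :
      m.map Subtype.val U = m.map Subtype.val (U ∩ Ω) := by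
    rw [he.map_apply, he.map_apply]
    congr 1
    ext x
    simp
  have hmap : μ.map Subtype.val = ν.map Subtype.val := by
    refine Measure.OuterRegular.ext_isOpen fun U hU => ?_
    rw [hres μ U hU, hres ν U hU, (hU.inter hΩ).measure_eq_iSup_isCompact,
      (hU.inter hΩ).measure_eq_iSup_isCompact]
    refine iSup_congr fun K => iSup_congr fun hKU => iSup_congr fun hK => le_antisymm ?_ ?_
    · exact measure_le_of_testFunctions hΩ h' hK (hKU.trans inter_subset_right)
    · exact measure_le_of_testFunctions hΩ (fun v hv => (h' v hv).symm) hK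
        (hKU.trans inter_subset_right)
  rw [← he.comap_map μ, hmap, he.comap_map]

/-- The restriction of a test function to `Ω`, as a function in `C₀(Ω)`. -/
def IsTestFunction.toZeroAtInfty {Ω : Set (Space d)} {v : Space d → ℝ}
    (hv : IsTestFunction Ω v) : C₀(Ω, ℝ) where
  toFun x := v x
  continuous_toFun := hv.1.continuous.comp continuous_subtype_val
  zero_at_infty' := by
    have hc : HasCompactSupport fun x : Ω => v x := by
      refine HasCompactSupport.intro (K := Subtype.val ⁻¹' tsupport v) ?_ fun x hx => ?_
      · exact Topology.IsInducing.subtypeVal.isCompact_preimage_iff (by simpa using hv.2.2)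
          |>.mpr hv.2.1
      · exact image_eq_zero_of_notMem_tsupport hx
    exact hc.is_zero_at_infty

lemma signedMeasure_ext_of_testFunctions {Ω : Set (Space d)} (hΩ : IsOpen Ω)
    {μ ν : SignedMeasure Ω}
    (h : ∀ v, (hv : IsTestFunction Ω v) →
      ∫ᵛ x, hv.toZeroAtInfty x ∂<•μ = ∫ᵛ x, hv.toZeroAtInfty x ∂<•ν) : μ = ν := by
  set μ₁ := μ.toJordanDecomposition.posPart
  set μ₂ := μ.toJordanDecomposition.negPart
  set ν₁ := ν.toJordanDecomposition.posPart
  set ν₂ := ν.toJordanDecomposition.negPart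
  have hμ : μ = μ₁.toSignedMeasure - μ₂.toSignedMeasure :=
    μ.toSignedMeasure_toJordanDecomposition.symm
  have hν : ν = ν₁.toSignedMeasure - ν₂.toSignedMeasure :=
    ν.toSignedMeasure_toJordanDecomposition.symm
  have key : μ₁ + ν₂ = ν₁ + μ₂ := by
    refine measure_ext_of_testFunctions hΩ fun v hv => ?_
    have hint (m : Measure Ω) [IsFiniteMeasure m] : Integrable (fun x : Ω => v x) m :=
      integrable_of_bounded (hv.1.continuous.comp continuous_subtype_val)
        fun x => hv.toZeroAtInfty.toBCF.norm_coe_le_norm x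
    have h1 := h v hv
    have hφ (m : Measure Ω) [IsFiniteMeasure m] : Integrable hv.toZeroAtInfty m := hint m
    rw [hμ, hν, integral_toSignedMeasure_sub (hφ μ₁) (hφ μ₂),
      integral_toSignedMeasure_sub (hφ ν₁) (hφ ν₂)] at h1
    have h2 : ∫ x : Ω, v x ∂μ₁ - ∫ x : Ω, v x ∂μ₂ = ∫ x : Ω, v x ∂ν₁ - ∫ x : Ω, v x ∂ν₂ := h1
    rw [integral_add_measure (hint _) (hint _), integral_add_measure (hint _) (hint _)]
    linarith
  have key2 : μ₁.toSignedMeasure + ν₂.toSignedMeasure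
      = ν₁.toSignedMeasure + μ₂.toSignedMeasure := by
    rw [← Measure.toSignedMeasure_add, ← Measure.toSignedMeasure_add]
    congr 1
  rw [hμ, hν, sub_eq_sub_iff_add_eq_add]
  exact key2

end Signed

/-! ### Identification of limits of the multipliers -/

section Identification

variable {Ω : Set (Space d)} {s : ℝ} {κ : SobolevType}

/-- A signed measure representing limits of functions bounded in `L¹(Ω)`. -/
lemma exists_signedMeasure_of_bounded (hΩ : IsOpen Ω) [IsFiniteMeasure (volume.restrict Ω)]
    (lam : ℕ → L2 Ω) {C : ℝ} (hC : ∀ k, ∫ x in Ω, |lam k x| ≤ C) :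
    ∃ ν : SignedMeasure Ω, ∀ (φ : C₀(Ω, ℝ)) (z : L2 Ω) (a : ℝ),
      (∀ᵐ x ∂volume.restrict Ω, ∀ hx : x ∈ Ω, z x = φ ⟨x, hx⟩) →
      Tendsto (fun k => inner ℝ (lam k) z) atTop (𝓝 a) → a = ∫ᵛ x, φ x ∂<•ν := by
  have hm : MeasurableSet Ω := hΩ.measurableSet
  have : LocallyCompactSpace Ω := hΩ.locallyCompactSpace
  set vol : Measure Ω := volume.comap Subtype.val with hvol
  have hint (g : Space d → ℝ) : ∫ x : Ω, g x ∂vol = ∫ x in Ω, g x :=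
    integral_subtype_comap hm g
  have hlamI (k : ℕ) : Integrable (fun x : Ω => lam k x) vol := by
    have := integrable_Lp (lam k)
    exact (integrableOn_iff_comap_subtypeVal hm).mp this
  have habs (k : ℕ) : ∫ x : Ω, |lam k x| ∂vol ≤ C := by
    rw [hint fun x => |lam k x|]; exact hC k
  let μ (σ : ℝ) (k : ℕ) : Measure Ω :=
    vol.withDensity fun x => ENNReal.ofReal (max (σ * lam k x) 0)
  have hI (σ : ℝ) (k : ℕ) : Integrable (fun x : Ω => max (σ * lam k x) 0) vol :=
    ((hlamI k).const_mul σ).pos_part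
  have hμuniv (σ : ℝ) (hσ : |σ| = 1) (k : ℕ) : μ σ k univ ≤ ENNReal.ofReal C := by
    change vol.withDensity _ univ ≤ _
    rw [withDensity_apply _ MeasurableSet.univ, Measure.restrict_univ,
      ← ofReal_integral_eq_lintegral_ofReal (hI σ k)
        (Eventually.of_forall fun x => le_max_right _ _)]
    refine ENNReal.ofReal_le_ofReal (le_trans ?_ (habs k))
    refine integral_mono (hI σ k) (hlamI k).abs fun x => max_le ?_ (abs_nonneg _)
    calc σ * lam k x ≤ |σ * lam k x| := le_abs_self _
      _ = |lam k x| := by rw [abs_mul, hσ, one_mul]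
  have hC0 : 0 ≤ C := (integral_nonneg fun x => abs_nonneg _).trans (hC 0)
  have hfin (σ : ℝ) (hσ : |σ| = 1) (k : ℕ) : IsFiniteMeasure (μ σ k) :=
    ⟨(hμuniv σ hσ k).trans_lt ENNReal.ofReal_lt_top⟩
  have hreal (σ : ℝ) (hσ : |σ| = 1) (k : ℕ) : (μ σ k).real univ ≤ C :=
    ENNReal.toReal_le_of_le_ofReal hC0 (hμuniv σ hσ k)
  let 𝒰 : Ultrafilter ℕ := Ultrafilter.of atTop
  have h𝒰 : (𝒰 : Filter ℕ) ≤ atTop := Ultrafilter.of_le _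
  have f1 := hfin 1 (by simp)
  have f2 := hfin (-1) (by simp)
  obtain ⟨ν₁, hν₁, h1⟩ := exists_weakStar_limit 𝒰 (μ 1) (hreal 1 (by simp))
  obtain ⟨ν₂, hν₂, h2⟩ := exists_weakStar_limit 𝒰 (μ (-1)) (hreal (-1) (by simp))
  refine ⟨ν₁.toSignedMeasure - ν₂.toSignedMeasure, fun φ z a hz ha => ?_⟩
  have hφ (m : Measure Ω) [IsFiniteMeasure m] : Integrable φ m :=
    integrable_of_bounded (map_continuous φ) fun x => φ.toBCF.norm_coe_le_norm x
  rw [integral_toSignedMeasure_sub (hφ ν₁) (hφ ν₂)]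
  refine tendsto_nhds_unique (ha.mono_left h𝒰) (((h1 φ).sub (h2 φ)).congr fun k => ?_)
  have hdens (σ : ℝ) : ∫ x, φ x ∂(μ σ k) = ∫ x : Ω, max (σ * lam k x) 0 * φ x ∂vol := by
    change ∫ x, φ x ∂(vol.withDensity _) = _
    rw [integral_withDensity_eq_integral_toReal_smul₀]
    · refine integral_congr_ae (Eventually.of_forall fun x => ?_)
      simp only [smul_eq_mul]
      rw [ENNReal.toReal_ofReal (le_max_right _ _)]
    · exact (hI σ k).aestronglyMeasurable.aemeasurable.ennreal_ofReal
    · exact Eventually.of_forall fun x => ENNReal.ofReal_lt_top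
  have hI' (σ : ℝ) : Integrable (fun x : Ω => max (σ * lam k x) 0 * φ x) vol :=
    (hI σ k).mul_bdd (c := ‖φ‖) (map_continuous φ).aestronglyMeasurable
      (Eventually.of_forall fun x => φ.toBCF.norm_coe_le_norm x)
  rw [hdens, hdens, ← integral_sub (hI' _) (hI' _), inner_eq_integral,
    ← hint fun x => lam k x * z x]
  refine integral_congr_ae ?_
  have hz' : ∀ᵐ x : Ω ∂vol, z x = φ x := by
    rw [ae_restrict_iff_subtype hm] at hz
    filter_upwards [hz] with x hx
    exact hx x.2
  filter_upwards [hz'] with x hx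
  rw [hx, ← sub_mul, one_mul, neg_one_mul]
  congr 1
  rcases le_total (lam k x) 0 with h | h
  · rw [max_eq_right h, max_eq_left (by linarith)]; ring
  · rw [max_eq_left h, max_eq_right (by linarith)]; ring

variable {H : Type*} [NormedAddCommGroup H] [InnerProductSpace ℝ H]
  {J : fracSobolev Ω s κ →ₗ[ℝ] H}

lemma tendsto_apply_of_tendsto_dualNorm (hn : ∀ z : fracSobolev Ω s κ, wNorm Ω s κ z = ‖J z‖)
    {ℓ : ℕ → Module.Dual ℝ (fracSobolev Ω s κ)} {ℓ' : Module.Dual ℝ (fracSobolev Ω s κ)}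
    (h : Tendsto (fun k => dualNorm Ω s κ (ℓ k - ℓ')) atTop (𝓝 0)) (z : fracSobolev Ω s κ) :
    Tendsto (fun k => ℓ k z) atTop (𝓝 (ℓ' z)) := by
  set c : ℝ := ‖J z‖ + 1 with hc
  have hc0 : 0 < c := by positivity
  have hle (k : ℕ) : ‖(ℓ k - ℓ') (c⁻¹ • z)‖ₑ ≤ dualNorm Ω s κ (ℓ k - ℓ') := by
    refine le_iSup₂_of_le (f := fun (z : fracSobolev Ω s κ) (_ : wNorm Ω s κ z ≤ 1) =>
      ‖(ℓ k - ℓ') z‖ₑ) (c⁻¹ • z) ?_ le_rfl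
    rw [hn, map_smul, norm_smul, norm_inv, Real.norm_of_nonneg hc0.le, inv_mul_le_one₀ hc0]
    linarith
  have h1 : Tendsto (fun k => ‖(ℓ k - ℓ') (c⁻¹ • z)‖ₑ) atTop (𝓝 0) :=
    tendsto_of_tendsto_of_tendsto_of_le_of_le tendsto_const_nhds h (fun _ => zero_le) hle
  have h2 : Tendsto (fun k => (ℓ k - ℓ') (c⁻¹ • z)) atTop (𝓝 0) :=
    tendsto_zero_iff_enorm_tendsto_zero.mpr h1
  have h3 := h2.const_mul c
  rw [mul_zero] at h3
  rw [← tendsto_sub_nhds_zero_iff]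
  refine h3.congr fun k => ?_
  rw [map_smul, smul_eq_mul, ← mul_assoc, mul_inv_cancel₀ hc0.ne', one_mul]
  rfl

lemma existsUnique_identified (hΩ : IsOpen Ω) [IsFiniteMeasure (volume.restrict Ω)]
    (hJ : EnergyModel (fracSobolev Ω s κ) J)
    (hn : ∀ z : fracSobolev Ω s κ, wNorm Ω s κ z = ‖J z‖)
    (lam : ℕ → L2 Ω) {C : ℝ} (hC : ∀ k, ∫ x in Ω, |lam k x| ≤ C)
    (ℓ : Module.Dual ℝ (fracSobolev Ω s κ))
    (h : Tendsto (fun k => dualNorm Ω s κ (toFunctional Ω s κ (lam k) - ℓ)) atTop (𝓝 0)) :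
    ∃! ν : SignedMeasure Ω, IsIdentifiedWith Ω s κ ℓ ν := by
  obtain ⟨ν, hν⟩ := exists_signedMeasure_of_bounded hΩ lam hC
  refine ⟨ν, fun φ z hz => hν φ z (ℓ z) hz (tendsto_apply_of_tendsto_dualNorm hn h z),
    fun ν' hν' => ?_⟩
  refine signedMeasure_ext_of_testFunctions hΩ fun v hv => ?_
  obtain ⟨z, hz⟩ := hJ.test v hv
  have hz' : ∀ᵐ x ∂volume.restrict Ω, ∀ hx : x ∈ Ω,
      (z : L2 Ω) x = hv.toZeroAtInfty ⟨x, hx⟩ := by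
    filter_upwards [hz] with x hx _
    exact hx
  rw [← hν' _ z hz']
  exact hν _ z (ℓ z) hz' (tendsto_apply_of_tendsto_dualNorm hn h z)

end Identification

end SparseControl
end

noncomputable section

namespace SparseControl

variable {d : ℕ}

/-! ### Test functions belong to the fractional Sobolev spaces -/

lemma enorm_integral_sq_le {X : Type*} [MeasurableSpace X] {P : Measure X} [IsProbabilityMeasure P]
    {g : X → ℝ} (hg : AEStronglyMeasurable g P) :
    ‖∫ x, g x ∂P‖ₑ ^ 2 ≤ ∫⁻ x, ‖g x‖ₑ ^ 2 ∂P := by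
  have h1 : ‖∫ x, g x ∂P‖ₑ ≤ eLpNorm g 1 P := by
    rw [eLpNorm_one_eq_lintegral_enorm]
    exact enorm_integral_le_lintegral_enorm g
  have h2 : eLpNorm g 1 P ≤ eLpNorm g 2 P :=
    eLpNorm_le_eLpNorm_of_exponent_le (by norm_num) hg
  have h3 : eLpNorm g 2 P ^ 2 = ∫⁻ x, ‖g x‖ₑ ^ 2 ∂P := by
    have := eLpNorm_nnreal_pow_eq_lintegral (f := g) (μ := P) (p := 2) two_ne_zero
    simpa using this
  rw [← h3]
  gcongr
  exact h1.trans h2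

lemma eLpNorm_two_sq {X E : Type*} [MeasurableSpace X] [NormedAddCommGroup E] {μ : Measure X}
    (g : X → E) : eLpNorm g 2 μ ^ 2 = ∫⁻ x, ‖g x‖ₑ ^ 2 ∂μ := by
  have := eLpNorm_nnreal_pow_eq_lintegral (f := g) (μ := μ) (p := 2) two_ne_zero
  simpa using this

lemma norm_gradient (v : Space d → ℝ) (x : Space d) : ‖gradient v x‖ = ‖fderiv ℝ v x‖ := by
  rw [gradient, LinearIsometryEquiv.norm_map]

lemma enorm_sub_sq_le {v : Space d → ℝ} (hv : ContDiff ℝ ∞ v) (x h : Space d) :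
    ‖v x - v (x - h)‖ₑ ^ 2 ≤
      ‖h‖ₑ ^ 2 * ∫⁻ τ in Ioc (0 : ℝ) 1, ‖gradient v (x - h + τ • h)‖ₑ ^ 2 := by
  have hd (τ : ℝ) : HasDerivAt (fun τ : ℝ => v (x - h + τ • h)) (fderiv ℝ v (x - h + τ • h) h) τ := by
    have h1 : HasDerivAt (fun τ : ℝ => x - h + τ • h) h τ := by
      simpa using ((hasDerivAt_id τ).smul_const h).const_add (x - h)
    exact ((hv.differentiable (by simp)) _).hasFDerivAt.comp_hasDerivAt τ h1
  have hcf : Continuous (fderiv ℝ v) := hv.continuous_fderiv (by simp)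
  have hc : Continuous fun τ : ℝ => fderiv ℝ v (x - h + τ • h) h := by fun_prop
  have hint := intervalIntegral.integral_eq_sub_of_hasDerivAt (fun τ _ => hd τ)
    (hc.intervalIntegrable 0 1)
  simp only [one_smul, sub_add_cancel, zero_smul, add_zero] at hint
  rw [intervalIntegral.integral_of_le zero_le_one] at hint
  have : IsProbabilityMeasure (volume.restrict (Ioc (0 : ℝ) 1)) := ⟨by simp⟩
  rw [← hint]
  refine (enorm_integral_sq_le hc.aestronglyMeasurable).trans ?_
  rw [← lintegral_const_mul' _ _ (by simp)]
  refine lintegral_mono fun τ => ?_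
  rw [← mul_pow]
  gcongr
  rw [mul_comm, ← enorm_norm, ← enorm_norm (gradient v _), ← enorm_norm h, ← enorm_mul,
    norm_gradient]
  exact enorm_le_iff_norm_le.mpr (by
    simpa using (fderiv ℝ v (x - h + τ • h)).le_opNorm h)

lemma continuous_gradient {v : Space d → ℝ} (hv : ContDiff ℝ ∞ v) : Continuous (gradient v) :=
  (LinearIsometryEquiv.continuous _).comp (hv.continuous_fderiv (by simp))

lemma lintegral_sub_translate_le {v : Space d → ℝ} (hv : ContDiff ℝ ∞ v) (h : Space d) :
    ∫⁻ x, ‖v x - v (x - h)‖ₑ ^ 2 ≤ ‖h‖ₑ ^ 2 * ∫⁻ x, ‖gradient v x‖ₑ ^ 2 := by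
  calc ∫⁻ x, ‖v x - v (x - h)‖ₑ ^ 2
      ≤ ∫⁻ x, ‖h‖ₑ ^ 2 * ∫⁻ τ in Ioc (0 : ℝ) 1, ‖gradient v (x - h + τ • h)‖ₑ ^ 2 :=
        lintegral_mono fun x => enorm_sub_sq_le hv x h
    _ = ‖h‖ₑ ^ 2 * ∫⁻ x, ∫⁻ τ in Ioc (0 : ℝ) 1, ‖gradient v (x - h + τ • h)‖ₑ ^ 2 := by
        rw [lintegral_const_mul' _ _ (by simp)]
    _ = ‖h‖ₑ ^ 2 * ∫⁻ τ in Ioc (0 : ℝ) 1, ∫⁻ x, ‖gradient v (x - h + τ • h)‖ₑ ^ 2 := by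
        rw [lintegral_lintegral_swap]
        have hcg := continuous_gradient hv
        have : Continuous (Function.uncurry fun (x : Space d) (τ : ℝ) =>
            ‖gradient v (x - h + τ • h)‖ₑ ^ 2) := by
          simp only [Function.uncurry_def]
          exact (ENNReal.continuous_pow 2).comp
            (continuous_enorm.comp (hcg.comp (by fun_prop)))
        exact this.measurable.aemeasurable
    _ = ‖h‖ₑ ^ 2 * ∫⁻ τ in Ioc (0 : ℝ) 1, ∫⁻ x, ‖gradient v x‖ₑ ^ 2 := by
        congr 1
        refine lintegral_congr fun τ => ?_
        have e : ∀ x, x - h + τ • h = x + (τ • h - h) := fun x => by abel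
        simp only [e]
        exact lintegral_add_right_eq_self (fun x => ‖gradient v x‖ₑ ^ 2) _
    _ = _ := by simp

/-- The kernel of the fractional Sobolev seminorm. -/
def hsKernel (d : ℕ) (s : ℝ) (h : Space d) : ℝ≥0∞ := ‖(‖h‖ ^ ((d : ℝ) / 2 + s))⁻¹‖ₑ ^ 2

lemma measurable_hsKernel (s : ℝ) : Measurable (hsKernel d s) := by
  unfold hsKernel
  fun_prop

lemma enorm_diffQuot_sq (s : ℝ) (v : Space d → ℝ) (x y : Space d) :
    ‖diffQuot s v (x, y)‖ₑ ^ 2 = hsKernel d s (x - y) * ‖v x - v y‖ₑ ^ 2 := by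
  rw [diffQuot, div_eq_mul_inv, enorm_mul, mul_pow, mul_comm, hsKernel]

lemma lintegral_hsKernel_lt_top (hd : 0 < d) {s : ℝ} (hs0 : 0 < s) (hs1 : s < 1) :
    ∫⁻ h, hsKernel d s h * ENNReal.ofReal (min (‖h‖ ^ 2) 1) < ⊤ := by
  have hnt : Nontrivial (Space d) := by
    have : Nonempty (Fin d) := ⟨⟨0, hd⟩⟩
    infer_instance
  set g : ℝ → ℝ := fun r => r ^ (-((d : ℝ) + 2 * s)) * min (r ^ 2) 1 with hg
  have hgi : Integrable (fun h : Space d => g ‖h‖) := by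
    rw [integrable_fun_norm_addHaar]
    have hfin : Module.finrank ℝ (Space d) = d := by simp
    rw [hfin]
    have e : ∀ r ∈ Ioi (0 : ℝ), r ^ (d - 1) • g r = r ^ (-1 - 2 * s) * min (r ^ 2) 1 := by
      intro r hr
      have hr : 0 < r := hr
      rw [hg, smul_eq_mul, ← mul_assoc, ← Real.rpow_natCast r (d - 1), ← Real.rpow_add hr]
      congr 2
      rw [Nat.cast_sub hd]; push_cast; ring
    rw [integrableOn_congr_fun e measurableSet_Ioi, ← Ioc_union_Ioi_eq_Ioi zero_le_one]
    refine IntegrableOn.union ?_ ?_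
    · have h1 : IntegrableOn (fun r : ℝ => r ^ (1 - 2 * s)) (Ioc 0 1) := by
        rw [← intervalIntegrable_iff_integrableOn_Ioc_of_le zero_le_one]
        exact intervalIntegral.intervalIntegrable_rpow' (by linarith)
      refine h1.congr_fun (fun r hr => ?_) measurableSet_Ioc
      have hr2 : r ^ 2 ≤ 1 := pow_le_one₀ hr.1.le hr.2
      change r ^ (1 - 2 * s) = r ^ (-1 - 2 * s) * min (r ^ 2) 1
      rw [min_eq_left hr2, ← Real.rpow_natCast r 2, ← Real.rpow_add hr.1]
      congr 1; push_cast; ring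
    · have h1 : IntegrableOn (fun r : ℝ => r ^ (-1 - 2 * s)) (Ioi 1) :=
        integrableOn_Ioi_rpow_of_lt (by linarith) one_pos
      refine h1.congr_fun (fun r hr => ?_) measurableSet_Ioi
      have hr2 : 1 ≤ r ^ 2 := one_le_pow₀ (le_of_lt hr)
      change r ^ (-1 - 2 * s) = r ^ (-1 - 2 * s) * min (r ^ 2) 1
      rw [min_eq_right hr2, mul_one]
  refine lt_of_le_of_lt (lintegral_mono fun h => ?_) hgi.2
  rw [hsKernel, ← enorm_pow, ← ofReal_norm, ← ofReal_norm,
    ← ENNReal.ofReal_mul (norm_nonneg _)]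
  refine ENNReal.ofReal_le_ofReal (le_of_eq ?_)
  have h0 : 0 ≤ ‖h‖ := norm_nonneg h
  rw [hg, Real.norm_of_nonneg (by positivity), Real.norm_of_nonneg (by positivity)]
  congr 1
  rw [inv_pow, ← Real.rpow_natCast, ← Real.rpow_mul h0, ← Real.rpow_neg h0]
  congr 1; push_cast; ring

lemma ae_restrict_univ_measure : volume.restrict (univ : Set (Space d)) = volume :=
  Measure.restrict_univ

lemma aestronglyMeasurable_diffQuot {A : Set (Space d)} (s : ℝ) {w : Space d → ℝ}
    (hw : AEStronglyMeasurable w (volume.restrict A)) :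
    AEStronglyMeasurable (diffQuot s w) (sqMeasure A) := by
  unfold diffQuot
  refine AEMeasurable.aestronglyMeasurable ?_
  refine AEMeasurable.div (AEMeasurable.sub ?_ ?_) ?_
  · exact hw.aemeasurable.comp_quasiMeasurePreserving Measure.quasiMeasurePreserving_fst
  · exact hw.aemeasurable.comp_quasiMeasurePreserving Measure.quasiMeasurePreserving_snd
  · exact Measurable.aemeasurable (by fun_prop)

/-- The seminorm of `H^s(ℝᵈ)` is bounded by the norm of `H¹(ℝᵈ)`. -/
lemma exists_eLpNorm_diffQuot_le (hd : 0 < d) {s : ℝ} (hs0 : 0 < s) (hs1 : s < 1) :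
    ∃ C : ℝ≥0∞, C < ⊤ ∧ ∀ v : Space d → ℝ, ContDiff ℝ ∞ v →
      eLpNorm (diffQuot s v) 2 (sqMeasure univ) ^ 2 ≤
        C * (eLpNorm v 2 volume ^ 2 + eLpNorm (gradient v) 2 volume ^ 2) := by
  refine ⟨4 * ∫⁻ h, hsKernel d s h * ENNReal.ofReal (min (‖h‖ ^ 2) 1),
    ENNReal.mul_lt_top (by norm_num) (lintegral_hsKernel_lt_top hd hs0 hs1), fun v hv => ?_⟩
  have hvc : Continuous v := hv.continuous
  set N := eLpNorm v 2 volume ^ 2 + eLpNorm (gradient v) 2 volume ^ 2 with hN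
  have hinner (h : Space d) : ∫⁻ x, ‖v x - v (x - h)‖ₑ ^ 2
      ≤ 4 * ENNReal.ofReal (min (‖h‖ ^ 2) 1) * N := by
    have h1 : ∫⁻ x, ‖v x - v (x - h)‖ₑ ^ 2 ≤ 4 * ENNReal.ofReal (‖h‖ ^ 2) * N := by
      refine (lintegral_sub_translate_le hv h).trans ?_
      rw [← eLpNorm_two_sq, ENNReal.ofReal_pow (norm_nonneg _), ofReal_norm]
      refine mul_le_mul' ?_ le_add_self
      calc ‖h‖ₑ ^ 2 = 1 * ‖h‖ₑ ^ 2 := (one_mul _).symm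
        _ ≤ 4 * ‖h‖ₑ ^ 2 := by gcongr; norm_num
    have h2 : ∫⁻ x, ‖v x - v (x - h)‖ₑ ^ 2 ≤ 4 * N := by
      have hm : eLpNorm (fun x => v x - v (x - h)) 2 volume ≤ 2 * eLpNorm v 2 volume := by
        refine (eLpNorm_sub_le hvc.aestronglyMeasurable
          (hvc.comp (continuous_id.sub continuous_const)).aestronglyMeasurable (by norm_num)).trans ?_
        have : eLpNorm (fun x => v (x - h)) 2 volume = eLpNorm v 2 volume :=
          eLpNorm_comp_measurePreserving hvc.aestronglyMeasurable
            (measurePreserving_sub_right volume h)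
        rw [two_mul]
        exact add_le_add le_rfl this.le
      rw [← eLpNorm_two_sq]
      calc eLpNorm (fun x => v x - v (x - h)) 2 volume ^ 2 ≤ (2 * eLpNorm v 2 volume) ^ 2 := by
            gcongr
        _ = 4 * eLpNorm v 2 volume ^ 2 := by rw [mul_pow]; norm_num
        _ ≤ 4 * N := by gcongr; exact le_self_add
    rcases le_total (‖h‖ ^ 2) 1 with hh | hh
    · rwa [min_eq_left hh]
    · rw [min_eq_right hh]; simpa using h2
  rw [eLpNorm_two_sq, sqMeasure, ae_restrict_univ_measure]
  have hm : Measurable fun z : Space d × Space d => hsKernel d s (z.1 - z.2) :=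
    (measurable_hsKernel s).comp (by fun_prop)
  have hm2 : Measurable fun z : Space d × Space d => ‖v z.1 - v z.2‖ₑ ^ 2 := by
    have := hvc.measurable
    fun_prop
  have hmm : Measurable fun z : Space d × Space d => ‖diffQuot s v z‖ₑ ^ 2 := by
    have : (fun z : Space d × Space d => ‖diffQuot s v z‖ₑ ^ 2)
        = fun z => hsKernel d s (z.1 - z.2) * ‖v z.1 - v z.2‖ₑ ^ 2 :=
      funext fun z => enorm_diffQuot_sq s v z.1 z.2
    rw [this]
    exact hm.mul hm2
  have hm3 : Measurable fun z : Space d × Space d =>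
      hsKernel d s z.2 * ‖v z.1 - v (z.1 - z.2)‖ₑ ^ 2 := by
    have := hvc.measurable
    have h2 : Measurable fun z : Space d × Space d => ‖v z.1 - v (z.1 - z.2)‖ₑ ^ 2 := by fun_prop
    exact ((measurable_hsKernel s).comp measurable_snd).mul h2
  rw [lintegral_prod _ hmm.aemeasurable]
  simp only [enorm_diffQuot_sq]
  calc ∫⁻ x, ∫⁻ y, hsKernel d s (x - y) * ‖v x - v y‖ₑ ^ 2
      = ∫⁻ x, ∫⁻ h, hsKernel d s h * ‖v x - v (x - h)‖ₑ ^ 2 := by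
        refine lintegral_congr fun x => ?_
        have := lintegral_sub_left_eq_self (μ := (volume : Measure (Space d)))
          (fun h => hsKernel d s h * ‖v x - v (x - h)‖ₑ ^ 2) x
        simpa using this
    _ = ∫⁻ h, ∫⁻ x, hsKernel d s h * ‖v x - v (x - h)‖ₑ ^ 2 :=
        lintegral_lintegral_swap hm3.aemeasurable
    _ = ∫⁻ h, hsKernel d s h * ∫⁻ x, ‖v x - v (x - h)‖ₑ ^ 2 := by
        refine lintegral_congr fun h => lintegral_const_mul _ ?_
        have := hvc.measurable
        fun_prop
    _ ≤ ∫⁻ h, hsKernel d s h * (4 * ENNReal.ofReal (min (‖h‖ ^ 2) 1) * N) := by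
        gcongr with h
        exact hinner h
    _ = ∫⁻ h, (hsKernel d s h * ENNReal.ofReal (min (‖h‖ ^ 2) 1)) * (4 * N) := by
        refine lintegral_congr fun h => ?_
        ring
    _ = _ := by
        have hk : Measurable fun h : Space d => hsKernel d s h * ENNReal.ofReal (min (‖h‖ ^ 2) 1) :=
          (measurable_hsKernel s).mul (by fun_prop)
        rw [lintegral_mul_const _ hk]
        ring

lemma IsTestFunction.memLp {Ω : Set (Space d)} {v : Space d → ℝ} (hv : IsTestFunction Ω v)
    (μ : Measure (Space d)) [IsFiniteMeasureOnCompacts μ] : MemLp v 2 μ :=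
  hv.1.continuous.memLp_of_hasCompactSupport hv.2.1

lemma IsTestFunction.hasCompactSupport_gradient {Ω : Set (Space d)} {v : Space d → ℝ}
    (hv : IsTestFunction Ω v) : HasCompactSupport (gradient v) :=
  (hv.2.1.fderiv (𝕜 := ℝ)).comp_left (g := (InnerProductSpace.toDual ℝ (Space d)).symm) (map_zero _)

lemma IsTestFunction.memLp_gradient {Ω : Set (Space d)} {v : Space d → ℝ}
    (hv : IsTestFunction Ω v) (μ : Measure (Space d)) [IsFiniteMeasureOnCompacts μ] :
    MemLp (gradient v) 2 μ :=
  (continuous_gradient hv.1).memLp_of_hasCompactSupport hv.hasCompactSupport_gradient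

lemma sqMeasure_mono {A B : Set (Space d)} (h : A ⊆ B) : sqMeasure A ≤ sqMeasure B := by
  rw [sqMeasure, sqMeasure, Measure.prod_restrict, Measure.prod_restrict]
  exact Measure.restrict_mono (prod_mono h h) le_rfl

lemma MemHs.mono {A B : Set (Space d)} (h : A ⊆ B) {s : ℝ} {w : Space d → ℝ} (hw : MemHs B s w) :
    MemHs A s w :=
  ⟨hw.1.mono_measure (Measure.restrict_mono h le_rfl), hw.2.mono_measure (sqMeasure_mono h)⟩

/-- Test functions belong to `H^s(ℝᵈ)`. -/
lemma IsTestFunction.memHs (hd : 0 < d) {s : ℝ} (hs0 : 0 < s) (hs1 : s < 1) {Ω : Set (Space d)}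
    {v : Space d → ℝ} (hv : IsTestFunction Ω v) : MemHs univ s v := by
  refine ⟨hv.memLp _, aestronglyMeasurable_diffQuot s (hv.memLp _).1, ?_⟩
  obtain ⟨C, hC, hle⟩ := exists_eLpNorm_diffQuot_le hd hs0 hs1
  have h := (hle v hv.1).trans_lt (ENNReal.mul_lt_top hC (ENNReal.add_lt_top.mpr
    ⟨ENNReal.pow_lt_top (hv.memLp _).2, ENNReal.pow_lt_top (hv.memLp_gradient _).2⟩))
  exact lt_top_of_lt_top_of_pow h
where
  lt_top_of_lt_top_of_pow {a : ℝ≥0∞} (h : a ^ 2 < ⊤) : a < ⊤ := by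
    by_contra hh
    rw [not_lt, top_le_iff] at hh
    simp [hh] at h

end SparseControl
end

noncomputable section

namespace SparseControl

variable {d : ℕ}

/-! ### Compactness -/

lemma enorm_sq_le_two_mul (p q : ℝ) : ‖p‖ₑ ^ 2 ≤ 2 * (‖p - q‖ₑ ^ 2 + ‖q‖ₑ ^ 2) := by
  have h (r : ℝ) : ‖r‖ₑ ^ 2 = ENNReal.ofReal (r ^ 2) := by
    rw [Real.enorm_eq_ofReal_abs, ← ENNReal.ofReal_pow (abs_nonneg r), sq_abs]
  rw [h, h, h, ← ENNReal.ofReal_add (sq_nonneg _) (sq_nonneg _), ← ENNReal.ofReal_ofNat 2,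
    ← ENNReal.ofReal_mul (by norm_num)]
  exact ENNReal.ofReal_le_ofReal (by nlinarith [sq_nonneg (p - q - q)])

/-- The uniform probability measure on a ball. -/
def ballMeasure (x : Space d) (δ : ℝ) : Measure (Space d) :=
  (volume (Metric.ball (0 : Space d) δ))⁻¹ • volume.restrict (Metric.ball x δ)

lemma isProbabilityMeasure_ballMeasure (x : Space d) {δ : ℝ} (hδ : 0 < δ) :
    IsProbabilityMeasure (ballMeasure x δ) := by
  refine ⟨?_⟩
  rw [ballMeasure, Measure.smul_apply, Measure.restrict_apply_univ, smul_eq_mul,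
    Measure.addHaar_ball_center _ x]
  exact ENNReal.inv_mul_cancel (Metric.measure_ball_pos _ _ hδ).ne' (measure_ball_lt_top (μ := volume) (x := (0 : Space d))).ne

lemma enorm_sub_integral_ballMeasure_sq_le {s δ : ℝ} (hs0 : 0 < s) (hδ : 0 < δ)
    {A : Set (Space d)} {x : Space d} (hx : Metric.ball x δ ⊆ A) {v : Space d → ℝ}
    (hv : MemLp v 2 (volume.restrict A)) :
    ‖v x - ∫ y, v y ∂ballMeasure x δ‖ₑ ^ 2 ≤
      (volume (Metric.ball (0 : Space d) δ))⁻¹ * ENNReal.ofReal (δ ^ ((d : ℝ) / 2 + s)) ^ 2 *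
        ∫⁻ y in A, ‖diffQuot s v (x, y)‖ₑ ^ 2 := by
  have hP := isProbabilityMeasure_ballMeasure x hδ
  have hvB : MemLp v 2 (ballMeasure x δ) :=
    (hv.mono_measure (Measure.restrict_mono hx le_rfl)).smul_measure
      (ENNReal.inv_ne_top.mpr (Metric.measure_ball_pos _ _ hδ).ne')
  have e : v x - ∫ y, v y ∂ballMeasure x δ = ∫ y, (v x - v y) ∂ballMeasure x δ := by
    rw [integral_sub (integrable_const _) (hvB.integrable (by norm_num))]
    simp
  rw [e]
  refine (enorm_integral_sq_le (aestronglyMeasurable_const.sub hvB.1)).trans ?_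
  rw [ballMeasure, lintegral_smul_measure, smul_eq_mul, mul_assoc]
  gcongr
  rw [← lintegral_const_mul' _ _ (by simp)]
  refine le_trans ?_ (lintegral_mono_set hx)
  refine setLIntegral_mono' measurableSet_ball fun y hy => ?_
  rw [← mul_pow]
  gcongr
  have hxy : ‖x - y‖ ≤ δ := by
    rw [← dist_eq_norm, dist_comm]; exact (Metric.mem_ball.mp hy).le
  rw [← ofReal_norm, ← ofReal_norm, ← ENNReal.ofReal_mul (by positivity)]
  refine ENNReal.ofReal_le_ofReal ?_
  have hpos : 0 < (d : ℝ) / 2 + s := by positivity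
  rw [diffQuot, norm_div, Real.norm_of_nonneg (Real.rpow_nonneg (norm_nonneg _) _)]
  rcases eq_or_lt_of_le (norm_nonneg (x - y)) with h0 | h0
  · have : x = y := by rwa [eq_comm, norm_eq_zero, sub_eq_zero] at h0
    simp [this]
  · have h1 := Real.rpow_le_rpow h0.le hxy hpos.le
    have h2 := Real.rpow_pos_of_pos h0 ((d : ℝ) / 2 + s)
    rw [mul_div_assoc', le_div_iff₀ h2, mul_comm]
    exact mul_le_mul_of_nonneg_right h1 (norm_nonneg _)

lemma enorm_integral_ballMeasure_sq_le {δ : ℝ} (hδ : 0 < δ)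
    {A : Set (Space d)} {x : Space d} (hx : Metric.ball x δ ⊆ A) {v : Space d → ℝ}
    (hv : MemLp v 2 (volume.restrict A)) :
    ‖∫ y, v y ∂ballMeasure x δ‖ₑ ^ 2 ≤
      (volume (Metric.ball (0 : Space d) δ))⁻¹ * eLpNorm v 2 (volume.restrict A) ^ 2 := by
  have hP := isProbabilityMeasure_ballMeasure x hδ
  have hvB : MemLp v 2 (ballMeasure x δ) :=
    (hv.mono_measure (Measure.restrict_mono hx le_rfl)).smul_measure
      (ENNReal.inv_ne_top.mpr (Metric.measure_ball_pos _ _ hδ).ne')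
  refine (enorm_integral_sq_le hvB.1).trans ?_
  rw [ballMeasure, lintegral_smul_measure, smul_eq_mul, eLpNorm_two_sq]
  gcongr

lemma aestronglyMeasurable_integral_ballMeasure {δ : ℝ}
    {A K : Set (Space d)} (hK : MeasurableSet K) (hx : ∀ x ∈ K, Metric.ball x δ ⊆ A)
    {v : Space d → ℝ} (hv : MemLp v 2 (volume.restrict A)) :
    AEStronglyMeasurable (fun x => ∫ y, v y ∂ballMeasure x δ) (volume.restrict K) := by
  have hS : MeasurableSet {z : Space d × Space d | dist z.2 z.1 < δ} :=
    measurableSet_lt (by fun_prop) measurable_const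
  have h1 : AEStronglyMeasurable (fun z : Space d × Space d => v z.2)
      ((volume.restrict K).prod (volume.restrict A)) := hv.1.comp_snd
  have h2 := (h1.indicator hS).integral_prod_right'
  refine (h2.const_smul (volume (Metric.ball (0 : Space d) δ))⁻¹.toReal).congr ?_
  filter_upwards [ae_restrict_mem hK] with x hxK
  rw [ballMeasure, integral_smul_measure]
  refine congrArg (fun r : ℝ => (volume (Metric.ball (0 : Space d) δ))⁻¹.toReal • r) ?_
  have e : (fun y => {z : Space d × Space d | dist z.2 z.1 < δ}.indicator (fun z => v z.2) (x, y))
      = (Metric.ball x δ).indicator v := by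
    funext y
    simp only [indicator, mem_ofPred_eq, Metric.mem_ball]
  change ∫ y in A, {z : Space d × Space d | dist z.2 z.1 < δ}.indicator (fun z => v z.2) (x, y) = _
  rw [e, integral_indicator measurableSet_ball, Measure.restrict_restrict measurableSet_ball,
    inter_eq_left.mpr (hx x hxK)]

lemma exists_radius {s : ℝ} (hs0 : 0 < s) {M η : ℝ≥0∞} (hM : M < ⊤) (hη : 0 < η) {δ₀ : ℝ}
    (hδ₀ : 0 < δ₀) : ∃ δ : ℝ, 0 < δ ∧ δ < δ₀ ∧
      (volume (Metric.ball (0 : Space d) δ))⁻¹ * ENNReal.ofReal (δ ^ ((d : ℝ) / 2 + s)) ^ 2 * M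
        ≤ η := by
  have ht : Tendsto (fun δ : ℝ => (volume (Metric.ball (0 : Space d) 1))⁻¹ *
      ENNReal.ofReal (δ ^ (2 * s)) * M) (𝓝[>] 0) (𝓝 0) := by
    have h1 : Tendsto (fun δ : ℝ => ENNReal.ofReal (δ ^ (2 * s))) (𝓝[>] 0) (𝓝 0) := by
      have : Tendsto (fun δ : ℝ => δ ^ (2 * s)) (𝓝[>] 0) (𝓝 0) := by
        have h := (Real.continuousAt_rpow_const 0 (2 * s) (Or.inr (by positivity))).tendsto
        rw [Real.zero_rpow (by positivity)] at h
        exact h.mono_left nhdsWithin_le_nhds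
      simpa [Function.comp_def] using (ENNReal.continuous_ofReal.tendsto _).comp this
    have h2 := ENNReal.Tendsto.const_mul (a := (volume (Metric.ball (0 : Space d) 1))⁻¹) h1
      (Or.inr (ENNReal.inv_ne_top.mpr (Metric.measure_ball_pos _ _ one_pos).ne'))
    have h3 := ENNReal.Tendsto.mul_const (b := M) h2 (Or.inr hM.ne)
    simpa using h3
  have he := (ht.eventually (ge_mem_nhds hη)).and
    ((eventually_mem_nhdsWithin (a := (0 : ℝ)) (s := Ioi 0)).and
      ((eventually_lt_nhds hδ₀).filter_mono nhdsWithin_le_nhds))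
  obtain ⟨δ, h1, h2, h3⟩ := he.exists
  have h2 : 0 < δ := h2
  refine ⟨δ, h2, h3, le_trans (le_of_eq ?_) h1⟩
  congr 1
  rw [Measure.addHaar_ball_of_pos _ _ h2, finrank_euclideanSpace_fin,
    ENNReal.mul_inv (Or.inr (measure_ball_lt_top (μ := volume)).ne) (by simp), mul_comm (_⁻¹), mul_assoc]
  congr 1
  rw [← ENNReal.ofReal_pow (by positivity), ← ENNReal.ofReal_inv_of_pos (by positivity),
    ← ENNReal.ofReal_mul (by positivity)]
  congr 1
  rw [← Real.rpow_natCast _ 2, ← Real.rpow_mul h2.le, ← Real.rpow_natCast, ← Real.rpow_neg h2.le,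
    ← Real.rpow_add h2]
  congr 1; push_cast; ring

/-- A bounded sequence in `H^s(A)` all of whose averages over small balls tend to zero tends to
zero in `L²` on subsets with positive distance to the boundary of `A`. -/
lemma tendsto_lintegral_sq_of_memHs {s : ℝ} (hs0 : 0 < s) {A K : Set (Space d)}
    (hK : MeasurableSet K) (hKf : volume K < ⊤) {δ₀ : ℝ} (hδ₀ : 0 < δ₀)
    (hKA : ∀ x ∈ K, Metric.ball x δ₀ ⊆ A) {v : ℕ → Space d → ℝ} {M : ℝ≥0∞} (hM : M < ⊤)
    (hv : ∀ n, MemLp (v n) 2 (volume.restrict A))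
    (hv1 : ∀ n, eLpNorm (v n) 2 (volume.restrict A) ≤ M)
    (hv2 : ∀ n, eLpNorm (diffQuot s (v n)) 2 (sqMeasure A) ≤ M)
    (hw : ∀ x ∈ K, ∀ δ, 0 < δ → δ < δ₀ →
      Tendsto (fun n => ∫ y in Metric.ball x δ, v n y) atTop (𝓝 0)) :
    Tendsto (fun n => ∫⁻ x in K, ‖v n x‖ₑ ^ 2) atTop (𝓝 0) := by
  rw [ENNReal.tendsto_nhds_zero]
  intro η hη
  have hη4 : 0 < η / 4 := ENNReal.div_pos hη.ne' (by norm_num)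
  obtain ⟨δ, hδ0, hδ1, hδ⟩ := exists_radius (d := d) hs0 (ENNReal.pow_lt_top hM (n := 2)) hη4 hδ₀
  have hball (x) (hx : x ∈ K) : Metric.ball x δ ⊆ A :=
    (Metric.ball_subset_ball hδ1.le).trans (hKA x hx)
  set c := (volume (Metric.ball (0 : Space d) δ))⁻¹ * ENNReal.ofReal (δ ^ ((d : ℝ) / 2 + s)) ^ 2
  have hKA' : K ⊆ A := fun x hx => hball x hx (Metric.mem_ball_self hδ0)
  have hvol : (volume (Metric.ball (0 : Space d) δ))⁻¹ < ⊤ :=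
    ENNReal.inv_lt_top.mpr (Metric.measure_ball_pos _ _ hδ0)
  have hlim : Tendsto (fun n => ∫⁻ x in K, ‖∫ y, v n y ∂ballMeasure x δ‖ₑ ^ 2) atTop (𝓝 0) := by
    have h0 : (0 : ℝ≥0∞) = ∫⁻ x in K, 0 := by simp
    rw [h0]
    refine tendsto_lintegral_of_dominated_convergence'
      (fun _ => (volume (Metric.ball (0 : Space d) δ))⁻¹ * M ^ 2) (fun n => ?_) (fun n => ?_) ?_ ?_
    · exact ((aestronglyMeasurable_integral_ballMeasure hK hball (hv n)).enorm).pow_const 2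
    · filter_upwards [ae_restrict_mem hK] with x hx
      refine (enorm_integral_ballMeasure_sq_le hδ0 (hball x hx) (hv n)).trans ?_
      gcongr
      exact hv1 n
    · rw [lintegral_const, Measure.restrict_apply_univ]
      exact (ENNReal.mul_lt_top (ENNReal.mul_lt_top hvol (ENNReal.pow_lt_top hM)) hKf).ne
    · filter_upwards [ae_restrict_mem hK] with x hx
      have h1 : Tendsto (fun n => ∫ y, v n y ∂ballMeasure x δ) atTop (𝓝 0) := by
        simp only [ballMeasure, integral_smul_measure]
        simpa using (hw x hx δ hδ0 hδ1).const_smul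
          (volume (Metric.ball (0 : Space d) δ))⁻¹.toReal
      have h2 := ((ENNReal.continuous_pow 2).comp continuous_enorm).tendsto (0 : ℝ)
      simpa [Function.comp_def] using h2.comp h1
  filter_upwards [(ENNReal.tendsto_nhds_zero.mp hlim) _ hη4] with n hn
  have hmeas : AEMeasurable (fun x => c * ∫⁻ y in A, ‖diffQuot s (v n) (x, y)‖ₑ ^ 2)
      (volume.restrict K) := by
    refine AEMeasurable.const_mul ?_ c
    have h1 : AEMeasurable (fun z => ‖diffQuot s (v n) z‖ₑ ^ 2)
        ((volume.restrict K).prod (volume.restrict A)) := by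
      have := (aestronglyMeasurable_diffQuot s (hv n).1).mono_measure
        (Measure.prod_mono (Measure.restrict_mono hKA' le_rfl) le_rfl)
      exact this.enorm.pow_const 2
    exact h1.lintegral_prod_right'
  calc ∫⁻ x in K, ‖v n x‖ₑ ^ 2
      ≤ ∫⁻ x in K, 2 * (c * (∫⁻ y in A, ‖diffQuot s (v n) (x, y)‖ₑ ^ 2)
          + ‖∫ y, v n y ∂ballMeasure x δ‖ₑ ^ 2) := by
        refine setLIntegral_mono' hK fun x hx => ?_
        refine (enorm_sq_le_two_mul _ (∫ y, v n y ∂ballMeasure x δ)).trans ?_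
        gcongr
        exact enorm_sub_integral_ballMeasure_sq_le hs0 hδ0 (hball x hx) (hv n)
    _ = 2 * (c * (∫⁻ x in K, ∫⁻ y in A, ‖diffQuot s (v n) (x, y)‖ₑ ^ 2)
          + ∫⁻ x in K, ‖∫ y, v n y ∂ballMeasure x δ‖ₑ ^ 2) := by
        rw [lintegral_const_mul' _ _ (by norm_num), lintegral_add_left' hmeas,
          lintegral_const_mul' _ _ (ENNReal.mul_lt_top hvol (by finiteness)).ne]
    _ ≤ 2 * (c * M ^ 2 + η / 4) := by
        gcongr
        calc ∫⁻ x in K, ∫⁻ y in A, ‖diffQuot s (v n) (x, y)‖ₑ ^ 2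
            ≤ ∫⁻ x in A, ∫⁻ y in A, ‖diffQuot s (v n) (x, y)‖ₑ ^ 2 := lintegral_mono_set hKA'
          _ = eLpNorm (diffQuot s (v n)) 2 (sqMeasure A) ^ 2 := by
              rw [eLpNorm_two_sq, sqMeasure, lintegral_prod]
              exact ((aestronglyMeasurable_diffQuot s (hv n).1).enorm).pow_const 2
          _ ≤ M ^ 2 := by gcongr; exact hv2 n
    _ ≤ 2 * (η / 4 + η / 4) := by gcongr
    _ = η := by
        rw [← mul_two, mul_comm, mul_assoc]
        norm_num
        exact ENNReal.div_mul_cancel (by norm_num) (by norm_num)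

lemma weakTendsto_setIntegral {A B : Set (Space d)} (hB : MeasurableSet B) (hBA : B ⊆ A)
    (hBf : volume B < ⊤) {z : ℕ → L2 A} {z' : L2 A} (h : WeakTendsto z z') :
    Tendsto (fun n => ∫ y in B, (z n y - z' y)) atTop (𝓝 0) := by
  have hBf' : (volume.restrict A) B ≠ ⊤ := ((Measure.restrict_apply_le _ _).trans_lt hBf).ne
  have hi (u : L2 A) : inner ℝ u (indicatorConstLp 2 hB hBf' (1 : ℝ)) = ∫ y in B, u y := by
    rw [real_inner_comm, L2.inner_indicatorConstLp_one, Measure.restrict_restrict hB,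
      inter_eq_left.mpr hBA]
  have hint (u : L2 A) : IntegrableOn u B := by
    have : IsFiniteMeasure (volume.restrict B) := isFiniteMeasure_restrict.mpr hBf.ne
    exact ((Lp.memLp u).mono_measure (Measure.restrict_mono hBA le_rfl)).integrable (by norm_num)
  have h1 := h (indicatorConstLp 2 hB hBf' (1 : ℝ))
  simp only [hi] at h1
  have h2 := h1.sub_const (∫ y in B, z' y)
  rw [sub_self] at h2
  refine h2.congr fun n => ?_
  rw [integral_sub (hint _) (hint _)]

lemma diffQuot_sub (s : ℝ) (u w : Space d → ℝ) :
    diffQuot s (u - w) = diffQuot s u - diffQuot s w := by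
  funext z; simp only [diffQuot, Pi.sub_apply]; ring

/-- Weakly convergent sequences that are bounded in `H^s(Ω)` have subsequences that converge almost
everywhere. -/
lemma exists_subseq_ae_tendsto {s : ℝ} (hs0 : 0 < s) {Ω : Set (Space d)} (hΩo : IsOpen Ω)
    (hΩb : Bornology.IsBounded Ω) {z : ℕ → L2 Ω} {z' : L2 Ω} (h : WeakTendsto z z') {M : ℝ≥0∞}
    (hM : M < ⊤) (h1 : ∀ n, eLpNorm (z n) 2 (volume.restrict Ω) ≤ M)
    (h2 : ∀ n, eLpNorm (diffQuot s (z n)) 2 (sqMeasure Ω) ≤ M)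
    (h3 : eLpNorm (diffQuot s z') 2 (sqMeasure Ω) < ⊤) :
    ∃ φ : ℕ → ℕ, StrictMono φ ∧
      ∀ᵐ a ∂volume.restrict Ω, Tendsto (fun n => z (φ n) a) atTop (𝓝 (z' a)) := by
  have hm (u : L2 Ω) : AEStronglyMeasurable u (volume.restrict Ω) := Lp.aestronglyMeasurable u
  have hdq (n : ℕ) : eLpNorm (diffQuot s (⇑(z n) - ⇑z')) 2 (sqMeasure Ω)
      ≤ M + eLpNorm (diffQuot s z') 2 (sqMeasure Ω) := by
    rw [diffQuot_sub]
    refine (eLpNorm_sub_le (aestronglyMeasurable_diffQuot s (hm _))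
      (aestronglyMeasurable_diffQuot s (hm _)) (by norm_num)).trans ?_
    gcongr
    exact h2 n
  have hL (n : ℕ) : eLpNorm (⇑(z n) - ⇑z') 2 (volume.restrict Ω)
      ≤ M + eLpNorm z' 2 (volume.restrict Ω) := by
    refine (eLpNorm_sub_le (hm _) (hm _) (by norm_num)).trans ?_
    gcongr
    exact h1 n
  have hTM : TendstoInMeasure (volume.restrict Ω) (fun n => ⇑(z n)) atTop z' := by
    intro ε hε
    rw [ENNReal.tendsto_nhds_zero]
    intro η hη
    obtain ⟨K, hKΩ, hK, hKη⟩ := hΩo.measurableSet.exists_isCompact_sdiff_lt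
      hΩb.measure_lt_top.ne (μ := volume) (ENNReal.half_pos hη.ne').ne'
    obtain ⟨δ₀, hδ₀, hthick⟩ := hK.exists_thickening_subset_open hΩo hKΩ
    have hball (x) (hx : x ∈ K) : Metric.ball x δ₀ ⊆ Ω :=
      (Metric.ball_subset_thickening hx δ₀).trans hthick
    have hz (u : L2 Ω) : MemLp u 2 (volume.restrict Ω) := Lp.memLp u
    set M' := max (M + eLpNorm (diffQuot s z') 2 (sqMeasure Ω))
      (M + eLpNorm z' 2 (volume.restrict Ω))
    have hM' : M' < ⊤ := max_lt (ENNReal.add_lt_top.mpr ⟨hM, h3⟩)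
      (ENNReal.add_lt_top.mpr ⟨hM, (hz z').2⟩)
    have hloc := tendsto_lintegral_sq_of_memHs hs0 hK.measurableSet hK.measure_lt_top hδ₀ hball hM'
      (v := fun n => ⇑(z n) - ⇑z') (fun n => (hz _).sub (hz _))
      (fun n => (hL n).trans (le_max_right _ _)) (fun n => (hdq n).trans (le_max_left _ _))
      (fun x hx δ hδ hδ' => weakTendsto_setIntegral measurableSet_ball
        ((Metric.ball_subset_ball hδ'.le).trans (hball x hx)) measure_ball_lt_top h)
    have hlocL : Tendsto (fun n => eLpNorm (⇑(z n) - ⇑z') 2 (volume.restrict K)) atTop (𝓝 0) := by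
      have e (n : ℕ) : eLpNorm (⇑(z n) - ⇑z') 2 (volume.restrict K)
          = (∫⁻ x in K, ‖(⇑(z n) - ⇑z') x‖ₑ ^ 2) ^ (1 / 2 : ℝ) := by
        rw [← eLpNorm_two_sq, ← ENNReal.rpow_natCast, ← ENNReal.rpow_mul]
        norm_num
      simp only [e]
      have h5 := (ENNReal.continuous_rpow_const (y := (1 / 2 : ℝ))).tendsto (0 : ℝ≥0∞)
      rw [ENNReal.zero_rpow_of_pos (by norm_num)] at h5
      exact h5.comp hloc
    have hmK (u : L2 Ω) : AEStronglyMeasurable u (volume.restrict K) :=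
      (hm u).mono_measure (Measure.restrict_mono hKΩ le_rfl)
    have hK' := tendstoInMeasure_of_tendsto_eLpNorm two_ne_zero (fun n => hmK (z n)) (hmK z')
      hlocL ε hε
    filter_upwards [(ENNReal.tendsto_nhds_zero.mp hK') _ (ENNReal.half_pos hη.ne')] with n hn
    calc volume.restrict Ω {x | ε ≤ edist (z n x) (z' x)}
        ≤ volume.restrict (K ∪ Ω \ K) {x | ε ≤ edist (z n x) (z' x)} :=
          Measure.restrict_mono (by rw [union_sdiff_self]; exact subset_union_right) le_rfl _
      _ ≤ volume.restrict K {x | ε ≤ edist (z n x) (z' x)}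
          + volume.restrict (Ω \ K) {x | ε ≤ edist (z n x) (z' x)} :=
          Measure.restrict_union_le _ _ _
      _ ≤ η / 2 + η / 2 := by
          gcongr
          refine (measure_mono (subset_univ _)).trans ?_
          rw [Measure.restrict_apply_univ]
          exact hKη.le
      _ = η := ENNReal.add_halves η
  exact hTM.exists_seq_tendsto_ae

end SparseControl
end

noncomputable section

namespace SparseControl

variable {d : ℕ}

/-! ### The model of `H^s(A)` -/

section Hs

variable {A : Set (Space d)} {s : ℝ}

lemma sobolevConst_pos (hd : 0 < d) (hs0 : 0 < s) (hs1 : s < 1) : 0 < sobolevConst d s := by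
  have h1 : 0 < Real.Gamma (s + d / 2) := Real.Gamma_pos_of_pos (by positivity)
  have h2 : 0 < Real.Gamma (1 - s) := Real.Gamma_pos_of_pos (by linarith)
  unfold sobolevConst
  positivity

lemma memHs_coe (z : spaceHs A s) : MemHs A s z := z.2

variable (A s) in
/-- The difference quotient as an operator from `H^s(A)` to `L²(A × A)`. -/
def diffQuotLp : spaceHs A s →ₗ[ℝ] Lp ℝ 2 (sqMeasure A) where
  toFun z := MemLp.toLp (diffQuot s z) (memHs_coe z).2
  map_add' z z' := by
    rw [← MemLp.toLp_add (memHs_coe z).2 (memHs_coe z').2, MemLp.toLp_eq_toLp_iff, ← diffQuot_add]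
    exact diffQuot_congr s (Lp.coeFn_add _ _)
  map_smul' c z := by
    refine Eq.trans ?_ (MemLp.toLp_const_smul c (memHs_coe z).2)
    rw [MemLp.toLp_eq_toLp_iff, ← diffQuot_smul]
    exact diffQuot_congr s (Lp.coeFn_smul _ _)

lemma diffQuotLp_ae (z : spaceHs A s) : diffQuotLp A s z =ᵐ[sqMeasure A] diffQuot s z :=
  (memHs_coe z).2.coeFn_toLp

/-- The product of `L²(A)` and `L²(A × A)`. -/
abbrev HsModel (A : Set (Space d)) : Type := WithLp 2 (L2 A × Lp ℝ 2 (sqMeasure A))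

variable (A s) in
/-- The map `w ↦ (w, √(c_{d,s}/2) (w(x) - w(y)) / |x - y|^(d/2+s))`, isometric for the norm
of `H^s(A)`. -/
def jHs : spaceHs A s →ₗ[ℝ] HsModel A :=
  (WithLp.linearEquiv 2 ℝ (L2 A × Lp ℝ 2 (sqMeasure A))).symm.toLinearMap ∘ₗ
    ((spaceHs A s).subtype.prod (√(sobolevConst d s / 2) • diffQuotLp A s))

lemma jHs_fst (z : spaceHs A s) : (jHs A s z).fst = z := rfl

lemma jHs_snd (z : spaceHs A s) :
    (jHs A s z).snd = √(sobolevConst d s / 2) • diffQuotLp A s z := rfl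

lemma norm_jHs_sq (hc : 0 ≤ sobolevConst d s) (z : spaceHs A s) :
    ‖jHs A s z‖ ^ 2 = ‖(z : L2 A)‖ ^ 2 + sobolevConst d s / 2 * ‖diffQuotLp A s z‖ ^ 2 := by
  rw [WithLp.prod_norm_sq_eq_of_L2, jHs_fst, jHs_snd, norm_smul, mul_pow,
    Real.norm_of_nonneg (Real.sqrt_nonneg _), Real.sq_sqrt (by positivity)]

lemma hsInner_self (z : spaceHs A s) :
    hsInner A s z z = ‖(z : L2 A)‖ ^ 2 + sobolevConst d s / 2 * ‖diffQuotLp A s z‖ ^ 2 := by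
  rw [hsInner, norm_sq_eq_integral, norm_sq_eq_integral]
  congr 2
  · simp only [sq]
  · refine integral_congr_ae ?_
    filter_upwards [diffQuotLp_ae z] with x hx
    rw [hx, diffQuot, div_pow, sq, ← Real.rpow_mul_natCast (norm_nonneg _)]
    congr 2
    push_cast; ring

lemma sqrt_hsInner_self (hc : 0 ≤ sobolevConst d s) (z : spaceHs A s) :
    √(hsInner A s z z) = ‖jHs A s z‖ := by
  rw [hsInner_self, ← norm_jHs_sq hc, Real.sqrt_sq (norm_nonneg _)]

lemma norm_le_norm_jHs (hc : 0 ≤ sobolevConst d s) (z : spaceHs A s) :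
    ‖(z : L2 A)‖ ≤ ‖jHs A s z‖ := by
  refine le_of_sq_le_sq ?_ (norm_nonneg _)
  rw [norm_jHs_sq hc]
  exact le_add_of_nonneg_right (by positivity)
where
  le_of_sq_le_sq {a b : ℝ} (h : a ^ 2 ≤ b ^ 2) (hb : 0 ≤ b) : a ≤ b := abs_le_of_sq_le_sq' h hb |>.2

lemma eLpNorm_diffQuot_le (hc : 0 < sobolevConst d s) (z : spaceHs A s) :
    eLpNorm (diffQuot s z) 2 (sqMeasure A)
      ≤ ENNReal.ofReal ((√(sobolevConst d s / 2))⁻¹ * ‖jHs A s z‖) := by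
  rw [← eLpNorm_congr_ae (diffQuotLp_ae z), ← Lp.enorm_def, ← ofReal_norm]
  refine ENNReal.ofReal_le_ofReal ?_
  have h0 : 0 < √(sobolevConst d s / 2) := by positivity
  rw [← div_eq_inv_mul, le_div_iff₀ h0]
  have := WithLp.norm_snd_le _ (jHs A s z)
  rwa [jHs_snd, norm_smul, Real.norm_of_nonneg h0.le, mul_comm] at this

lemma tendsto_jHs_iff {z : ℕ → spaceHs A s} {w : spaceHs A s} (hc : 0 < sobolevConst d s) :
    Tendsto (fun n => jHs A s (z n)) atTop (𝓝 (jHs A s w)) ↔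
      Tendsto (fun n => eLpNorm (⇑(z n : L2 A) - ⇑(w : L2 A)) 2 (volume.restrict A)) atTop (𝓝 0) ∧
      Tendsto (fun n => eLpNorm (diffQuot s (⇑(z n : L2 A) - ⇑(w : L2 A))) 2 (sqMeasure A))
        atTop (𝓝 0) := by
  have h0 : √(sobolevConst d s / 2) ≠ 0 := by positivity
  have e (n : ℕ) : eLpNorm (diffQuot s (⇑(z n : L2 A) - ⇑(w : L2 A))) 2 (sqMeasure A)
      = eLpNorm (⇑(diffQuotLp A s (z n)) - ⇑(diffQuotLp A s w)) 2 (sqMeasure A) := by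
    rw [diffQuot_sub]
    exact eLpNorm_congr_ae ((diffQuotLp_ae _).symm.sub (diffQuotLp_ae _).symm)
  simp only [e]
  rw [← Lp.tendsto_Lp_iff_tendsto_eLpNorm', ← Lp.tendsto_Lp_iff_tendsto_eLpNorm',
    ← tendsto_const_smul_iff₀ h0 (f := fun n => diffQuotLp A s (z n))]
  constructor
  · intro h
    exact ⟨((by fun_prop : Continuous fun p : HsModel A => p.fst).tendsto _).comp h,
      ((by fun_prop : Continuous fun p : HsModel A => p.snd).tendsto _).comp h⟩
  · rintro ⟨h1, h2⟩
    exact ((WithLp.prod_continuous_toLp 2 _ _).tendsto _).comp (h1.prodMk_nhds h2)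

lemma jHs_closed (hc : 0 < sobolevConst d s) (x : ℕ → spaceHs A s) (w : L2 A) (y : HsModel A)
    (hw : Tendsto (fun n => (x n : L2 A)) atTop (𝓝 w))
    (hy : Tendsto (fun n => jHs A s (x n)) atTop (𝓝 y)) :
    ∃ z : spaceHs A s, (z : L2 A) = w ∧ jHs A s z = y := by
  set k := √(sobolevConst d s / 2)
  have h0 : k ≠ 0 := by positivity
  have hfst : y.fst = w := by
    refine tendsto_nhds_unique (((by fun_prop : Continuous fun p : HsModel A => p.fst).tendsto
      _).comp hy) hw
  have hsnd : Tendsto (fun n => diffQuotLp A s (x n)) atTop (𝓝 (k⁻¹ • y.snd)) := by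
    have := (((by fun_prop : Continuous fun p : HsModel A => p.snd).tendsto _).comp hy).const_smul
      k⁻¹
    refine this.congr fun n => ?_
    simp only [Function.comp, jHs_snd]
    rw [smul_smul, inv_mul_cancel₀ h0, one_smul]
  obtain ⟨φ, hφ, h1⟩ := (tendstoInMeasure_of_tendsto_Lp hw).exists_seq_tendsto_ae
  obtain ⟨χ, hχ, h2⟩ := (tendstoInMeasure_of_tendsto_Lp
    (hsnd.comp hφ.tendsto_atTop)).exists_seq_tendsto_ae
  have ha : ∀ᵐ z ∂sqMeasure A, Tendsto (fun n => (x (φ (χ n)) : L2 A) z.1) atTop (𝓝 (w z.1)) := by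
    have := Measure.quasiMeasurePreserving_fst (μ := volume.restrict A) (ν := volume.restrict A)
      |>.ae h1
    filter_upwards [this] with z hz using hz.comp hχ.tendsto_atTop
  have hb : ∀ᵐ z ∂sqMeasure A, Tendsto (fun n => (x (φ (χ n)) : L2 A) z.2) atTop (𝓝 (w z.2)) := by
    have := Measure.quasiMeasurePreserving_snd (μ := volume.restrict A) (ν := volume.restrict A)
      |>.ae h1
    filter_upwards [this] with z hz using hz.comp hχ.tendsto_atTop
  have hdq : ∀ᵐ z ∂sqMeasure A, ∀ n, diffQuotLp A s (x (φ (χ n))) z = diffQuot s (x (φ (χ n))) z :=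
    ae_all_iff.mpr fun n => diffQuotLp_ae _
  have key : diffQuot s w =ᵐ[sqMeasure A] (k⁻¹ • y.snd : Lp ℝ 2 (sqMeasure A)) := by
    filter_upwards [ha, hb, hdq, h2] with z h3 h4 h5 h6
    refine tendsto_nhds_unique ?_ h6
    simp only [Function.comp, h5, diffQuot]
    exact (h3.sub h4).div_const _
  have hmem : MemHs A s w := ⟨Lp.memLp w, (Lp.memLp _).ae_eq key.symm⟩
  refine ⟨⟨w, hmem⟩, rfl, ?_⟩
  have e2 : diffQuotLp A s ⟨w, hmem⟩ = k⁻¹ • y.snd :=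
    Lp.ext ((diffQuotLp_ae _).trans key)
  have e3 : (jHs A s ⟨w, hmem⟩).snd = y.snd := by
    rw [jHs_snd, e2, smul_smul, mul_inv_cancel₀ h0, one_smul]
  have e4 : (jHs A s ⟨w, hmem⟩).fst = y.fst := hfst.symm
  exact WithLp.ofLp_injective 2 (Prod.ext e4 e3)

lemma abs_sub_le_of_deriv {T : ℝ → ℝ} (hT : ContDiff ℝ ∞ T) (hT1 : ∀ r, |deriv T r| ≤ 1)
    (a b : ℝ) : |T a - T b| ≤ |a - b| := by
  have := convex_univ.norm_image_sub_le_of_norm_deriv_le (f := T) (C := 1) (x := b) (y := a)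
    (fun _ _ => hT.differentiable (by simp) _) (fun _ _ => hT1 _) trivial trivial
  simpa using this

lemma abs_le_of_deriv {T : ℝ → ℝ} (hT : ContDiff ℝ ∞ T) (hT0 : T 0 = 0)
    (hT1 : ∀ r, |deriv T r| ≤ 1) (a : ℝ) : |T a| ≤ |a| := by
  simpa [hT0] using abs_sub_le_of_deriv hT hT1 a 0

lemma memLp_comp_contraction {X : Type*} [MeasurableSpace X] {μ : Measure X} {T : ℝ → ℝ}
    (hT : ContDiff ℝ ∞ T) (hT0 : T 0 = 0) (hT1 : ∀ r, |deriv T r| ≤ 1) {w : X → ℝ}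
    (hw : MemLp w 2 μ) : MemLp (fun x => T (w x)) 2 μ :=
  hw.mono (hT.continuous.comp_aestronglyMeasurable hw.1)
    (Eventually.of_forall fun _ => abs_le_of_deriv hT hT0 hT1 _)

lemma abs_diffQuot_comp_le {T : ℝ → ℝ} (hT : ContDiff ℝ ∞ T) (hT1 : ∀ r, |deriv T r| ≤ 1)
    (w : Space d → ℝ) (z : Space d × Space d) :
    ‖diffQuot s (fun a => T (w a)) z‖ ≤ ‖diffQuot s w z‖ := by
  rw [diffQuot, diffQuot, norm_div, norm_div]
  gcongr
  exact abs_sub_le_of_deriv hT hT1 _ _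

lemma MemHs.comp_contraction {T : ℝ → ℝ}
    (hT : ContDiff ℝ ∞ T) (hT0 : T 0 = 0) (hT1 : ∀ r, |deriv T r| ≤ 1) {w : Space d → ℝ}
    (hw : MemHs A s w) : MemHs A s (fun x => T (w x)) := by
  have h := memLp_comp_contraction hT hT0 hT1 hw.1
  exact ⟨h, hw.2.mono (aestronglyMeasurable_diffQuot s h.1)
    (Eventually.of_forall fun z => abs_diffQuot_comp_le hT hT1 w z)⟩

lemma jHs_contract (hc : 0 < sobolevConst d s) {T : ℝ → ℝ}
    (hT : ContDiff ℝ ∞ T) (hT0 : T 0 = 0) (hT1 : ∀ r, |deriv T r| ≤ 1) (z : spaceHs A s) :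
    ∃ z' : spaceHs A s, (z' : L2 A) =ᵐ[volume.restrict A] (fun a => T ((z : L2 A) a)) ∧
      ‖jHs A s z'‖ ≤ ‖jHs A s z‖ := by
  have hm : MemHs A s fun a => T ((z : L2 A) a) := MemHs.comp_contraction hT hT0 hT1 (memHs_coe z)
  have hae := hm.1.coeFn_toLp
  refine ⟨⟨hm.1.toLp _, hm.congr hae.symm⟩, hae, ?_⟩
  refine abs_le_of_sq_le_sq' ?_ (norm_nonneg _) |>.2
  rw [norm_jHs_sq hc.le, norm_jHs_sq hc.le]
  gcongr
  · refine Lp.norm_le_norm_of_ae_le ?_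
    filter_upwards [hae] with a ha
    rw [ha]
    exact abs_le_of_deriv hT hT0 hT1 _
  · refine Lp.norm_le_norm_of_ae_le ?_
    filter_upwards [diffQuotLp_ae z, diffQuotLp_ae ⟨hm.1.toLp _, hm.congr hae.symm⟩,
      diffQuot_congr s hae] with a h1 h2 h3
    rw [h1, h2]
    change ‖diffQuot s (hm.1.toLp _) a‖ ≤ _
    rw [h3]
    exact abs_diffQuot_comp_le hT hT1 _ a

lemma exists_subseq_of_bounded_jHs (hc : 0 < sobolevConst d s) (hs0 : 0 < s) (hAo : IsOpen A)
    (hAb : Bornology.IsBounded A) (x : ℕ → spaceHs A s) (z : spaceHs A s) {M : ℝ}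
    (hM : ∀ n, ‖jHs A s (x n)‖ ≤ M) (h : WeakTendsto (fun n => (x n : L2 A)) z) :
    ∃ φ : ℕ → ℕ, StrictMono φ ∧
      ∀ᵐ a ∂volume.restrict A, Tendsto (fun n => (x (φ n) : L2 A) a) atTop (𝓝 ((z : L2 A) a)) := by
  refine exists_subseq_ae_tendsto hs0 hAo hAb (z := fun n => (x n : L2 A)) (z' := (z : L2 A)) h
    (M := max (ENNReal.ofReal M) (ENNReal.ofReal ((√(sobolevConst d s / 2))⁻¹ * M)))
    (max_lt ENNReal.ofReal_lt_top ENNReal.ofReal_lt_top)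
    (fun n => le_max_of_le_left ?_) (fun n => le_max_of_le_right ?_) (memHs_coe z).2.2
  · rw [← Lp.enorm_def, ← ofReal_norm]
    exact ENNReal.ofReal_le_ofReal ((norm_le_norm_jHs hc.le _).trans (hM n))
  · refine (eLpNorm_diffQuot_le hc _).trans (ENNReal.ofReal_le_ofReal ?_)
    gcongr
    exact hM n

lemma exists_mem_spaceHs_of_test (hd : 0 < d) (hs0 : 0 < s) (hs1 : s < 1) {v : Space d → ℝ}
    (hv : IsTestFunction A v) :
    ∃ z : spaceHs A s, (z : L2 A) =ᵐ[volume.restrict A] v := by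
  have h : MemHs A s v := (hv.memHs hd hs0 hs1).mono (subset_univ A)
  exact ⟨⟨h.1.toLp v, h.congr h.1.coeFn_toLp.symm⟩, h.1.coeFn_toLp⟩

lemma energyModel_spaceHs (hd : 0 < d) (hs0 : 0 < s) (hs1 : s < 1) (hAo : IsOpen A)
    (hAb : Bornology.IsBounded A) : EnergyModel (spaceHs A s) (jHs A s) :=
  have hc := sobolevConst_pos hd hs0 hs1
  { closed := jHs_closed hc
    bound := ⟨1, fun z => by rw [one_mul]; exact norm_le_norm_jHs hc.le z⟩
    compact := fun x z M hM h => exists_subseq_of_bounded_jHs hc hs0 hAo hAb x z hM h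
    contract := fun T hT hT0 hT1 z => jHs_contract hc hT hT0 hT1 z
    test := fun v hv => exists_mem_spaceHs_of_test hd hs0 hs1 hv }

end Hs

end SparseControl
end

noncomputable section

namespace SparseControl

variable {d : ℕ}

/-! ### The model of `H^s_0(Ω)` -/

section HsZero

variable {Ω : Set (Space d)} {s : ℝ}

lemma IsTestFunction.comp_contraction {T : ℝ → ℝ} (hT : ContDiff ℝ ∞ T) (hT0 : T 0 = 0)
    {v : Space d → ℝ} (hv : IsTestFunction Ω v) : IsTestFunction Ω (fun x => T (v x)) :=
  ⟨hT.comp hv.1, hv.2.1.comp_left hT0, (tsupport_comp_subset hT0 v).trans hv.2.2⟩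

variable (Ω s) in
/-- The test functions, as a subspace of `H^s(Ω)`. -/
def testHs : Submodule ℝ (spaceHs Ω s) where
  carrier := {z | ∃ v, IsTestFunction Ω v ∧ (z : L2 Ω) =ᵐ[volume.restrict Ω] v}
  add_mem' := by
    rintro _ _ ⟨u, hu, hu'⟩ ⟨v, hv, hv'⟩
    exact ⟨u + v, hu.add hv, (Lp.coeFn_add _ _).trans (hu'.add hv')⟩
  zero_mem' := ⟨0, IsTestFunction.zero Ω, Lp.coeFn_zero _ _ _⟩
  smul_mem' := by
    rintro c _ ⟨u, hu, hu'⟩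
    exact ⟨c • u, hu.smul c, (Lp.coeFn_smul _ _).trans (hu'.const_smul c)⟩

variable (Ω s) in
/-- The image of `H^s_0(Ω)` in the model of `H^s(Ω)`. -/
def closureTestHs : Submodule ℝ (HsModel Ω) := ((testHs Ω s).map (jHs Ω s)).topologicalClosure

lemma jHs_mem_closureTestHs_iff (hc : 0 < sobolevConst d s) (z : spaceHs Ω s) :
    jHs Ω s z ∈ closureTestHs Ω s ↔ (z : L2 Ω) ∈ spaceHs0 Ω s := by
  rw [closureTestHs, ← SetLike.mem_coe, Submodule.topologicalClosure_coe, mem_closure_iff_seq_limit]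
  constructor
  · rintro ⟨y, hy, hlim⟩
    choose x hx hxy using hy
    choose v hv hxv using hx
    replace hlim : Tendsto (fun n => jHs Ω s (x n)) atTop (𝓝 (jHs Ω s z)) :=
      hlim.congr fun n => (hxy n).symm
    obtain ⟨h1, h2⟩ := (tendsto_jHs_iff hc).mp hlim
    have e (n : ℕ) : (⇑(x n : L2 Ω) - ⇑(z : L2 Ω)) =ᵐ[volume.restrict Ω] v n - ⇑(z : L2 Ω) :=
      (hxv n).sub EventuallyEq.rfl
    refine ⟨memHs_coe z, v, fun n => ⟨hv n, (memHs_coe (x n)).congr (hxv n)⟩, ?_, ?_⟩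
    · exact h1.congr fun n => eLpNorm_congr_ae (e n)
    · exact h2.congr fun n => eLpNorm_congr_ae (diffQuot_congr s (e n))
  · rintro ⟨-, v, hv, h1, h2⟩
    have hae (n : ℕ) := (hv n).2.1.coeFn_toLp
    let x (n : ℕ) : spaceHs Ω s := ⟨(hv n).2.1.toLp _, (hv n).2.congr (hae n).symm⟩
    refine ⟨fun n => jHs Ω s (x n), fun n => ⟨x n, ⟨v n, (hv n).1, hae n⟩, rfl⟩, ?_⟩
    have e (n : ℕ) : (⇑(x n : L2 Ω) - ⇑(z : L2 Ω)) =ᵐ[volume.restrict Ω] v n - ⇑(z : L2 Ω) :=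
      (hae n).sub EventuallyEq.rfl
    refine (tendsto_jHs_iff hc).mpr ⟨?_, ?_⟩
    · exact h1.congr fun n => (eLpNorm_congr_ae (e n)).symm
    · exact h2.congr fun n => (eLpNorm_congr_ae (diffQuot_congr s (e n))).symm

lemma spaceHs0_le : spaceHs0 Ω s ≤ spaceHs Ω s := fun _ h => h.1

variable (Ω s) in
/-- The restriction of `jHs` to `H^s_0(Ω)`. -/
def jHs0 : spaceHs0 Ω s →ₗ[ℝ] HsModel Ω := jHs Ω s ∘ₗ Submodule.inclusion spaceHs0_le

lemma jHs0_mem (hc : 0 < sobolevConst d s) (z : spaceHs0 Ω s) :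
    jHs0 Ω s z ∈ closureTestHs Ω s :=
  (jHs_mem_closureTestHs_iff hc (Submodule.inclusion spaceHs0_le z)).mpr z.2

lemma jHs0_contract (hc : 0 < sobolevConst d s) {T : ℝ → ℝ}
    (hT : ContDiff ℝ ∞ T) (hT0 : T 0 = 0) (hT1 : ∀ r, |deriv T r| ≤ 1) (z : spaceHs0 Ω s) :
    ∃ z' : spaceHs0 Ω s, (z' : L2 Ω) =ᵐ[volume.restrict Ω] (fun a => T ((z : L2 Ω) a)) ∧
      ‖jHs0 Ω s z'‖ ≤ ‖jHs0 Ω s z‖ := by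
  set y : spaceHs Ω s := Submodule.inclusion spaceHs0_le z
  obtain ⟨z', hz', hle⟩ := jHs_contract hc hT hT0 hT1 y
  suffices h : (z' : L2 Ω) ∈ spaceHs0 Ω s from ⟨⟨z', h⟩, hz', hle⟩
  have hmem := jHs0_mem hc z
  rw [closureTestHs, ← SetLike.mem_coe, Submodule.topologicalClosure_coe,
    mem_closure_iff_seq_limit] at hmem
  obtain ⟨q, hq, hlim⟩ := hmem
  choose x hx hxq using hq
  choose v hv hxv using hx
  replace hlim : Tendsto (fun n => jHs Ω s (x n)) atTop (𝓝 (jHs Ω s y)) :=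
    hlim.congr fun n => (hxq n).symm
  choose x' hx' hle' using fun n => jHs_contract hc hT hT0 hT1 (x n)
  obtain ⟨M, hM⟩ := hlim.norm.bddAbove_range
  have hM' (n : ℕ) : ‖jHs Ω s (x' n)‖ ≤ M := (hle' n).trans (hM (mem_range_self n))
  have hmem' (n : ℕ) : jHs Ω s (x' n) ∈ closureTestHs Ω s := by
    refine Submodule.le_topologicalClosure _ ⟨x' n, ⟨_, (hv n).comp_contraction hT hT0, ?_⟩, rfl⟩
    filter_upwards [hx' n, hxv n] with a h1 h2
    rw [h1, h2]
  have hL2 : Tendsto (fun n => (x' n : L2 Ω)) atTop (𝓝 (z' : L2 Ω)) := by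
    have h1 : Tendsto (fun n => (x n : L2 Ω)) atTop (𝓝 (y : L2 Ω)) :=
      ((by fun_prop : Continuous fun p : HsModel Ω => p.fst).tendsto _).comp hlim
    rw [tendsto_iff_norm_sub_tendsto_zero] at h1 ⊢
    refine squeeze_zero (fun n => norm_nonneg _) (fun n => ?_) h1
    refine Lp.norm_le_norm_of_ae_le ?_
    filter_upwards [hx' n, hz', Lp.coeFn_sub (x' n : L2 Ω) (z' : L2 Ω),
      Lp.coeFn_sub (x n : L2 Ω) (y : L2 Ω)] with a h1 h2 h3 h4
    rw [h3, h4, Pi.sub_apply, Pi.sub_apply, h1, h2]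
    exact abs_sub_le_of_deriv hT hT1 _ _
  obtain ⟨φ, hφ, u, hu1, hu2⟩ := exists_weakTendsto_of_closed (jHs_closed hc)
    (fun n => (norm_le_norm_jHs hc.le (x' n)).trans (hM' n)) hM'
  have hu : u = z' := Subtype.ext
    (hu1.unique (WeakTendsto.of_tendsto (hL2.comp hφ.tendsto_atTop)))
  rw [hu] at hu2
  exact (jHs_mem_closureTestHs_iff hc z').mp
    (hu2.mem_of_isClosed (Submodule.isClosed_topologicalClosure _) fun n => hmem' _)

lemma energyModel_spaceHs0 (hd : 0 < d) (hs0 : 0 < s) (hs1 : s < 1) (hΩo : IsOpen Ω)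
    (hΩb : Bornology.IsBounded Ω) : EnergyModel (spaceHs0 Ω s) (jHs0 Ω s) :=
  have hc := sobolevConst_pos hd hs0 hs1
  { closed := fun x w y hw hy => by
      obtain ⟨z, hz1, hz2⟩ := jHs_closed hc (fun n => Submodule.inclusion spaceHs0_le (x n)) w y
        hw hy
      have hmem : jHs Ω s z ∈ closureTestHs Ω s := by
        rw [hz2]
        exact (Submodule.isClosed_topologicalClosure _).mem_of_tendsto hy
          (Eventually.of_forall fun n => jHs0_mem hc (x n))
      exact ⟨⟨z, (jHs_mem_closureTestHs_iff hc z).mp hmem⟩, hz1, hz2⟩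
    bound := ⟨1, fun z => by
      rw [one_mul]; exact norm_le_norm_jHs hc.le (Submodule.inclusion spaceHs0_le z)⟩
    compact := fun x z M hM h => exists_subseq_of_bounded_jHs hc hs0 hΩo hΩb
      (fun n => Submodule.inclusion spaceHs0_le (x n)) (Submodule.inclusion spaceHs0_le z) hM h
    contract := fun T hT hT0 hT1 z => jHs0_contract hc hT hT0 hT1 z
    test := fun v hv => by
      obtain ⟨z, hz⟩ := exists_mem_spaceHs_of_test (s := s) hd hs0 hs1 hv
      refine ⟨⟨z, (jHs_mem_closureTestHs_iff hc z).mp ?_⟩, hz⟩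
      exact Submodule.le_topologicalClosure _ ⟨z, ⟨v, hv, hz⟩, rfl⟩ }

end HsZero

/-! ### The model of `H̃^s(Ω)` -/

section HsTilde

variable {Ω : Set (Space d)} {s : ℝ}

lemma ae_eq_indicator_iff (hΩ : MeasurableSet Ω) {w' w : Space d → ℝ} :
    w' =ᵐ[volume.restrict univ] Ω.indicator w ↔
      w' =ᵐ[volume.restrict Ω] w ∧ w' =ᵐ[volume.restrict Ωᶜ] 0 := by
  rw [Measure.restrict_univ]
  constructor
  · intro h
    refine ⟨?_, ?_⟩
    · filter_upwards [ae_restrict_of_ae h, ae_restrict_mem hΩ] with x hx hm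
      rw [hx, indicator_of_mem hm]
    · filter_upwards [ae_restrict_of_ae h, ae_restrict_mem hΩ.compl] with x hx hm
      rw [hx, indicator_of_notMem hm, Pi.zero_apply]
  · rintro ⟨h1, h2⟩
    filter_upwards [(ae_restrict_iff' hΩ).mp h1, (ae_restrict_iff' hΩ.compl).mp h2] with x g1 g2
    by_cases hx : x ∈ Ω
    · rw [g1 hx, indicator_of_mem hx]
    · rw [g2 hx, indicator_of_notMem hx, Pi.zero_apply]

lemma mem_spaceHsTilde_iff (hΩ : MeasurableSet Ω) (w : L2 Ω) :
    w ∈ spaceHsTilde Ω s ↔ MemHs univ s (Ω.indicator w) := by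
  constructor
  · rintro ⟨w', hw', h1, h2⟩
    exact hw'.congr ((ae_eq_indicator_iff hΩ).mpr ⟨h1, h2⟩)
  · intro h
    exact ⟨_, h, (ae_eq_indicator_iff hΩ).mp EventuallyEq.rfl⟩

/-- Extension by zero, from `H̃^s(Ω)` to `H^s(ℝᵈ)`. -/
def extendZero (hΩ : MeasurableSet Ω) (s : ℝ) : spaceHsTilde Ω s →ₗ[ℝ]
    spaceHs (univ : Set (Space d)) s where
  toFun w := ⟨((mem_spaceHsTilde_iff hΩ w.1).mp w.2).1.toLp _,
    ((mem_spaceHsTilde_iff hΩ w.1).mp w.2).congr (MemLp.coeFn_toLp _).symm⟩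
  map_add' u w := by
    refine Subtype.ext (Eq.trans ?_ (MemLp.toLp_add ((mem_spaceHsTilde_iff hΩ u.1).mp u.2).1
      ((mem_spaceHsTilde_iff hΩ w.1).mp w.2).1))
    rw [MemLp.toLp_eq_toLp_iff, ← indicator_add']
    exact ((ae_eq_indicator_iff hΩ).mpr ⟨((ae_eq_indicator_iff hΩ).mp EventuallyEq.rfl).1.trans
      (Lp.coeFn_add _ _), ((ae_eq_indicator_iff hΩ).mp EventuallyEq.rfl).2⟩)
  map_smul' c w := by
    refine Subtype.ext (Eq.trans ?_ (MemLp.toLp_const_smul c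
      ((mem_spaceHsTilde_iff hΩ w.1).mp w.2).1))
    rw [MemLp.toLp_eq_toLp_iff, show c • Ω.indicator ⇑(w : L2 Ω) = Ω.indicator (c • ⇑(w : L2 Ω))
      from (indicator_const_smul Ω c ⇑(w : L2 Ω)).symm]
    exact ((ae_eq_indicator_iff hΩ).mpr ⟨((ae_eq_indicator_iff hΩ).mp EventuallyEq.rfl).1.trans
      (Lp.coeFn_smul _ _), ((ae_eq_indicator_iff hΩ).mp EventuallyEq.rfl).2⟩)

lemma extendZero_ae (hΩ : MeasurableSet Ω) (w : spaceHsTilde Ω s) :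
    (extendZero hΩ s w : L2 univ) =ᵐ[volume.restrict univ] Ω.indicator (w : L2 Ω) :=
  ((mem_spaceHsTilde_iff hΩ w.1).mp w.2).1.coeFn_toLp

lemma extendZero_ae_restrict (hΩ : MeasurableSet Ω) (w : spaceHsTilde Ω s) :
    (extendZero hΩ s w : L2 univ) =ᵐ[volume.restrict Ω] (w : L2 Ω) :=
  ((ae_eq_indicator_iff hΩ).mp (extendZero_ae hΩ w)).1

lemma norm_extendZero (hΩ : MeasurableSet Ω) (w : spaceHsTilde Ω s) :
    ‖(extendZero hΩ s w : L2 (univ : Set (Space d)))‖ = ‖(w : L2 Ω)‖ := by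
  rw [Lp.norm_def, Lp.norm_def, eLpNorm_congr_ae (extendZero_ae hΩ w), Measure.restrict_univ,
    eLpNorm_indicator_eq_eLpNorm_restrict hΩ]

/-- The map `w ↦ jHs` of the extension of `w` by zero. -/
def jHsTilde (hΩ : MeasurableSet Ω) (s : ℝ) : spaceHsTilde Ω s →ₗ[ℝ] HsModel (univ : Set (Space d)) :=
  jHs univ s ∘ₗ extendZero hΩ s

lemma hsInner_congr {A : Set (Space d)} {u w : Space d → ℝ} (h : u =ᵐ[volume.restrict A] w) :
    hsInner A s u u = hsInner A s w w := by
  have e : ∫ x in A, u x * u x = ∫ x in A, w x * w x := by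
    refine integral_congr_ae ?_
    filter_upwards [h] with x hx
    rw [hx]
  rw [hsInner, hsInner, e]
  congr 2
  · have h1 : ∀ᵐ z ∂sqMeasure A, u z.1 = w z.1 := Measure.quasiMeasurePreserving_fst.ae h
    have h2 : ∀ᵐ z ∂sqMeasure A, u z.2 = w z.2 := Measure.quasiMeasurePreserving_snd.ae h
    refine integral_congr_ae ?_
    filter_upwards [h1, h2] with z hz1 hz2
    rw [hz1, hz2]

lemma jHsTilde_closed (hc : 0 < sobolevConst d s) (hΩ : MeasurableSet Ω)
    (x : ℕ → spaceHsTilde Ω s) (w : L2 Ω) (y : HsModel (univ : Set (Space d)))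
    (hw : Tendsto (fun n => (x n : L2 Ω)) atTop (𝓝 w))
    (hy : Tendsto (fun n => jHsTilde hΩ s (x n)) atTop (𝓝 y)) :
    ∃ z : spaceHsTilde Ω s, (z : L2 Ω) = w ∧ jHsTilde hΩ s z = y := by
  have hfst : Tendsto (fun n => (extendZero hΩ s (x n) : L2 univ)) atTop (𝓝 y.fst) :=
    ((by fun_prop : Continuous fun p : HsModel (univ : Set (Space d)) => p.fst).tendsto _).comp hy
  obtain ⟨z, hz1, hz2⟩ := jHs_closed hc (fun n => extendZero hΩ s (x n)) y.fst y hfst hy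
  rw [← hz1] at hfst
  obtain ⟨φ, hφ, h1⟩ := (tendstoInMeasure_of_tendsto_Lp hfst).exists_seq_tendsto_ae
  obtain ⟨χ, hχ, h2⟩ := (tendstoInMeasure_of_tendsto_Lp
    (hw.comp hφ.tendsto_atTop)).exists_seq_tendsto_ae
  have hzw : (z : L2 univ) =ᵐ[volume.restrict univ] Ω.indicator w := by
    rw [ae_eq_indicator_iff hΩ]
    constructor
    · filter_upwards [ae_restrict_of_ae_restrict_of_subset (subset_univ _) h1, h2, ae_all_iff.mpr fun n =>
        extendZero_ae_restrict hΩ (x n)] with a g1 g2 g3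
      refine tendsto_nhds_unique (g1.comp hχ.tendsto_atTop) (g2.congr fun n => ?_)
      simp only [Function.comp, g3]
    · filter_upwards [ae_restrict_of_ae_restrict_of_subset (subset_univ _) h1, ae_all_iff.mpr fun n =>
        ((ae_eq_indicator_iff hΩ).mp (extendZero_ae hΩ (x n))).2] with a g1 g3
      refine tendsto_nhds_unique g1 (tendsto_const_nhds.congr fun n => ?_)
      rw [g3]
  have hmem : w ∈ spaceHsTilde Ω s := (mem_spaceHsTilde_iff hΩ w).mpr ((memHs_coe z).congr hzw)
  refine ⟨⟨w, hmem⟩, rfl, ?_⟩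
  have : extendZero hΩ s ⟨w, hmem⟩ = z :=
    Subtype.ext (Lp.ext ((extendZero_ae hΩ ⟨w, hmem⟩).trans hzw.symm))
  rw [jHsTilde, LinearMap.comp_apply, this, hz2]

lemma energyModel_spaceHsTilde (hd : 0 < d) (hs0 : 0 < s) (hs1 : s < 1) (hΩo : IsOpen Ω)
    (hΩb : Bornology.IsBounded Ω) :
    EnergyModel (spaceHsTilde Ω s) (jHsTilde hΩo.measurableSet s) :=
  have hc := sobolevConst_pos hd hs0 hs1
  have hb (z : spaceHsTilde Ω s) : ‖(z : L2 Ω)‖ ≤ ‖jHsTilde hΩo.measurableSet s z‖ := by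
    rw [← norm_extendZero hΩo.measurableSet]
    exact norm_le_norm_jHs hc.le _
  have hdq (z : spaceHsTilde Ω s) : eLpNorm (diffQuot s (z : L2 Ω)) 2 (sqMeasure Ω) ≤
      ENNReal.ofReal ((√(sobolevConst d s / 2))⁻¹ * ‖jHsTilde hΩo.measurableSet s z‖) := by
    rw [← eLpNorm_congr_ae (diffQuot_congr s (extendZero_ae_restrict hΩo.measurableSet z))]
    exact (eLpNorm_mono_measure _ (sqMeasure_mono (subset_univ Ω))).trans
      (eLpNorm_diffQuot_le hc _)
  { closed := jHsTilde_closed hc hΩo.measurableSet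
    bound := ⟨1, fun z => by rw [one_mul]; exact hb z⟩
    compact := fun x z M hM h => by
      refine exists_subseq_ae_tendsto hs0 hΩo hΩb (z := fun n => (x n : L2 Ω)) (z' := (z : L2 Ω)) h
        (M := max (ENNReal.ofReal M) (ENNReal.ofReal ((√(sobolevConst d s / 2))⁻¹ * M)))
        (max_lt ENNReal.ofReal_lt_top ENNReal.ofReal_lt_top)
        (fun n => le_max_of_le_left ?_) (fun n => le_max_of_le_right ?_)
        ((hdq z).trans_lt ENNReal.ofReal_lt_top)
      · rw [← Lp.enorm_def, ← ofReal_norm]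
        exact ENNReal.ofReal_le_ofReal ((hb _).trans (hM n))
      · refine (hdq _).trans (ENNReal.ofReal_le_ofReal ?_)
        gcongr
        exact hM n
    contract := fun T hT hT0 hT1 z => by
      obtain ⟨y, hy1, hy2⟩ := jHs_contract hc hT hT0 hT1 (extendZero hΩo.measurableSet s z)
      have hm := memLp_comp_contraction hT hT0 hT1 (Lp.memLp (z : L2 Ω))
      have hyw : (y : L2 univ) =ᵐ[volume.restrict univ] Ω.indicator (hm.toLp _) := by
        rw [ae_eq_indicator_iff hΩo.measurableSet]
        constructor
        · filter_upwards [ae_restrict_of_ae_restrict_of_subset (subset_univ _) hy1, hm.coeFn_toLp,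
            extendZero_ae_restrict hΩo.measurableSet z] with a g1 g2 g3
          rw [g1, g2, g3]
        · filter_upwards [ae_restrict_of_ae_restrict_of_subset (subset_univ _) hy1, ((ae_eq_indicator_iff hΩo.measurableSet).mp
            (extendZero_ae hΩo.measurableSet z)).2] with a g1 g3
          rw [g1, g3, Pi.zero_apply, hT0]
      have hmem : hm.toLp _ ∈ spaceHsTilde Ω s :=
        (mem_spaceHsTilde_iff hΩo.measurableSet _).mpr ((memHs_coe y).congr hyw)
      have e : extendZero hΩo.measurableSet s ⟨_, hmem⟩ = y :=
        Subtype.ext (Lp.ext ((extendZero_ae hΩo.measurableSet ⟨_, hmem⟩).trans hyw.symm))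
      refine ⟨⟨_, hmem⟩, hm.coeFn_toLp, ?_⟩
      rw [jHsTilde, LinearMap.comp_apply, LinearMap.comp_apply, e]
      exact hy2
    test := fun v hv => by
      have h := hv.memHs hd hs0 hs1
      have hm : MemLp v 2 (volume.restrict Ω) := hv.memLp _
      refine ⟨⟨hm.toLp v, v, h, hm.coeFn_toLp.symm, ?_⟩, hm.coeFn_toLp⟩
      filter_upwards [ae_restrict_mem hΩo.measurableSet.compl] with x hx
      exact image_eq_zero_of_notMem_tsupport fun hx' => hx (hv.2.2 hx') }

end HsTilde

end SparseControl
end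

noncomputable section

namespace SparseControl

variable {d : ℕ}

/-! ### The space `H^1_0(Ω)` -/

section H01

variable {Ω : Set (Space d)}

lemma gradient_add_smooth {u v : Space d → ℝ} (hu : ContDiff ℝ ∞ u) (hv : ContDiff ℝ ∞ v) :
    gradient (u + v) = gradient u + gradient v := by
  funext x
  simp only [gradient, Pi.add_apply]
  rw [fderiv_add (hu.differentiable (by simp) x) (hv.differentiable (by simp) x), map_add]

lemma gradient_smul_smooth {u : Space d → ℝ} (c : ℝ) (hu : ContDiff ℝ ∞ u) :
    gradient (c • u) = c • gradient u := by
  funext x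
  simp only [gradient, Pi.smul_apply]
  rw [fderiv_const_smul (hu.differentiable (by simp) x), LinearIsometryEquiv.map_smulₛₗ]
  simp

/-- The product of `L²(Ω)` and `L²(Ω)ᵈ`. -/
abbrev H1Model (Ω : Set (Space d)) : Type :=
  WithLp 2 (L2 Ω × Lp (Space d) 2 (volume.restrict Ω))

variable (Ω) in
/-- The pairs `(v, ∇v)` of test functions `v`. -/
def testH1 : Submodule ℝ (H1Model Ω) where
  carrier := {p | ∃ v, IsTestFunction Ω v ∧ p.fst =ᵐ[volume.restrict Ω] v ∧
    p.snd =ᵐ[volume.restrict Ω] gradient v}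
  add_mem' := by
    rintro p q ⟨u, hu, hu1, hu2⟩ ⟨v, hv, hv1, hv2⟩
    refine ⟨u + v, hu.add hv, (Lp.coeFn_add p.fst q.fst).trans (hu1.add hv1), ?_⟩
    rw [gradient_add_smooth hu.1 hv.1]
    exact (Lp.coeFn_add p.snd q.snd).trans (hu2.add hv2)
  zero_mem' := by
    refine ⟨0, IsTestFunction.zero Ω, Lp.coeFn_zero _ _ _, ?_⟩
    have : gradient (0 : Space d → ℝ) = 0 := by
      funext x
      simp [gradient]
    rw [this]
    exact Lp.coeFn_zero _ _ _
  smul_mem' := by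
    rintro c p ⟨u, hu, hu1, hu2⟩
    refine ⟨c • u, hu.smul c, (Lp.coeFn_smul c p.fst).trans (hu1.const_smul c), ?_⟩
    rw [gradient_smul_smooth c hu.1]
    exact (Lp.coeFn_smul c p.snd).trans (hu2.const_smul c)

variable (Ω) in
/-- The space `H^1_0(Ω)`, as the space of pairs `(φ, ∇φ)`. -/
def h01 : Submodule ℝ (H1Model Ω) := (testH1 Ω).topologicalClosure

instance : CompleteSpace (h01 Ω) :=
  (Submodule.isClosed_topologicalClosure _).completeSpace_coe

lemma IsTestFunction.toLp_mem {v : Space d → ℝ} (hv : IsTestFunction Ω v) :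
    WithLp.toLp 2 ((hv.memLp (volume.restrict Ω)).toLp v,
      (hv.memLp_gradient (volume.restrict Ω)).toLp (gradient v)) ∈ testH1 Ω :=
  ⟨v, hv, (hv.memLp _).coeFn_toLp, (hv.memLp_gradient _).coeFn_toLp⟩

lemma hasH01Gradient_iff {φ : L2 Ω} {g : Lp (Space d) 2 (volume.restrict Ω)} :
    HasH01Gradient Ω φ g ↔ WithLp.toLp 2 (φ, g) ∈ h01 Ω := by
  rw [h01, ← SetLike.mem_coe, Submodule.topologicalClosure_coe, mem_closure_iff_seq_limit]
  constructor
  · rintro ⟨v, hv, h1, h2⟩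
    refine ⟨fun n => _, fun n => (hv n).toLp_mem, ?_⟩
    refine ((WithLp.prod_continuous_toLp 2 _ _).tendsto _).comp (Tendsto.prodMk_nhds ?_ ?_)
    · rw [Lp.tendsto_Lp_iff_tendsto_eLpNorm']
      refine h1.congr fun n => eLpNorm_congr_ae ?_
      exact ((hv n).memLp _).coeFn_toLp.symm.sub EventuallyEq.rfl
    · rw [Lp.tendsto_Lp_iff_tendsto_eLpNorm']
      refine h2.congr fun n => eLpNorm_congr_ae ?_
      exact ((hv n).memLp_gradient _).coeFn_toLp.symm.sub EventuallyEq.rfl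
  · rintro ⟨p, hp, hlim⟩
    choose v hv hp1 hp2 using hp
    have h1 : Tendsto (fun n => (p n).fst) atTop (𝓝 φ) :=
      ((by fun_prop : Continuous fun q : H1Model Ω => q.fst).tendsto _).comp hlim
    have h2 : Tendsto (fun n => (p n).snd) atTop (𝓝 g) :=
      ((by fun_prop : Continuous fun q : H1Model Ω => q.snd).tendsto _).comp hlim
    rw [Lp.tendsto_Lp_iff_tendsto_eLpNorm'] at h1 h2
    exact ⟨v, hv, h1.congr fun n => eLpNorm_congr_ae ((hp1 n).sub EventuallyEq.rfl),
      h2.congr fun n => eLpNorm_congr_ae ((hp2 n).sub EventuallyEq.rfl)⟩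

/-- Closed conditions that hold for test functions hold on `H^1_0(Ω)`. -/
lemma h01_induction {P : H1Model Ω → Prop} (hP : IsClosed {p | P p}) (h : ∀ p ∈ testH1 Ω, P p)
    {p : H1Model Ω} (hp : p ∈ h01 Ω) : P p :=
  closure_minimal (s := (testH1 Ω : Set (H1Model Ω))) h hP hp

lemma IsTestFunction.eq_zero_of_notMem {v : Space d → ℝ} (hv : IsTestFunction Ω v) {x : Space d}
    (hx : x ∉ Ω) : v x = 0 :=
  image_eq_zero_of_notMem_tsupport fun hx' => hx (hv.2.2 hx')

lemma IsTestFunction.eLpNorm_restrict {v : Space d → ℝ} (hv : IsTestFunction Ω v) :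
    eLpNorm v 2 (volume.restrict Ω) = eLpNorm v 2 volume := by
  refine eLpNorm_restrict_eq_of_support_subset fun x hx => ?_
  by_contra h
  exact hx (hv.eq_zero_of_notMem h)

lemma IsTestFunction.eLpNorm_gradient_restrict {v : Space d → ℝ} (hv : IsTestFunction Ω v) :
    eLpNorm (gradient v) 2 (volume.restrict Ω) = eLpNorm (gradient v) 2 volume := by
  refine eLpNorm_restrict_eq_of_support_subset fun x hx => hv.2.2 ?_
  by_contra h
  refine hx ?_
  rw [gradient, fderiv_of_notMem_tsupport (𝕜 := ℝ) h, map_zero]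

/-- Poincaré's inequality. -/
lemma exists_poincare (hd : 0 < d) (hΩb : Bornology.IsBounded Ω) :
    ∃ C : ℝ, 0 < C ∧ ∀ p ∈ h01 Ω, ‖p.fst‖ ≤ C * ‖p.snd‖ := by
  obtain ⟨R, hR0, hR⟩ := hΩb.subset_ball_lt 0 0
  refine ⟨2 * R, by positivity, fun p hp => ?_⟩
  refine h01_induction (P := fun p => ‖p.fst‖ ≤ 2 * R * ‖p.snd‖)
    (isClosed_le (by fun_prop) (by fun_prop)) ?_ hp
  rintro p ⟨v, hv, h1, h2⟩
  set h : Space d := EuclideanSpace.single ⟨0, hd⟩ (2 * R)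
  have hh : ‖h‖ = 2 * R := by simp [h, abs_of_pos hR0]
  have hle : ∫⁻ x, ‖v x‖ₑ ^ 2 ≤ ‖h‖ₑ ^ 2 * ∫⁻ x, ‖gradient v x‖ₑ ^ 2 := by
    refine le_trans (lintegral_mono fun x => ?_) (lintegral_sub_translate_le hv.1 h)
    by_cases hx : x ∈ Ω
    · have : x - h ∉ Ω := by
        intro hx'
        have e1 := mem_ball_zero_iff.mp (hR hx)
        have e2 := mem_ball_zero_iff.mp (hR hx')
        have e3 := norm_sub_le x (x - h)
        rw [sub_sub_cancel, hh] at e3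
        linarith
      rw [hv.eq_zero_of_notMem this, sub_zero]
    · rw [hv.eq_zero_of_notMem hx]
      simp
  rw [← eLpNorm_two_sq, ← eLpNorm_two_sq, ← mul_pow, ← hv.eLpNorm_restrict,
    ← hv.eLpNorm_gradient_restrict, ← eLpNorm_congr_ae h1, ← eLpNorm_congr_ae h2, ← Lp.enorm_def,
    ← Lp.enorm_def] at hle
  have hle' := (ENNReal.pow_le_pow_left_iff two_ne_zero).mp hle
  rw [← ofReal_norm, ← ofReal_norm, ← ofReal_norm, ← ENNReal.ofReal_mul (norm_nonneg _), hh,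
    ENNReal.ofReal_le_ofReal_iff (by positivity)] at hle'
  exact hle'

/-- `H^1_0(Ω)` is continuously embedded in `H̃^s(Ω)`. -/
lemma exists_norm_jHsTilde_le (hd : 0 < d) {s : ℝ} (hs0 : 0 < s) (hs1 : s < 1)
    (hΩ : MeasurableSet Ω) :
    ∃ C : ℝ, ∀ p ∈ h01 Ω, ∃ z : spaceHsTilde Ω s, (z : L2 Ω) = p.fst ∧
      ‖jHsTilde hΩ s z‖ ≤ C * ‖p‖ := by
  have hc := sobolevConst_pos hd hs0 hs1
  obtain ⟨D, hD, hle⟩ := exists_eLpNorm_diffQuot_le hd hs0 hs1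
  set C := √(1 + sobolevConst d s / 2 * D.toReal)
  have htest (p : H1Model Ω) (hp : p ∈ testH1 Ω) : ∃ z : spaceHsTilde Ω s, (z : L2 Ω) = p.fst ∧
      ‖jHsTilde hΩ s z‖ ≤ C * ‖p‖ := by
    obtain ⟨v, hv, h1, h2⟩ := hp
    have hiv : Ω.indicator p.fst =ᵐ[volume.restrict univ] v := by
      refine ((ae_eq_indicator_iff hΩ).mpr ⟨h1.symm, ?_⟩).symm
      filter_upwards [ae_restrict_mem hΩ.compl] with x hx using hv.eq_zero_of_notMem hx
    refine ⟨⟨p.fst, (mem_spaceHsTilde_iff hΩ _).mpr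
      ((hv.memHs hd hs0 hs1).congr hiv.symm)⟩, rfl, ?_⟩
    set z : spaceHsTilde Ω s := ⟨p.fst, (mem_spaceHsTilde_iff hΩ _).mpr
      ((hv.memHs hd hs0 hs1).congr hiv.symm)⟩
    have e1 : diffQuotLp univ s (extendZero hΩ s z) =ᵐ[sqMeasure univ] diffQuot s v :=
      (diffQuotLp_ae _).trans (diffQuot_congr s ((extendZero_ae hΩ z).trans hiv))
    have e2 : ‖diffQuotLp univ s (extendZero hΩ s z)‖ ^ 2 ≤ D.toReal * ‖p‖ ^ 2 := by
      rw [WithLp.prod_norm_sq_eq_of_L2, Lp.norm_def, Lp.norm_def p.fst, Lp.norm_def p.snd,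
        ← ENNReal.toReal_pow, ← ENNReal.toReal_pow, ← ENNReal.toReal_pow, eLpNorm_congr_ae e1,
        eLpNorm_congr_ae h1, eLpNorm_congr_ae h2, hv.eLpNorm_restrict,
        hv.eLpNorm_gradient_restrict]
      have f1 : eLpNorm v 2 volume ^ 2 < ⊤ := ENNReal.pow_lt_top (hv.memLp _).2
      have f2 : eLpNorm (gradient v) 2 volume ^ 2 < ⊤ := ENNReal.pow_lt_top (hv.memLp_gradient _).2
      rw [← ENNReal.toReal_add f1.ne f2.ne, ← ENNReal.toReal_mul]
      exact ENNReal.toReal_mono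
        (ENNReal.mul_lt_top hD (ENNReal.add_lt_top.mpr ⟨f1, f2⟩)).ne (hle v hv.1)
    refine abs_le_of_sq_le_sq' ?_ (by positivity) |>.2
    rw [mul_pow, Real.sq_sqrt (by positivity), jHsTilde, LinearMap.comp_apply, norm_jHs_sq hc.le,
      norm_extendZero, add_mul, one_mul, mul_assoc]
    gcongr
    exact WithLp.norm_fst_le _ p
  refine ⟨C, fun p hp => ?_⟩
  rw [h01, ← SetLike.mem_coe, Submodule.topologicalClosure_coe, mem_closure_iff_seq_limit] at hp
  obtain ⟨q, hq, hlim⟩ := hp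
  choose z hz1 hz2 using fun n => htest (q n) (hq n)
  have hdiff (m n : ℕ) : dist (jHsTilde hΩ s (z m)) (jHsTilde hΩ s (z n)) ≤ C * dist (q m) (q n) := by
    obtain ⟨y, hy1, hy2⟩ := htest (q m - q n) ((testH1 Ω).sub_mem (hq m) (hq n))
    have : y = z m - z n := Subtype.ext (by
      rw [hy1, Submodule.coe_sub, hz1, hz1]; rfl)
    rw [dist_eq_norm, dist_eq_norm, ← map_sub, ← this]
    exact hy2
  have hcau : CauchySeq fun n => jHsTilde hΩ s (z n) := by
    rw [Metric.cauchySeq_iff]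
    intro ε hε
    obtain ⟨N, hN⟩ := Metric.cauchySeq_iff.mp hlim.cauchySeq (ε / (C + 1)) (by positivity)
    refine ⟨N, fun m hm n hn => (hdiff m n).trans_lt ?_⟩
    have h1 := hN m hm n hn
    rw [lt_div_iff₀ (by positivity)] at h1
    nlinarith [dist_nonneg (x := q m) (y := q n)]
  obtain ⟨y, hy⟩ := cauchySeq_tendsto_of_complete hcau
  have hL2 : Tendsto (fun n => (z n : L2 Ω)) atTop (𝓝 p.fst) := by
    simp only [hz1]
    exact ((by fun_prop : Continuous fun q : H1Model Ω => q.fst).tendsto _).comp hlim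
  obtain ⟨z', h1, h2⟩ := jHsTilde_closed hc hΩ z p.fst y hL2 hy
  refine ⟨z', h1, ?_⟩
  rw [h2]
  exact le_of_tendsto_of_tendsto' hy.norm (hlim.norm.const_mul C) hz2

/-- The Rellich theorem for `H^1_0(Ω)`: weak convergence implies convergence in `L²(Ω)`. -/
lemma tendsto_fst_of_weakTendsto (hd : 0 < d) (hΩo : IsOpen Ω) (hΩb : Bornology.IsBounded Ω)
    {p : ℕ → H1Model Ω} {q : H1Model Ω} (hp : ∀ n, p n ∈ h01 Ω) (hq : q ∈ h01 Ω) {M : ℝ}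
    (hM : ∀ n, ‖p n‖ ≤ M) (h : WeakTendsto (fun n => (p n).fst) q.fst) :
    Tendsto (fun n => (p n).fst) atTop (𝓝 q.fst) := by
  have hs0 : (0 : ℝ) < 1 / 2 := by norm_num
  have hs1 : (1 / 2 : ℝ) < 1 := by norm_num
  have hc := sobolevConst_pos hd hs0 hs1
  obtain ⟨C, hC⟩ := exists_norm_jHsTilde_le hd hs0 hs1 hΩo.measurableSet
  choose z hz1 hz2 using fun n => hC (p n - q) ((h01 Ω).sub_mem (hp n) hq)
  have hz3 (n : ℕ) : (z n : L2 Ω) = (p n).fst - q.fst := hz1 n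
  have hb (n : ℕ) : ‖jHsTilde hΩo.measurableSet (1 / 2) (z n)‖ ≤ |C| * (M + ‖q‖) := by
    refine (hz2 n).trans ?_
    gcongr
    · exact le_abs_self C
    · exact (norm_sub_le _ _).trans (by gcongr; exact hM n)
  set k := (√(sobolevConst d (1 / 2) / 2))⁻¹
  have hE := extendZero_ae (s := 1 / 2) hΩo.measurableSet
  have key := tendsto_lintegral_sq_of_memHs (A := univ) (K := Ω) hs0 hΩo.measurableSet
    hΩb.measure_lt_top one_pos (fun _ _ => subset_univ _)
    (v := fun n => Ω.indicator (z n : L2 Ω))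
    (M := max (ENNReal.ofReal (|C| * (M + ‖q‖))) (ENNReal.ofReal (k * (|C| * (M + ‖q‖)))))
    (max_lt ENNReal.ofReal_lt_top ENNReal.ofReal_lt_top)
    (fun n => ((mem_spaceHsTilde_iff hΩo.measurableSet _).mp (z n).2).1)
    (fun n => le_max_of_le_left ?_) (fun n => le_max_of_le_right ?_) ?_
  · have e (n : ℕ) : ∫⁻ x in Ω, ‖Ω.indicator (z n : L2 Ω) x‖ₑ ^ 2
        = ‖(p n).fst - q.fst‖ₑ ^ 2 := by
      rw [← hz3, Lp.enorm_def, eLpNorm_two_sq]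
      refine lintegral_congr_ae ?_
      filter_upwards [ae_restrict_mem hΩo.measurableSet] with x hx
      rw [indicator_of_mem hx]
    simp only [e] at key
    rw [tendsto_iff_norm_sub_tendsto_zero]
    have h2 := ((ENNReal.continuous_rpow_const (y := (1 / 2 : ℝ))).tendsto (0 : ℝ≥0∞)).comp key
    rw [ENNReal.zero_rpow_of_pos (by norm_num)] at h2
    have h3 := (ENNReal.tendsto_toReal ENNReal.zero_ne_top).comp h2
    refine h3.congr fun n => ?_
    simp only [Function.comp]
    rw [← ENNReal.rpow_natCast, ← ENNReal.rpow_mul]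
    simp
  · rw [← eLpNorm_congr_ae (hE (z n)), ← Lp.enorm_def, ← ofReal_norm]
    exact ENNReal.ofReal_le_ofReal ((norm_le_norm_jHs hc.le _).trans (hb n))
  · rw [← eLpNorm_congr_ae (diffQuot_congr _ (hE (z n)))]
    refine (eLpNorm_diffQuot_le hc _).trans (ENNReal.ofReal_le_ofReal ?_)
    change k * _ ≤ _
    gcongr
    exact hb n
  · intro x _ δ _ _
    have h1 := weakTendsto_setIntegral (A := Ω) (B := Ω ∩ Metric.ball x δ)
      (hΩo.measurableSet.inter measurableSet_ball) inter_subset_left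
      ((measure_mono inter_subset_right).trans_lt measure_ball_lt_top) h
    refine h1.congr fun n => ?_
    rw [setIntegral_indicator hΩo.measurableSet, inter_comm]
    refine integral_congr_ae ?_
    have h2 := Lp.coeFn_sub (p n).fst q.fst
    rw [← hz3] at h2
    filter_upwards [ae_restrict_of_ae_restrict_of_subset inter_subset_right h2] with y hy
    rw [hy, Pi.sub_apply]

end H01

end SparseControl
end

noncomputable section

namespace SparseControl

/-! ### Spectral theory of a closed quadratic form with compact resolvent

The form is `q ↦ ‖q.snd‖²` on a closed subspace `V` of `X × Y`, whose elements are to be thought of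
as the pairs `(φ, ∇φ)`. -/

section Form

variable {X Y : Type*} [NormedAddCommGroup X] [InnerProductSpace ℝ X]
  [NormedAddCommGroup Y] [InnerProductSpace ℝ Y] (V : Submodule ℝ (WithLp 2 (X × Y)))

/-- The solutions `φ` of the eigenvalue problem with eigenvalue `l`. -/
def formEigenspace (l : ℝ) : Submodule ℝ X where
  carrier := {φ | ∃ g, WithLp.toLp 2 (φ, g) ∈ V ∧ ∀ q ∈ V, inner ℝ g q.snd = l * inner ℝ φ q.fst}
  add_mem' := by
    rintro φ ψ ⟨g, hg, hg'⟩ ⟨k, hk, hk'⟩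
    refine ⟨g + k, V.add_mem hg hk, fun q hq => ?_⟩
    rw [inner_add_left, inner_add_left, hg' q hq, hk' q hq]
    ring
  zero_mem' := ⟨0, V.zero_mem, by simp⟩
  smul_mem' := by
    rintro c φ ⟨g, hg, hg'⟩
    refine ⟨c • g, V.smul_mem c hg, fun q hq => ?_⟩
    rw [real_inner_smul_left, real_inner_smul_left, hg' q hq]
    ring

/-- The projection to the first component. -/
def formFst : V →L[ℝ] X := (WithLp.fstL 2 ℝ X Y).comp V.subtypeL

@[simp] lemma formFst_apply (q : V) : formFst V q = (q : WithLp 2 (X × Y)).fst := rfl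

variable {V}

lemma inner_eq_zero_of_mem_formEigenspace {l k : ℝ} (hlk : l ≠ k) {φ ψ : X}
    (hφ : φ ∈ formEigenspace V l) (hψ : ψ ∈ formEigenspace V k) : inner ℝ φ ψ = 0 := by
  obtain ⟨g, hg, hg'⟩ := hφ
  obtain ⟨h, hh, hh'⟩ := hψ
  have h1 : inner ℝ g h = l * inner ℝ φ ψ := hg' _ hh
  have h2 : inner ℝ h g = k * inner ℝ ψ φ := hh' _ hg
  rw [real_inner_comm, real_inner_comm φ ψ, h1] at h2
  have h3 : (l - k) * inner ℝ φ ψ = 0 := by linarith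
  exact (mul_eq_zero.mp h3).resolve_left (sub_ne_zero.mpr hlk)

variable (V) in
/-- `P l` is the orthogonal projection onto the eigenspace of `l`, for all `l > 0`. -/
structure IsEigenProj (P : ℝ → X →L[ℝ] X) : Prop where
  mem : ∀ l, 0 < l → ∀ w, P l w ∈ formEigenspace V l
  ortho : ∀ l, 0 < l → ∀ w, ∀ φ ∈ formEigenspace V l, inner ℝ (w - P l w) φ = 0

variable {P : ℝ → X →L[ℝ] X}

lemma norm_sum_sq {ι E : Type*} [NormedAddCommGroup E] [InnerProductSpace ℝ E]
    (F : Finset ι) (v : ι → E) (h : ∀ i j, i ≠ j → inner ℝ (v i) (v j) = 0) :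
    ‖∑ i ∈ F, v i‖ ^ 2 = ∑ i ∈ F, ‖v i‖ ^ 2 := by
  classical
  rw [← real_inner_self_eq_norm_sq, sum_inner]
  refine Finset.sum_congr rfl fun i hi => ?_
  rw [inner_sum, Finset.sum_eq_single i (fun j _ hj => h i j hj.symm) (fun h => absurd hi h),
    real_inner_self_eq_norm_sq]

lemma IsEigenProj.inner_eq (hP : IsEigenProj V P) {l : ℝ} (hl : 0 < l) (w : X) {φ : X}
    (hφ : φ ∈ formEigenspace V l) : inner ℝ (P l w) φ = inner ℝ w φ := by
  have := hP.ortho l hl w φ hφ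
  rw [inner_sub_left] at this
  linarith

lemma IsEigenProj.inner_self (hP : IsEigenProj V P) {l : ℝ} (hl : 0 < l) (w : X) :
    inner ℝ w (P l w) = ‖P l w‖ ^ 2 := by
  rw [← hP.inner_eq hl w (hP.mem l hl w), real_inner_self_eq_norm_sq]

lemma IsEigenProj.inner_ne (hP : IsEigenProj V P) {l k : Ioi (0 : ℝ)} (hlk : l ≠ k) (u w : X) :
    inner ℝ (P l u) (P k w) = 0 :=
  inner_eq_zero_of_mem_formEigenspace (fun h => hlk (Subtype.ext h)) (hP.mem l l.2 u)
    (hP.mem k k.2 w)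

/-- Gradients of the components of `w` in the eigenspaces. -/
lemma IsEigenProj.exists_gradient (hP : IsEigenProj V P) (w : X) :
    ∃ G : Ioi (0 : ℝ) → Y,
      (∀ l : Ioi (0 : ℝ), WithLp.toLp 2 (P l w, G l) ∈ V) ∧
      (∀ l : Ioi (0 : ℝ), ∀ q ∈ V, inner ℝ (G l) q.snd = l * inner ℝ (P l w) q.fst) ∧
      (∀ l k, l ≠ k → inner ℝ (G l) (G k) = 0) ∧
      ∀ l : Ioi (0 : ℝ), ‖G l‖ ^ 2 = l * ‖P l w‖ ^ 2 := by
  choose G hG1 hG2 using fun l : Ioi (0 : ℝ) => hP.mem l l.2 w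
  refine ⟨G, hG1, hG2, fun l k hlk => ?_, fun l => ?_⟩
  · have : inner ℝ (G l) (G k) = l * inner ℝ (P l w) (P k w) := hG2 l _ (hG1 k)
    rw [this, hP.inner_ne hlk, mul_zero]
  · have : inner ℝ (G l) (G l) = l * inner ℝ (P l w) (P l w) := hG2 l _ (hG1 l)
    rw [real_inner_self_eq_norm_sq, real_inner_self_eq_norm_sq] at this
    exact this

lemma IsEigenProj.norm_sum_smul_sq (hP : IsEigenProj V P) (w : X) (F : Finset (Ioi (0 : ℝ)))
    (c : Ioi (0 : ℝ) → ℝ) :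
    ‖∑ l ∈ F, c l • P l w‖ ^ 2 = ∑ l ∈ F, c l ^ 2 * ‖P l w‖ ^ 2 := by
  rw [norm_sum_sq F _ fun l k hlk => by
    rw [real_inner_smul_left, real_inner_smul_right, hP.inner_ne hlk]; simp]
  refine Finset.sum_congr rfl fun l _ => ?_
  rw [norm_smul, mul_pow, Real.norm_eq_abs, sq_abs]

/-- Finite linear combinations of eigenfunctions. -/
lemma IsEigenProj.exists_sum_smul_mem (hP : IsEigenProj V P) (w : X) (F : Finset (Ioi (0 : ℝ)))
    (c : Ioi (0 : ℝ) → ℝ) : ∃ q ∈ V, q.fst = ∑ l ∈ F, c l • P l w ∧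
      ‖q.snd‖ ^ 2 = ∑ l ∈ F, c l ^ 2 * (l * ‖P l w‖ ^ 2) := by
  obtain ⟨G, hG1, -, hG3, hG4⟩ := hP.exists_gradient w
  refine ⟨∑ l ∈ F, c l • WithLp.toLp 2 (P l w, G l),
    V.sum_mem fun l _ => V.smul_mem _ (hG1 l), ?_, ?_⟩
  · exact map_sum (WithLp.fstL 2 ℝ X Y) (fun l => c l • WithLp.toLp 2 (P l w, G l)) F
  · have e : (∑ l ∈ F, c l • WithLp.toLp 2 (P l w, G l)).snd = ∑ l ∈ F, c l • G l :=
      map_sum (WithLp.sndL 2 ℝ X Y) (fun l => c l • WithLp.toLp 2 (P l w, G l)) F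
    rw [e, norm_sum_sq F _ fun l k hlk => by
      rw [real_inner_smul_left, real_inner_smul_right, hG3 l k hlk]; simp]
    refine Finset.sum_congr rfl fun l _ => ?_
    rw [norm_smul, mul_pow, Real.norm_eq_abs, sq_abs, hG4]

lemma le_of_sq_le_mul {a b : ℝ} (hb : 0 ≤ b) (h : a ^ 2 ≤ a * b) : a ≤ b := by
  by_contra hlt
  nlinarith

lemma IsEigenProj.norm_sum_le (hP : IsEigenProj V P) (w : X) (F : Finset (Ioi (0 : ℝ))) :
    ‖∑ l ∈ F, P l w‖ ≤ ‖w‖ := by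
  refine le_of_sq_le_mul (norm_nonneg w) ?_
  have h1 : ‖∑ l ∈ F, P l w‖ ^ 2 = inner ℝ w (∑ l ∈ F, P l w) := by
    rw [norm_sum_sq F _ fun l k hlk => hP.inner_ne hlk w w, inner_sum]
    exact Finset.sum_congr rfl fun l _ => (hP.inner_self l.2 w).symm
  rw [h1, mul_comm]
  exact real_inner_le_norm _ _

/-- Bessel's inequality. -/
lemma IsEigenProj.sum_norm_sq_le (hP : IsEigenProj V P) (w : X) (F : Finset (Ioi (0 : ℝ))) :
    ∑ l ∈ F, ‖P l w‖ ^ 2 ≤ ‖w‖ ^ 2 := by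
  rw [← norm_sum_sq F _ fun l k hlk => hP.inner_ne hlk w w]
  gcongr
  exact hP.norm_sum_le w F

/-- Bessel's inequality for the form. -/
lemma IsEigenProj.sum_mul_norm_sq_le (hP : IsEigenProj V P) {q : WithLp 2 (X × Y)} (hq : q ∈ V)
    (F : Finset (Ioi (0 : ℝ))) : ∑ l ∈ F, l * ‖P l q.fst‖ ^ 2 ≤ ‖q.snd‖ ^ 2 := by
  obtain ⟨G, -, hG2, hG3, hG4⟩ := hP.exists_gradient q.fst
  have h1 : ‖∑ l ∈ F, G l‖ ^ 2 = ∑ l ∈ F, l * ‖P l q.fst‖ ^ 2 := by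
    rw [norm_sum_sq F _ hG3]
    exact Finset.sum_congr rfl fun l _ => hG4 l
  have h2 : ‖∑ l ∈ F, G l‖ ^ 2 = inner ℝ (∑ l ∈ F, G l) q.snd := by
    rw [h1, sum_inner]
    refine Finset.sum_congr rfl fun l _ => ?_
    rw [hG2 l q hq, real_inner_comm, hP.inner_self l.2]
  have h3 : ‖∑ l ∈ F, G l‖ ≤ ‖q.snd‖ := by
    refine le_of_sq_le_mul (norm_nonneg _) ?_
    rw [h2]
    exact real_inner_le_norm _ _
  rw [← h1]
  gcongr

/-- The lower bound for the interpolation functional. -/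
lemma IsEigenProj.sum_le_functional (hP : IsEigenProj V P) {t : ℝ} (ht : 0 < t) (w : X)
    {q : WithLp 2 (X × Y)} (hq : q ∈ V) (F : Finset (Ioi (0 : ℝ))) :
    ∑ l ∈ F, t * l / (t + l) * ‖P l w‖ ^ 2 ≤ ‖q.snd‖ ^ 2 + t * ‖w - q.fst‖ ^ 2 := by
  have h1 := hP.sum_mul_norm_sq_le hq F
  have h2 := hP.sum_norm_sq_le (w - q.fst) F
  calc ∑ l ∈ F, t * l / (t + l) * ‖P l w‖ ^ 2
      ≤ ∑ l ∈ F, (l * ‖P l q.fst‖ ^ 2 + t * ‖P l (w - q.fst)‖ ^ 2) := by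
        refine Finset.sum_le_sum fun l _ => ?_
        have hl : (0 : ℝ) < l := l.2
        have h3 : ‖P l w‖ ≤ ‖P l q.fst‖ + ‖P l (w - q.fst)‖ := by
          rw [map_sub]
          have := norm_add_le (P l q.fst) (P l w - P l q.fst)
          rwa [add_sub_cancel] at this
        have h4 : ‖P l w‖ ^ 2 ≤ (‖P l q.fst‖ + ‖P l (w - q.fst)‖) ^ 2 := by gcongr
        rw [div_mul_eq_mul_div, div_le_iff₀ (by positivity)]
        have h5 : 0 < t * l := by positivity
        nlinarith [sq_nonneg (l * ‖P l q.fst‖ - t * ‖P l (w - q.fst)‖),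
          mul_le_mul_of_nonneg_left h4 h5.le]
    _ = ∑ l ∈ F, l * ‖P l q.fst‖ ^ 2 + t * ∑ l ∈ F, ‖P l (w - q.fst)‖ ^ 2 := by
        rw [Finset.sum_add_distrib, Finset.mul_sum]
    _ ≤ _ := by gcongr

/-- The upper bound for the interpolation functional. -/
lemma IsEigenProj.exists_functional_le (hP : IsEigenProj V P) {t : ℝ} (ht : 0 < t) (w : X)
    (F : Finset (Ioi (0 : ℝ))) : ∃ q ∈ V, ‖q.snd‖ ^ 2 + t * ‖w - q.fst‖ ^ 2 ≤
      ∑ l ∈ F, t * l / (t + l) * ‖P l w‖ ^ 2 + t * ‖w - ∑ l ∈ F, P l w‖ ^ 2 := by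
  obtain ⟨q, hq, hq1, hq2⟩ := hP.exists_sum_smul_mem w F (fun l => t / (t + l))
  refine ⟨q, hq, le_of_eq ?_⟩
  have e : w - q.fst = (w - ∑ l ∈ F, P l w) + ∑ l ∈ F, ((l : ℝ) / (t + l)) • P l w := by
    rw [hq1, sub_add, ← Finset.sum_sub_distrib]
    congr 1
    refine Finset.sum_congr rfl fun l _ => ?_
    have hl : (0 : ℝ) < l := l.2
    have h1 : t / (t + (l : ℝ)) = 1 - l / (t + l) := by field_simp; ring
    rw [h1, sub_smul, one_smul]
  have ho : inner ℝ (w - ∑ l ∈ F, P l w) (∑ l ∈ F, ((l : ℝ) / (t + l)) • P l w) = 0 := by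
    classical
    rw [inner_sum]
    refine Finset.sum_eq_zero fun l hl => ?_
    rw [real_inner_smul_right, inner_sub_left, hP.inner_self l.2, sum_inner,
      Finset.sum_eq_single l (fun k _ hk => hP.inner_ne hk w w) (fun h => absurd hl h),
      real_inner_self_eq_norm_sq, sub_self, mul_zero]
  have e2 : ‖w - q.fst‖ ^ 2 = ‖w - ∑ l ∈ F, P l w‖ ^ 2
      + ∑ l ∈ F, ((l : ℝ) / (t + l)) ^ 2 * ‖P l w‖ ^ 2 := by
    rw [e, norm_add_sq_real, ho, hP.norm_sum_smul_sq w F fun l => (l : ℝ) / (t + l)]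
    ring
  have e3 : ∑ l ∈ F, (t / (t + l)) ^ 2 * (l * ‖P l w‖ ^ 2)
      + t * ∑ l ∈ F, ((l : ℝ) / (t + l)) ^ 2 * ‖P l w‖ ^ 2
      = ∑ l ∈ F, t * l / (t + l) * ‖P l w‖ ^ 2 := by
    rw [Finset.mul_sum, ← Finset.sum_add_distrib]
    refine Finset.sum_congr rfl fun l _ => ?_
    have hl : (0 : ℝ) < l := l.2
    field_simp
  rw [hq2, e2, ← e3]
  ring

/-- A lower bound for the eigenvalues. -/
lemma IsEigenProj.one_le_of_ne_zero (hP : IsEigenProj V P) {C : ℝ}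
    (hC : ∀ q ∈ V, ‖q.fst‖ ≤ C * ‖q.snd‖) (l : Ioi (0 : ℝ)) {w : X} (h : P l w ≠ 0) :
    1 ≤ C ^ 2 * l := by
  obtain ⟨G, hG1, -, -, hG4⟩ := hP.exists_gradient w
  have h1 : ‖P l w‖ ≤ C * ‖G l‖ := hC _ (hG1 l)
  have h2 : ‖P l w‖ ^ 2 ≤ (C * ‖G l‖) ^ 2 := by gcongr
  rw [mul_pow, hG4, ← mul_assoc] at h2
  have h3 : 0 < ‖P l w‖ ^ 2 := by positivity
  by_contra hlt
  nlinarith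

variable [CompleteSpace X] [CompleteSpace V]

variable (V) in
/-- The inverse of the operator `1 + A`, where `A` is the operator of the form. -/
def formResolvent : X →L[ℝ] X := (formFst V).comp (ContinuousLinearMap.adjoint (formFst V))

lemma mem_formEigenspace_iff {l : ℝ} (hl : 1 + l ≠ 0) (φ : X) :
    φ ∈ formEigenspace V l ↔ formResolvent V φ = (1 + l)⁻¹ • φ := by
  have hadj (φ : X) (q : V) : inner ℝ (ContinuousLinearMap.adjoint (formFst V) φ) q
      = inner ℝ φ (q : WithLp 2 (X × Y)).fst := by
    rw [ContinuousLinearMap.adjoint_inner_left, formFst_apply]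
  constructor
  · rintro ⟨g, hg, hg'⟩
    have : ContinuousLinearMap.adjoint (formFst V) φ
        = (1 + l)⁻¹ • (⟨WithLp.toLp 2 (φ, g), hg⟩ : V) := by
      refine ext_inner_right ℝ fun q => ?_
      rw [hadj, Submodule.coe_inner, Submodule.coe_smul, real_inner_smul_left,
        WithLp.prod_inner_apply]
      change _ = (1 + l)⁻¹ * (inner ℝ φ _ + inner ℝ g (q : WithLp 2 (X × Y)).snd)
      rw [hg' _ q.2]
      change inner ℝ φ (q : WithLp 2 (X × Y)).fst =
        (1 + l)⁻¹ * (inner ℝ φ (q : WithLp 2 (X × Y)).fst + _)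
      field_simp
    rw [formResolvent, ContinuousLinearMap.comp_apply, this, map_smul]
    rfl
  · intro h
    set p : V := (1 + l) • ContinuousLinearMap.adjoint (formFst V) φ
    have hp : (p : WithLp 2 (X × Y)).fst = φ := by
      change (1 + l) • formResolvent V φ = φ
      rw [h, smul_smul, mul_inv_cancel₀ hl, one_smul]
    refine ⟨(p : WithLp 2 (X × Y)).snd, ?_, fun q hq => ?_⟩
    · rw [← hp]
      exact p.2
    · have h1 : inner ℝ p (⟨q, hq⟩ : V) = (1 + l) * inner ℝ φ q.fst := by
        rw [← hadj φ ⟨q, hq⟩, Submodule.coe_inner, Submodule.coe_inner, ← real_inner_smul_left]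
        rfl
      rw [Submodule.coe_inner, WithLp.prod_inner_apply] at h1
      change inner ℝ (p : WithLp 2 (X × Y)).fst q.fst + inner ℝ (p : WithLp 2 (X × Y)).snd q.snd
        = _ at h1
      rw [hp] at h1
      linarith

lemma inner_formResolvent (u w : X) :
    inner ℝ (formResolvent V u) w = inner ℝ u (formResolvent V w) := by
  rw [formResolvent, ContinuousLinearMap.comp_apply, ContinuousLinearMap.comp_apply,
    ← ContinuousLinearMap.adjoint_inner_right, ContinuousLinearMap.adjoint_inner_left]

lemma isClosed_formEigenspace {l : ℝ} (hl : 1 + l ≠ 0) :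
    IsClosed (formEigenspace V l : Set X) := by
  have : (formEigenspace V l : Set X) = {φ | formResolvent V φ = (1 + l)⁻¹ • φ} := by
    ext φ
    exact mem_formEigenspace_iff hl φ
  rw [this]
  exact isClosed_eq (by fun_prop) (by fun_prop)

lemma IsEigenProj.apply_formResolvent (hP : IsEigenProj V P) {l : ℝ} (hl : 0 < l) (u : X) :
    P l (formResolvent V u) = (1 + l)⁻¹ • P l u := by
  have hl' : 1 + l ≠ 0 := by positivity
  set y := P l (formResolvent V u) - (1 + l)⁻¹ • P l u with hy
  have hmem : y ∈ formEigenspace V l :=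
    Submodule.sub_mem _ (hP.mem l hl _) (Submodule.smul_mem _ _ (hP.mem l hl u))
  have h0 : inner ℝ y y = 0 := by
    have h1 := (mem_formEigenspace_iff hl' y).mp hmem
    nth_rw 1 [hy]
    rw [inner_sub_left, real_inner_smul_left, hP.inner_eq hl _ hmem, hP.inner_eq hl _ hmem,
      inner_formResolvent, h1, real_inner_smul_right, sub_self]
  exact sub_eq_zero.mp (inner_self_eq_zero.mp h0)

/-- The resolvent controls the components to bounded eigenvalues, the fractional norm those to large
eigenvalues. -/
lemma IsEigenProj.sum_norm_sq_le_resolvent (hP : IsEigenProj V P) {s R B : ℝ} (hs : 0 < s)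
    (hR : 0 < R) (u : X) (F : Finset (Ioi (0 : ℝ)))
    (hB : ∀ F : Finset (Ioi (0 : ℝ)), ∑ l ∈ F, (l : ℝ) ^ s * ‖P l u‖ ^ 2 ≤ B) :
    ∑ l ∈ F, ‖P l u‖ ^ 2 ≤ (1 + R) ^ 2 * ‖formResolvent V u‖ ^ 2 + (R ^ s)⁻¹ * B := by
  have h1 := hP.sum_norm_sq_le (formResolvent V u) F
  have h2 := hB F
  have hRs : 0 < R ^ s := Real.rpow_pos_of_pos hR s
  calc ∑ l ∈ F, ‖P l u‖ ^ 2
      ≤ ∑ l ∈ F, ((1 + R) ^ 2 * ‖P l (formResolvent V u)‖ ^ 2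
          + (R ^ s)⁻¹ * ((l : ℝ) ^ s * ‖P l u‖ ^ 2)) := by
        refine Finset.sum_le_sum fun l _ => ?_
        have hl : (0 : ℝ) < l := l.2
        have hls : 0 < (l : ℝ) ^ s := Real.rpow_pos_of_pos hl s
        rw [hP.apply_formResolvent hl, norm_smul, mul_pow, Real.norm_of_nonneg (by positivity)]
        rcases le_total (l : ℝ) R with h | h
        · have : 1 ≤ (1 + R) ^ 2 * (1 + (l : ℝ))⁻¹ ^ 2 := by
            rw [← mul_pow]
            refine one_le_pow₀ ?_
            rw [← div_eq_mul_inv, le_div_iff₀ (by positivity)]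
            linarith
          have h5 : 0 ≤ (R ^ s)⁻¹ * ((l : ℝ) ^ s * ‖P l u‖ ^ 2) := by positivity
          nlinarith [mul_le_mul_of_nonneg_right this (sq_nonneg ‖P l u‖)]
        · have : 1 ≤ (R ^ s)⁻¹ * (l : ℝ) ^ s := by
            rw [← div_eq_inv_mul, le_div_iff₀ hRs, one_mul]
            exact Real.rpow_le_rpow hR.le h hs.le
          have h5 : 0 ≤ (1 + R) ^ 2 * ((1 + (l : ℝ))⁻¹ ^ 2 * ‖P l u‖ ^ 2) := by positivity
          nlinarith [mul_le_mul_of_nonneg_right this (sq_nonneg ‖P l u‖)]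
    _ = (1 + R) ^ 2 * ∑ l ∈ F, ‖P l (formResolvent V u)‖ ^ 2
          + (R ^ s)⁻¹ * ∑ l ∈ F, (l : ℝ) ^ s * ‖P l u‖ ^ 2 := by
        rw [Finset.sum_add_distrib, Finset.mul_sum, Finset.mul_sum]
    _ ≤ _ := by gcongr

/-- Completeness of the eigenspaces. -/
lemma IsEigenProj.hasSum (hP : IsEigenProj V P) {C : ℝ} (hC : ∀ q ∈ V, ‖q.fst‖ ≤ C * ‖q.snd‖)
    (hK : IsCompactOperator (formFst V))
    (hdense : ∀ w : X, (∀ q ∈ V, inner ℝ w q.fst = 0) → w = 0) (w : X) :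
    HasSum (fun l : Ioi (0 : ℝ) => P l w) w := by
  have hort : OrthogonalFamily ℝ (fun l : Ioi (0 : ℝ) => formEigenspace V l)
      fun l => (formEigenspace V l).subtypeₗᵢ := fun l k hlk u v =>
    inner_eq_zero_of_mem_formEigenspace (fun h => hlk (Subtype.ext h)) u.2 v.2
  have hsum : Summable fun l : Ioi (0 : ℝ) => P l w := by
    have h1 : Summable fun l : Ioi (0 : ℝ) => ‖P l w‖ ^ 2 :=
      summable_of_sum_le (fun _ => sq_nonneg _) (hP.sum_norm_sq_le w)
    have := (hort.summable_iff_norm_sq_summable fun l => ⟨P l w, hP.mem l l.2 w⟩).mpr h1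
    exact this
  obtain ⟨w', hw'⟩ := hsum
  suffices h : w - w' = 0 by rwa [← sub_eq_zero.mp h] at hw'
  have hortho (l : Ioi (0 : ℝ)) (φ : X) (hφ : φ ∈ formEigenspace V l) :
      inner ℝ φ (w - w') = 0 := by
    have h1 : HasSum (fun k : Ioi (0 : ℝ) => inner ℝ φ (P k w)) (inner ℝ φ w') :=
      hw'.mapL (innerSL ℝ φ)
    have h2 : HasSum (fun k : Ioi (0 : ℝ) => inner ℝ φ (P k w)) (inner ℝ φ (P l w)) :=
      hasSum_single l fun k hk => inner_eq_zero_of_mem_formEigenspace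
        (fun h => hk (Subtype.ext h.symm)) hφ (hP.mem k k.2 w)
    rw [inner_sub_right, h1.unique h2, real_inner_comm, real_inner_comm _ φ, hP.inner_eq l.2 w hφ,
      sub_self]
  have hS : IsCompactOperator (formResolvent V) :=
    hK.comp_clm (ContinuousLinearMap.adjoint (formFst V))
  have hsymm : (formResolvent V : X →L[ℝ] X).IsSymmetric := fun u w => inner_formResolvent u w
  have hbot := ContinuousLinearMap.orthogonalComplement_iSup_eigenspaces_eq_bot hS hsymm
  rw [← Submodule.mem_bot ℝ, ← hbot, Submodule.mem_orthogonal]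
  intro u hu
  induction hu using Submodule.iSup_induction' with
  | zero => simp
  | add x y _ _ hx hy => rw [inner_add_left, hx, hy, add_zero]
  | mem μ x hx =>
    rw [Module.End.mem_eigenspace_iff] at hx
    have hx : formResolvent V x = μ • x := hx
    have hadj (q : V) : inner ℝ (ContinuousLinearMap.adjoint (formFst V) x) q
        = inner ℝ x (q : WithLp 2 (X × Y)).fst := by
      rw [ContinuousLinearMap.adjoint_inner_left, formFst_apply]
    have hnorm : ‖ContinuousLinearMap.adjoint (formFst V) x‖ ^ 2 = μ * ‖x‖ ^ 2 := by
      rw [← real_inner_self_eq_norm_sq, hadj]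
      change inner ℝ x (formResolvent V x) = _
      rw [hx, real_inner_smul_right, real_inner_self_eq_norm_sq]
    by_cases hx0 : x = 0
    · simp [hx0]
    have hxn : 0 < ‖x‖ := norm_pos_iff.mpr hx0
    have hμ0 : 0 < μ := by
      by_contra hμ
      have h1 : ContinuousLinearMap.adjoint (formFst V) x = 0 := by
        rw [← norm_eq_zero]
        have : μ * ‖x‖ ^ 2 ≤ 0 := mul_nonpos_of_nonpos_of_nonneg (not_lt.mp hμ) (sq_nonneg _)
        nlinarith [sq_nonneg ‖ContinuousLinearMap.adjoint (formFst V) x‖]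
      refine hx0 (hdense x fun q hq => ?_)
      rw [← hadj ⟨q, hq⟩, h1, inner_zero_left]
    have hl' : 1 + (μ⁻¹ - 1) ≠ 0 := by
      rw [add_sub_cancel]; positivity
    have hxl : x ∈ formEigenspace V (μ⁻¹ - 1) := by
      rw [mem_formEigenspace_iff hl', add_sub_cancel, inv_inv, hx]
    have hl0 : 0 < μ⁻¹ - 1 := by
      obtain ⟨g, hg1, hg2⟩ := hxl
      have h1 : inner ℝ g g = (μ⁻¹ - 1) * inner ℝ x x := hg2 _ hg1
      have h2 : ‖x‖ ≤ C * ‖g‖ := hC _ hg1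
      rw [real_inner_self_eq_norm_sq, real_inner_self_eq_norm_sq] at h1
      have hg : 0 < ‖g‖ ^ 2 := by
        have : ‖g‖ ≠ 0 := by
          intro h0
          rw [h0, mul_zero] at h2
          linarith
        positivity
      by_contra hle
      nlinarith [sq_nonneg ‖x‖]
    exact hortho ⟨_, hl0⟩ x hxl

end Form

end SparseControl
end

noncomputable section

namespace SparseControl

/-! ### Interpolation -/

lemma rpowIntegrand_eq {s t l : ℝ} (ht : 0 < t) (hl : 0 < l) :
    Real.rpowIntegrand₀₁ s t l = t ^ s * (t ^ 2)⁻¹ * (t * l / (t + l)) := by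
  rw [Real.rpowIntegrand₀₁]
  field_simp
  ring

lemma lintegral_rpowIntegrand {s l : ℝ} (hs : s ∈ Ioo (0 : ℝ) 1) (hl : 0 < l) {b : ℝ} (hb : 0 ≤ b) :
    ∫⁻ t in Ioi 0, ENNReal.ofReal (Real.rpowIntegrand₀₁ s t l * b)
      = ENNReal.ofReal (∫ t in Ioi 0, Real.rpowIntegrand₀₁ s t 1) * ENNReal.ofReal (l ^ s * b) := by
  have hnn : ∀ t ∈ Ioi (0 : ℝ), 0 ≤ Real.rpowIntegrand₀₁ s t l * b := fun t ht =>
    mul_nonneg (Real.rpowIntegrand₀₁_nonneg hs.1 (le_of_lt ht) hl.le) hb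
  rw [← ofReal_integral_eq_lintegral_ofReal
    ((Real.integrableOn_rpowIntegrand₀₁_Ioi hs hl.le).mul_const b)
    ((ae_restrict_iff' measurableSet_Ioi).mpr (Eventually.of_forall hnn)), integral_mul_const,
    Real.integral_rpowIntegrand₀₁_eq_rpow_mul_const hs hl.le, ← ENNReal.ofReal_mul
    (Real.integral_rpowIntegrand₀₁_one_pos hs).le]
  congr 1
  ring

/-- Inequalities between the interpolation functionals carry over to the fractional norms. -/
lemma sum_rpow_mul_le_tsum {ι : Type*} {s : ℝ} (hs : s ∈ Ioo (0 : ℝ) 1) {lam b b' : ι → ℝ}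
    (hlam : ∀ i, 0 < lam i) (hb : ∀ i, 0 ≤ b i) (hb' : ∀ i, 0 ≤ b' i) (hbs : Summable b)
    (hbs' : Summable fun i => lam i ^ s * b i) (F : Finset ι)
    (h : ∀ t, 0 < t → ∑ i ∈ F, t * lam i / (t + lam i) * b' i
      ≤ ∑' i, t * lam i / (t + lam i) * b i) :
    ∑ i ∈ F, lam i ^ s * b' i ≤ ∑' i, lam i ^ s * b i := by
  set C := ∫ t in Ioi 0, Real.rpowIntegrand₀₁ s t 1
  have hC : 0 < C := Real.integral_rpowIntegrand₀₁_one_pos hs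
  have hpow (i : ι) : 0 ≤ lam i ^ s := Real.rpow_nonneg (hlam i).le s
  have hsum0 : 0 ≤ ∑' i, lam i ^ s * b i := tsum_nonneg fun i => mul_nonneg (hpow i) (hb i)
  have hmeas (l b : ℝ) : Measurable fun t : ℝ => ENNReal.ofReal (Real.rpowIntegrand₀₁ s t l * b) := by
    unfold Real.rpowIntegrand₀₁
    fun_prop
  have hk (t : ℝ) (ht : 0 < t) (i : ι) : 0 ≤ Real.rpowIntegrand₀₁ s t (lam i) :=
    Real.rpowIntegrand₀₁_nonneg hs.1 ht.le (hlam i).le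
  have hle (t : ℝ) (ht : 0 < t) : ∑ i ∈ F, ENNReal.ofReal (Real.rpowIntegrand₀₁ s t (lam i) * b' i)
      ≤ ∑' i, ENNReal.ofReal (Real.rpowIntegrand₀₁ s t (lam i) * b i) := by
    have hsm : Summable fun i => Real.rpowIntegrand₀₁ s t (lam i) * b i := by
      refine Summable.of_nonneg_of_le (fun i => mul_nonneg (hk t ht i) (hb i)) (fun i => ?_)
        (hbs.mul_left (t ^ s * (t ^ 2)⁻¹ * t))
      rw [rpowIntegrand_eq ht (hlam i)]
      have : t * lam i / (t + lam i) ≤ t := by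
        rw [div_le_iff₀ (add_pos ht (hlam i))]
        nlinarith [hlam i]
      gcongr
      exact hb i
    rw [← ENNReal.ofReal_sum_of_nonneg fun i _ => mul_nonneg (hk t ht i) (hb' i),
      ← ENNReal.ofReal_tsum_of_nonneg (fun i => mul_nonneg (hk t ht i) (hb i)) hsm]
    refine ENNReal.ofReal_le_ofReal ?_
    have e (c : ι → ℝ) : (fun i => Real.rpowIntegrand₀₁ s t (lam i) * c i)
        = fun i => (t ^ s * (t ^ 2)⁻¹) * (t * lam i / (t + lam i) * c i) := by
      funext i
      rw [rpowIntegrand_eq ht (hlam i), mul_assoc]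
    rw [e, e, tsum_mul_left, ← Finset.mul_sum]
    have := Real.rpow_nonneg ht.le s
    gcongr
    exact h t ht
  have hcount : (Function.support b).Countable := hbs.countable_support
  have : Countable (Function.support b) := hcount
  have hsub (c : ι → ℝ) : ∑' i, ENNReal.ofReal (c i * b i)
      = ∑' i : Function.support b, ENNReal.ofReal (c i * b i) := by
    refine (tsum_subtype_eq_of_support_subset (s := Function.support b)
      (f := fun i => ENNReal.ofReal (c i * b i)) fun i hi => ?_).symm
    rw [Function.mem_support] at hi ⊢
    rintro hbi
    simp [hbi] at hi
  have key : ∑ i ∈ F, ENNReal.ofReal C * ENNReal.ofReal (lam i ^ s * b' i)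
      ≤ ∑' i, ENNReal.ofReal C * ENNReal.ofReal (lam i ^ s * b i) := by
    calc ∑ i ∈ F, ENNReal.ofReal C * ENNReal.ofReal (lam i ^ s * b' i)
        = ∫⁻ t in Ioi 0, ∑ i ∈ F, ENNReal.ofReal (Real.rpowIntegrand₀₁ s t (lam i) * b' i) := by
          rw [lintegral_finsetSum _ fun i _ => hmeas _ _]
          exact Finset.sum_congr rfl fun i _ => (lintegral_rpowIntegrand hs (hlam i) (hb' i)).symm
      _ ≤ ∫⁻ t in Ioi 0, ∑' i, ENNReal.ofReal (Real.rpowIntegrand₀₁ s t (lam i) * b i) :=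
          setLIntegral_mono' measurableSet_Ioi fun t ht => hle t ht
      _ = ∫⁻ t in Ioi 0, ∑' i : Function.support b,
            ENNReal.ofReal (Real.rpowIntegrand₀₁ s t (lam i) * b i) := by
          refine lintegral_congr fun t => hsub _
      _ = ∑' i : Function.support b, ENNReal.ofReal C * ENNReal.ofReal (lam i ^ s * b i) := by
          rw [lintegral_tsum fun i => (hmeas _ _).aemeasurable]
          exact tsum_congr fun i => lintegral_rpowIntegrand hs (hlam i) (hb i)
      _ = _ := by
          rw [ENNReal.tsum_mul_left, ENNReal.tsum_mul_left, hsub]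
  rw [ENNReal.tsum_mul_left, ← Finset.mul_sum,
    ENNReal.mul_le_mul_iff_right (ENNReal.ofReal_pos.mpr hC).ne' ENNReal.ofReal_ne_top,
    ← ENNReal.ofReal_sum_of_nonneg fun i _ => mul_nonneg (hpow i) (hb' i),
    ← ENNReal.ofReal_tsum_of_nonneg (fun i => mul_nonneg (hpow i) (hb i)) hbs',
    ENNReal.ofReal_le_ofReal_iff hsum0] at key
  exact key

end SparseControl
end

noncomputable section

namespace SparseControl

variable {d : ℕ}

/-! ### The model of `ℍ^s(Ω)` -/

section Spectral

variable {Ω : Set (Space d)} {s : ℝ}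

lemma solvesDirichletEigen_iff {l : ℝ} {φ : L2 Ω} :
    SolvesDirichletEigen Ω l φ ↔ φ ∈ formEigenspace (h01 Ω) l := by
  refine exists_congr fun g => and_congr hasH01Gradient_iff ?_
  have hint (p : H1Model Ω) (v : Space d → ℝ) (h1 : p.fst =ᵐ[volume.restrict Ω] v)
      (h2 : p.snd =ᵐ[volume.restrict Ω] gradient v) :
      inner ℝ g p.snd = ∫ x in Ω, inner ℝ (g x) (gradient v x) ∧
      inner ℝ φ p.fst = ∫ x in Ω, φ x * v x := by
    rw [L2.inner_def, inner_eq_integral]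
    constructor
    · refine integral_congr_ae ?_
      filter_upwards [h2] with x hx
      rw [hx]
    · refine integral_congr_ae ?_
      filter_upwards [h1] with x hx
      rw [hx]
  constructor
  · intro h q hq
    refine h01_induction (P := fun q => inner ℝ g q.snd = l * inner ℝ φ q.fst)
      (isClosed_eq (by fun_prop) (by fun_prop)) ?_ hq
    rintro p ⟨v, hv, h1, h2⟩
    obtain ⟨e1, e2⟩ := hint p v h1 h2
    rw [e1, e2, h v hv]
  · intro h v hv
    obtain ⟨e1, e2⟩ := hint (WithLp.toLp 2 (_, _)) v (hv.memLp _).coeFn_toLp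
      (hv.memLp_gradient _).coeFn_toLp
    rw [← e1, ← e2]
    exact h _ (Submodule.le_topologicalClosure _ hv.toLp_mem)

lemma eigenspace_eq {l : ℝ} (hl : 0 < l) : eigenspace Ω l = formEigenspace (h01 Ω) l := by
  have e : {φ | SolvesDirichletEigen Ω l φ} = (formEigenspace (h01 Ω) l : Set (L2 Ω)) :=
    Set.ext fun φ => solvesDirichletEigen_iff
  rw [eigenspace, e, Submodule.span_eq]
  exact (isClosed_formEigenspace (by positivity)).submodule_topologicalClosure_eq

variable (Ω) in
lemma isEigenProj : IsEigenProj (h01 Ω) (eigenProj Ω) where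
  mem l hl w := by
    have : CompleteSpace (eigenspace Ω l) :=
      (Submodule.isClosed_topologicalClosure _).completeSpace_coe
    rw [← eigenspace_eq hl]
    exact Submodule.starProjection_apply_mem (eigenspace Ω l) w
  ortho l hl w φ hφ := by
    have : CompleteSpace (eigenspace Ω l) :=
      (Submodule.isClosed_topologicalClosure _).completeSpace_coe
    rw [← eigenspace_eq hl] at hφ
    exact Submodule.starProjection_inner_eq_zero w φ hφ

lemma isCompactOperator_formFst (hd : 0 < d) (hΩo : IsOpen Ω) (hΩb : Bornology.IsBounded Ω) :
    IsCompactOperator (formFst (h01 Ω)) := by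
  refine (isCompactOperator_iff_image_closedBall_subset_compact
    (formFst (h01 Ω)).toLinearMap one_pos).mpr ⟨_, ?_, subset_rfl⟩
  refine IsSeqCompact.isCompact fun y hy => ?_
  choose p hp hpy using hy
  have hM (n : ℕ) : ‖p n‖ ≤ 1 := mem_closedBall_zero_iff.mp (hp n)
  obtain ⟨φ, hφ, q, hq⟩ := exists_weakTendsto hM
  have hqn : ‖q‖ ≤ 1 := hq.norm_le fun n => hM _
  refine ⟨formFst (h01 Ω) q, ⟨q, mem_closedBall_zero_iff.mpr hqn, rfl⟩, φ, hφ, ?_⟩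
  have hw : WeakTendsto (fun n => (p (φ n) : H1Model Ω).fst) (q : H1Model Ω).fst := by
    intro h
    have := hq (ContinuousLinearMap.adjoint (formFst (h01 Ω)) h)
    simp only [ContinuousLinearMap.adjoint_inner_right] at this
    exact this
  have := tendsto_fst_of_weakTendsto hd hΩo hΩb (fun n => (p (φ n)).2) q.2 (fun n => hM (φ n)) hw
  refine this.congr fun n => ?_
  rw [Function.comp, ← hpy]
  rfl

lemma eq_zero_of_inner_h01_eq_zero (hΩo : IsOpen Ω) {w : L2 Ω}
    (h : ∀ q ∈ h01 Ω, inner ℝ w q.fst = 0) : w = 0 := by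
  have hz := hΩo.ae_eq_zero_of_integral_contDiff_smul_eq_zero (μ := volume) (f := w) (by
    have : LocallyIntegrable (⇑w) (volume.restrict Ω) :=
      (Lp.memLp w).locallyIntegrable (by norm_num)
    exact locallyIntegrableOn_of_locallyIntegrable_restrict this) fun g hg1 hg2 hg3 => by
      have hg : IsTestFunction Ω g := ⟨hg1, hg2, hg3⟩
      have h1 := h _ (Submodule.le_topologicalClosure _ hg.toLp_mem)
      rw [real_inner_comm] at h1
      change inner ℝ ((hg.memLp _).toLp g) w = 0 at h1
      rw [inner_toLp_eq_integral] at h1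
      rw [← h1, ← setIntegral_eq_integral_of_forall_compl_eq_zero (s := Ω)]
      · simp only [smul_eq_mul]
      · intro x hx
        rw [hg.eq_zero_of_notMem hx, zero_smul]
  refine Lp.ext ?_
  filter_upwards [Lp.coeFn_zero ℝ 2 (volume.restrict Ω),
    (ae_restrict_iff' hΩo.measurableSet).mpr hz] with x h1 h2
  rw [h1, h2, Pi.zero_apply]

lemma hasSum_eigenProj (hd : 0 < d) (hΩo : IsOpen Ω) (hΩb : Bornology.IsBounded Ω) (w : L2 Ω) :
    HasSum (fun l : Ioi (0 : ℝ) => eigenProj Ω l w) w := by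
  obtain ⟨C, -, hC⟩ := exists_poincare hd hΩb
  exact (isEigenProj Ω).hasSum hC (isCompactOperator_formFst hd hΩo hΩb)
    (fun w h => eq_zero_of_inner_h01_eq_zero hΩo h) w

lemma hasSum_norm_eigenProj (hd : 0 < d) (hΩo : IsOpen Ω) (hΩb : Bornology.IsBounded Ω) (w : L2 Ω) :
    HasSum (fun l : Ioi (0 : ℝ) => ‖eigenProj Ω l w‖ ^ 2) (‖w‖ ^ 2) := by
  have h := (hasSum_eigenProj hd hΩo hΩb w).mapL (innerSL ℝ w)
  simp only [innerSL_apply_apply, real_inner_self_eq_norm_sq] at h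
  exact h.congr_fun fun l => ((isEigenProj Ω).inner_self l.2 w).symm

lemma memℓp_eigenProj {w : L2 Ω}
    (h : Summable fun l : Ioi (0 : ℝ) => (l : ℝ) ^ s * ‖eigenProj Ω l w‖ ^ 2) :
    Memℓp (fun l : Ioi (0 : ℝ) => √((l : ℝ) ^ s) • eigenProj Ω l w) 2 := by
  refine memℓp_gen ?_
  refine h.congr fun l => ?_
  rw [norm_smul, Real.norm_of_nonneg (Real.sqrt_nonneg _)]
  norm_num
  rw [mul_pow, Real.sq_sqrt (Real.rpow_nonneg l.2.le s)]

variable (Ω s) in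
/-- The map `w ↦ (l^(s/2) P_l w)_l`, where `P_l` is the projection onto the eigenspace of `l`. -/
def jSpectral : spaceSpectral Ω s →ₗ[ℝ] lp (fun _ : Ioi (0 : ℝ) => L2 Ω) 2 where
  toFun w := ⟨_, memℓp_eigenProj w.2.2⟩
  map_add' u w := by
    refine Subtype.ext (funext fun l => ?_)
    change √((l : ℝ) ^ s) • eigenProj Ω l ((u : L2 Ω) + w) = _
    rw [map_add, smul_add]
    rfl
  map_smul' c w := by
    refine Subtype.ext (funext fun l => ?_)
    change √((l : ℝ) ^ s) • eigenProj Ω l (c • (w : L2 Ω)) = _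
    rw [map_smul, smul_comm]
    rfl

lemma jSpectral_apply (w : spaceSpectral Ω s) (l : Ioi (0 : ℝ)) :
    jSpectral Ω s w l = √((l : ℝ) ^ s) • eigenProj Ω l (w : L2 Ω) := rfl

lemma norm_jSpectral_sq (w : spaceSpectral Ω s) :
    ‖jSpectral Ω s w‖ ^ 2 = ∑' l : Ioi (0 : ℝ), (l : ℝ) ^ s * ‖eigenProj Ω l (w : L2 Ω)‖ ^ 2 := by
  rw [← real_inner_self_eq_norm_sq, lp.inner_eq_tsum]
  refine tsum_congr fun l => ?_
  rw [jSpectral_apply, real_inner_self_eq_norm_sq, norm_smul, mul_pow,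
    Real.norm_of_nonneg (Real.sqrt_nonneg _), Real.sq_sqrt (Real.rpow_nonneg l.2.le s)]

lemma wNorm_spectral (w : spaceSpectral Ω s) :
    wNorm Ω s .spectral (w : L2 Ω) = ‖jSpectral Ω s w‖ := by
  rw [← Real.sqrt_sq (norm_nonneg (jSpectral Ω s w)), norm_jSpectral_sq, wNorm, wInner]
  simp only [real_inner_self_eq_norm_sq]

lemma sum_le_norm_jSpectral_sq (w : spaceSpectral Ω s) (F : Finset (Ioi (0 : ℝ))) :
    ∑ l ∈ F, (l : ℝ) ^ s * ‖eigenProj Ω l (w : L2 Ω)‖ ^ 2 ≤ ‖jSpectral Ω s w‖ ^ 2 := by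
  rw [norm_jSpectral_sq]
  exact w.2.2.sum_le_tsum F fun l _ => mul_nonneg (Real.rpow_nonneg l.2.le s) (sq_nonneg _)

lemma jSpectral_closed (hd : 0 < d) (hΩo : IsOpen Ω) (hΩb : Bornology.IsBounded Ω)
    (x : ℕ → spaceSpectral Ω s) (w : L2 Ω) (y : lp (fun _ : Ioi (0 : ℝ) => L2 Ω) 2)
    (hw : Tendsto (fun n => (x n : L2 Ω)) atTop (𝓝 w))
    (hy : Tendsto (fun n => jSpectral Ω s (x n)) atTop (𝓝 y)) :
    ∃ z : spaceSpectral Ω s, (z : L2 Ω) = w ∧ jSpectral Ω s z = y := by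
  have hc (l : Ioi (0 : ℝ)) : y l = √((l : ℝ) ^ s) • eigenProj Ω l w := by
    have h1 : Tendsto (fun n => jSpectral Ω s (x n) l) atTop (𝓝 (y l)) := by
      rw [tendsto_iff_norm_sub_tendsto_zero] at hy ⊢
      exact squeeze_zero (fun n => norm_nonneg _)
        (fun n => lp.norm_apply_le_norm two_ne_zero (jSpectral Ω s (x n) - y) l) hy
    have h2 : Tendsto (fun n => √((l : ℝ) ^ s) • eigenProj Ω l (x n : L2 Ω)) atTop
        (𝓝 (√((l : ℝ) ^ s) • eigenProj Ω l w)) :=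
      (((eigenProj Ω l).continuous.tendsto w).comp hw).const_smul _
    exact tendsto_nhds_unique h1 h2
  have hsum : Summable fun l : Ioi (0 : ℝ) => (l : ℝ) ^ s * ‖eigenProj Ω l w‖ ^ 2 := by
    refine (lp.summable_inner (𝕜 := ℝ) y y).congr fun l => ?_
    rw [hc, real_inner_self_eq_norm_sq, norm_smul, mul_pow,
      Real.norm_of_nonneg (Real.sqrt_nonneg _), Real.sq_sqrt (Real.rpow_nonneg l.2.le s)]
  refine ⟨⟨w, hasSum_eigenProj hd hΩo hΩb w, hsum⟩, rfl, Subtype.ext (funext fun l => ?_)⟩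
  exact (hc l).symm

lemma exists_norm_le_jSpectral (hd : 0 < d) (hΩo : IsOpen Ω) (hΩb : Bornology.IsBounded Ω)
    (hs0 : 0 < s) : ∃ C : ℝ, ∀ z : spaceSpectral Ω s, ‖(z : L2 Ω)‖ ≤ C * ‖jSpectral Ω s z‖ := by
  obtain ⟨C, hC0, hC⟩ := exists_poincare hd hΩb
  refine ⟨√((C ^ 2) ^ s), fun z => abs_le_of_sq_le_sq' ?_ (by positivity) |>.2⟩
  rw [mul_pow, Real.sq_sqrt (by positivity), norm_jSpectral_sq, ← tsum_mul_left,
    ← (hasSum_norm_eigenProj hd hΩo hΩb (z : L2 Ω)).tsum_eq]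
  refine (hasSum_norm_eigenProj hd hΩo hΩb (z : L2 Ω)).summable.tsum_le_tsum (fun l => ?_)
    (z.2.2.mul_left _)
  rw [← mul_assoc, ← Real.mul_rpow (by positivity) l.2.le]
  by_cases h0 : eigenProj Ω l (z : L2 Ω) = 0
  · simp [h0]
  · exact le_mul_of_one_le_left (sq_nonneg _)
      (Real.one_le_rpow ((isEigenProj Ω).one_le_of_ne_zero hC l h0) hs0.le)

lemma exists_mem_spaceSpectral_of_test (hd : 0 < d) (hΩo : IsOpen Ω) (hΩb : Bornology.IsBounded Ω)
    (hs0 : 0 < s) (hs1 : s < 1) {v : Space d → ℝ} (hv : IsTestFunction Ω v) :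
    ∃ z : spaceSpectral Ω s, (z : L2 Ω) =ᵐ[volume.restrict Ω] v := by
  set w : L2 Ω := (hv.memLp _).toLp v
  refine ⟨⟨w, hasSum_eigenProj hd hΩo hΩb w, ?_⟩, (hv.memLp _).coeFn_toLp⟩
  have h1 : Summable fun l : Ioi (0 : ℝ) => (l : ℝ) * ‖eigenProj Ω l w‖ ^ 2 :=
    summable_of_sum_le (fun l => mul_nonneg l.2.le (sq_nonneg _)) fun F =>
      (isEigenProj Ω).sum_mul_norm_sq_le (Submodule.le_topologicalClosure _ hv.toLp_mem) F
  refine Summable.of_nonneg_of_le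
    (fun l => mul_nonneg (Real.rpow_nonneg l.2.le s) (sq_nonneg _)) (fun l => ?_)
    ((hasSum_norm_eigenProj hd hΩo hΩb w).summable.add h1)
  rw [← one_add_mul]
  gcongr
  have hl : (0 : ℝ) < l := l.2
  rcases le_total (l : ℝ) 1 with h | h
  · have := Real.rpow_le_one hl.le h hs0.le
    linarith
  · have := Real.rpow_le_rpow_of_exponent_le h hs1.le
    rw [Real.rpow_one] at this
    linarith

lemma exists_subseq_of_bounded_jSpectral (hd : 0 < d) (hΩo : IsOpen Ω)
    (hΩb : Bornology.IsBounded Ω) (hs0 : 0 < s) (x : ℕ → spaceSpectral Ω s)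
    (z : spaceSpectral Ω s) {M : ℝ} (hM : ∀ n, ‖jSpectral Ω s (x n)‖ ≤ M)
    (h : WeakTendsto (fun n => (x n : L2 Ω)) z) :
    ∃ φ : ℕ → ℕ, StrictMono φ ∧
      ∀ᵐ a ∂volume.restrict Ω, Tendsto (fun n => (x (φ n) : L2 Ω) a) atTop (𝓝 ((z : L2 Ω) a)) := by
  obtain ⟨C, hC⟩ := exists_norm_le_jSpectral (s := s) hd hΩo hΩb hs0
  set N := M + ‖jSpectral Ω s z‖
  have hN (n : ℕ) : ‖jSpectral Ω s (x n - z)‖ ≤ N := by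
    rw [map_sub]
    exact (norm_sub_le _ _).trans (add_le_add_left (hM n) _)
  have hN0 : 0 ≤ N := (norm_nonneg _).trans (hN 0)
  have hu (n : ℕ) : (x n : L2 Ω) - z ∈ Metric.closedBall 0 (|C| * N) := by
    rw [mem_closedBall_zero_iff]
    refine (hC (x n - z)).trans ?_
    gcongr
    · exact le_abs_self C
    · exact hN n
  have hS : IsCompactOperator (formResolvent (h01 Ω)).toLinearMap :=
    (isCompactOperator_formFst hd hΩo hΩb).comp_clm (ContinuousLinearMap.adjoint (formFst (h01 Ω)))
  obtain ⟨K, hK, hKS⟩ := hS.image_closedBall_subset_compact (|C| * N)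
  obtain ⟨y, -, φ, hφ, hy⟩ := hK.tendsto_subseq fun n => hKS (mem_image_of_mem _ (hu n))
  have hy0 : y = 0 := by
    refine ext_inner_right ℝ fun v => ?_
    have h1 : Tendsto (fun n => inner ℝ (formResolvent (h01 Ω) ((x (φ n) : L2 Ω) - z)) v) atTop
        (𝓝 (inner ℝ y v)) := hy.inner tendsto_const_nhds
    have h2 := ((h.comp hφ) (formResolvent (h01 Ω) v)).sub_const
      (inner ℝ (z : L2 Ω) (formResolvent (h01 Ω) v))
    rw [sub_self] at h2
    rw [inner_zero_left]
    refine tendsto_nhds_unique h1 (h2.congr fun n => ?_)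
    rw [inner_formResolvent, inner_sub_left]
    rfl
  rw [hy0] at hy
  have hle (R : ℝ) (hR : 0 < R) (n : ℕ) : ‖(x n : L2 Ω) - z‖ ^ 2
      ≤ (1 + R) ^ 2 * ‖formResolvent (h01 Ω) ((x n : L2 Ω) - z)‖ ^ 2 + (R ^ s)⁻¹ * N ^ 2 := by
    refine hasSum_le_of_sum_le (hasSum_norm_eigenProj hd hΩo hΩb _) fun F => ?_
    refine (isEigenProj Ω).sum_norm_sq_le_resolvent hs0 hR _ F fun F => ?_
    refine (sum_le_norm_jSpectral_sq (x n - z) F).trans ?_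
    gcongr
    exact hN n
  have hlim : Tendsto (fun n => (x (φ n) : L2 Ω)) atTop (𝓝 (z : L2 Ω)) := by
    rw [tendsto_iff_norm_sub_tendsto_zero]
    have hsq : Tendsto (fun n => ‖(x (φ n) : L2 Ω) - z‖ ^ 2) atTop (𝓝 0) := by
      rw [Metric.tendsto_atTop]
      intro ε hε
      have hR : Tendsto (fun R : ℝ => (R ^ s)⁻¹ * N ^ 2) atTop (𝓝 (0 * N ^ 2)) :=
        (tendsto_inv_atTop_zero.comp (tendsto_rpow_atTop hs0)).mul_const _
      rw [zero_mul] at hR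
      obtain ⟨R, hR1, hR2⟩ := ((hR.eventually (gt_mem_nhds (half_pos hε))).and
        (eventually_gt_atTop 0)).exists
      have h1 : Tendsto (fun n => (1 + R) ^ 2 *
          ‖formResolvent (h01 Ω) ((x (φ n) : L2 Ω) - z)‖ ^ 2) atTop (𝓝 ((1 + R) ^ 2 * 0)) := by
        refine Tendsto.const_mul _ ?_
        have := (hy.norm).pow 2
        simpa using this
      rw [mul_zero] at h1
      obtain ⟨n₀, hn₀⟩ := eventually_atTop.mp (h1.eventually (gt_mem_nhds (half_pos hε)))
      refine ⟨n₀, fun n hn => ?_⟩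
      rw [Real.dist_eq, sub_zero, abs_of_nonneg (sq_nonneg _)]
      linarith [hle R hR2 (φ n), hn₀ n hn]
    have := hsq.sqrt
    simpa [Real.sqrt_sq (norm_nonneg _)] using this
  obtain ⟨χ, hχ, hae⟩ := (tendstoInMeasure_of_tendsto_Lp hlim).exists_seq_tendsto_ae
  exact ⟨φ ∘ χ, hφ.comp hχ, hae⟩

lemma norm_gradient_comp_le {T : ℝ → ℝ} (hT : ContDiff ℝ ∞ T) (hT1 : ∀ r, |deriv T r| ≤ 1)
    {v : Space d → ℝ} (hv : ContDiff ℝ ∞ v) (x : Space d) :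
    ‖gradient (fun x => T (v x)) x‖ ≤ ‖gradient v x‖ := by
  have h1 : HasFDerivAt (fun x => T (v x)) (deriv T (v x) • fderiv ℝ v x) x :=
    ((hT.differentiable (by simp)) (v x)).hasDerivAt.comp_hasFDerivAt x
      ((hv.differentiable (by simp)) x).hasFDerivAt
  rw [norm_gradient, norm_gradient, h1.fderiv, norm_smul]
  exact mul_le_of_le_one_left (norm_nonneg _) (hT1 _)

/-- Normal contractions do not increase the interpolation functional. -/
lemma sum_contraction_le_tsum (hd : 0 < d) (hΩo : IsOpen Ω) (hΩb : Bornology.IsBounded Ω)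
    {T : ℝ → ℝ} (hT : ContDiff ℝ ∞ T) (hT0 : T 0 = 0) (hT1 : ∀ r, |deriv T r| ≤ 1)
    {w w' : L2 Ω} (hw : w' =ᵐ[volume.restrict Ω] fun a => T (w a)) {t : ℝ} (ht : 0 < t)
    (F : Finset (Ioi (0 : ℝ))) :
    ∑ l ∈ F, t * l / (t + l) * ‖eigenProj Ω l w'‖ ^ 2
      ≤ ∑' l : Ioi (0 : ℝ), t * l / (t + l) * ‖eigenProj Ω l w‖ ^ 2 := by
  have hnn (l : Ioi (0 : ℝ)) : 0 ≤ t * l / (t + l) * ‖eigenProj Ω l w‖ ^ 2 := by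
    have hl : (0 : ℝ) < l := l.2
    positivity
  have hsum : Summable fun l : Ioi (0 : ℝ) => t * l / (t + l) * ‖eigenProj Ω l w‖ ^ 2 := by
    refine Summable.of_nonneg_of_le hnn (fun l => ?_)
      ((hasSum_norm_eigenProj hd hΩo hΩb w).summable.mul_left t)
    have hl : (0 : ℝ) < l := l.2
    gcongr
    rw [div_le_iff₀ (by positivity)]
    nlinarith
  refine le_of_forall_pos_le_add fun η hη => ?_
  have hrest : Tendsto (fun F : Finset (Ioi (0 : ℝ)) => t * ‖w - ∑ l ∈ F, eigenProj Ω l w‖ ^ 2)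
      atTop (𝓝 0) := by
    have h1 : Tendsto (fun F : Finset (Ioi (0 : ℝ)) => ∑ l ∈ F, eigenProj Ω l w) atTop (𝓝 w) :=
      hasSum_eigenProj hd hΩo hΩb w
    have h2 := (((tendsto_const_nhds (x := w)).sub h1).norm.pow 2).const_mul t
    simpa using h2
  obtain ⟨F', hF'⟩ := (hrest.eventually (gt_mem_nhds (half_pos hη))).exists
  obtain ⟨q, hq, hq'⟩ := (isEigenProj Ω).exists_functional_le ht w F'
  have hopen : IsOpen {p : H1Model Ω | ‖p.snd‖ ^ 2 + t * ‖w - p.fst‖ ^ 2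
      < ‖q.snd‖ ^ 2 + t * ‖w - q.fst‖ ^ 2 + η / 2} :=
    isOpen_lt (by fun_prop) (by fun_prop)
  obtain ⟨p, hp, v, hv, hv1, hv2⟩ := mem_closure_iff.mp
    (show q ∈ closure (testH1 Ω : Set (H1Model Ω)) from hq) _ hopen
    (show q ∈ {p : H1Model Ω | _} from lt_add_of_pos_right _ (half_pos hη))
  have hp : ‖p.snd‖ ^ 2 + t * ‖w - p.fst‖ ^ 2
      < ‖q.snd‖ ^ 2 + t * ‖w - q.fst‖ ^ 2 + η / 2 := hp
  have hTv := hv.comp_contraction hT hT0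
  have h1 := (isEigenProj Ω).sum_le_functional ht w'
    (Submodule.le_topologicalClosure _ hTv.toLp_mem) F
  change _ ≤ ‖(hTv.memLp_gradient _).toLp _‖ ^ 2 + t * ‖w' - (hTv.memLp _).toLp _‖ ^ 2 at h1
  have h2 : ‖(hTv.memLp_gradient (volume.restrict Ω)).toLp _‖ ≤ ‖p.snd‖ := by
    refine Lp.norm_le_norm_of_ae_le ?_
    filter_upwards [hv2, (hTv.memLp_gradient (volume.restrict Ω)).coeFn_toLp] with x g1 g2
    rw [g1, g2]
    exact norm_gradient_comp_le hT hT1 hv.1 x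
  have h3 : ‖w' - (hTv.memLp (volume.restrict Ω)).toLp _‖ ≤ ‖w - p.fst‖ := by
    refine Lp.norm_le_norm_of_ae_le ?_
    filter_upwards [hv1, hw, (hTv.memLp (volume.restrict Ω)).coeFn_toLp,
      Lp.coeFn_sub w' ((hTv.memLp (volume.restrict Ω)).toLp _), Lp.coeFn_sub w p.fst]
      with x g1 g2 g3 g4 g5
    rw [g4, g5, Pi.sub_apply, Pi.sub_apply, g1, g2, g3]
    exact abs_sub_le_of_deriv hT hT1 _ _
  calc ∑ l ∈ F, t * l / (t + l) * ‖eigenProj Ω l w'‖ ^ 2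
      ≤ ‖p.snd‖ ^ 2 + t * ‖w - p.fst‖ ^ 2 := h1.trans (by gcongr)
    _ ≤ ∑ l ∈ F', t * l / (t + l) * ‖eigenProj Ω l w‖ ^ 2 + η := by linarith
    _ ≤ _ := by
      gcongr
      exact hsum.sum_le_tsum F' fun l _ => hnn l

lemma jSpectral_contract (hd : 0 < d) (hΩo : IsOpen Ω) (hΩb : Bornology.IsBounded Ω)
    (hs0 : 0 < s) (hs1 : s < 1) {T : ℝ → ℝ}
    (hT : ContDiff ℝ ∞ T) (hT0 : T 0 = 0) (hT1 : ∀ r, |deriv T r| ≤ 1) (z : spaceSpectral Ω s) :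
    ∃ z' : spaceSpectral Ω s, (z' : L2 Ω) =ᵐ[volume.restrict Ω] (fun a => T ((z : L2 Ω) a)) ∧
      ‖jSpectral Ω s z'‖ ≤ ‖jSpectral Ω s z‖ := by
  have hm := memLp_comp_contraction hT hT0 hT1 (Lp.memLp (z : L2 Ω))
  have hle (F : Finset (Ioi (0 : ℝ))) : ∑ l ∈ F, (l : ℝ) ^ s * ‖eigenProj Ω l (hm.toLp _)‖ ^ 2
      ≤ ‖jSpectral Ω s z‖ ^ 2 := by
    rw [norm_jSpectral_sq]
    exact sum_rpow_mul_le_tsum ⟨hs0, hs1⟩ (fun l : Ioi (0 : ℝ) => l.2) (fun l => sq_nonneg _)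
      (fun l => sq_nonneg _) (hasSum_norm_eigenProj hd hΩo hΩb _).summable z.2.2 F
      fun t ht => sum_contraction_le_tsum hd hΩo hΩb hT hT0 hT1 hm.coeFn_toLp ht F
  have hnn (l : Ioi (0 : ℝ)) : 0 ≤ (l : ℝ) ^ s * ‖eigenProj Ω l (hm.toLp _)‖ ^ 2 :=
    mul_nonneg (Real.rpow_nonneg l.2.le s) (sq_nonneg _)
  have hsum := summable_of_sum_le hnn hle
  have hmem : hm.toLp _ ∈ spaceSpectral Ω s := ⟨hasSum_eigenProj hd hΩo hΩb _, hsum⟩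
  refine ⟨⟨hm.toLp _, hmem⟩, hm.coeFn_toLp, ?_⟩
  refine abs_le_of_sq_le_sq' ?_ (norm_nonneg _) |>.2
  rw [norm_jSpectral_sq]
  exact hsum.tsum_le_of_sum_le hle

lemma energyModel_spaceSpectral (hd : 0 < d) (hs0 : 0 < s) (hs1 : s < 1) (hΩo : IsOpen Ω)
    (hΩb : Bornology.IsBounded Ω) : EnergyModel (spaceSpectral Ω s) (jSpectral Ω s) where
  closed := jSpectral_closed hd hΩo hΩb
  bound := exists_norm_le_jSpectral hd hΩo hΩb hs0
  compact x z _ hM h := exists_subseq_of_bounded_jSpectral hd hΩo hΩb hs0 x z hM h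
  contract _ hT hT0 hT1 z := jSpectral_contract hd hΩo hΩb hs0 hs1 hT hT0 hT1 z
  test _ hv := exists_mem_spaceSpectral_of_test hd hΩo hΩb hs0 hs1 hv

end Spectral

/-- All four fractional Sobolev spaces have a Hilbert space model. -/
lemma exists_energyModel (hd : 0 < d) {Ω : Set (Space d)} (hΩo : IsOpen Ω)
    (hΩb : Bornology.IsBounded Ω) {s : ℝ} (hs0 : 0 < s) (hs1 : s < 1) (κ : SobolevType) :
    ∃ (H : Type) (_ : NormedAddCommGroup H) (_ : InnerProductSpace ℝ H) (_ : CompleteSpace H)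
      (J : fracSobolev Ω s κ →ₗ[ℝ] H), EnergyModel (fracSobolev Ω s κ) J ∧
        ∀ z : fracSobolev Ω s κ, wNorm Ω s κ z = ‖J z‖ := by
  have hc := (sobolevConst_pos hd hs0 hs1).le
  cases κ with
  | full =>
    exact ⟨_, _, _, inferInstance, jHs Ω s, energyModel_spaceHs hd hs0 hs1 hΩo hΩb,
      fun z => sqrt_hsInner_self hc z⟩
  | zeroTrace =>
    exact ⟨_, _, _, inferInstance, jHs0 Ω s, energyModel_spaceHs0 hd hs0 hs1 hΩo hΩb,
      fun z => sqrt_hsInner_self hc (Submodule.inclusion spaceHs0_le z)⟩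
  | zeroExtension =>
    refine ⟨_, _, _, inferInstance, jHsTilde hΩo.measurableSet s,
      energyModel_spaceHsTilde hd hs0 hs1 hΩo hΩb, fun z => ?_⟩
    refine Eq.trans ?_ (sqrt_hsInner_self hc (extendZero hΩo.measurableSet s z))
    rw [hsInner_congr (extendZero_ae hΩo.measurableSet z)]
    rfl
  | spectral =>
    exact ⟨_, _, _, inferInstance, jSpectral Ω s,
      energyModel_spaceSpectral hd hs0 hs1 hΩo hΩb, fun z => wNorm_spectral z⟩

end SparseControl
end

/-! ### The main theorem -/

namespace SparseControl

variable {d : ℕ}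

lemma eLpNorm_one_eq_ofReal {X : Type*} [MeasurableSpace X] {μ : Measure X} [IsFiniteMeasure μ]
    (v : Lp ℝ 2 μ) : eLpNorm v 1 μ = ENNReal.ofReal (∫ x, |v x| ∂μ) := by
  rw [eLpNorm_one_eq_lintegral_enorm, ofReal_integral_eq_lintegral_ofReal (integrable_Lp v).abs
    (Eventually.of_forall fun x => abs_nonneg _)]
  simp only [Real.enorm_eq_ofReal_abs]

/-- The multipliers are bounded in `L¹(Ω)`. -/
lemma exists_bound_multiplier {T : ℝ} {Ω : Set (Space d)} [IsFiniteMeasure (volume.restrict Ω)]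
    {s : ℝ} {κ : SobolevType} {H : Type*} [NormedAddCommGroup H] [InnerProductSpace ℝ H]
    [CompleteSpace H] {J : fracSobolev Ω s κ →ₗ[ℝ] H} {f : ControlSpace T Ω → ℝ}
    {α β γ p ρ : ℝ} {ubar : ControlSpace T Ω} {wbar : L2 Ω} {ε : ℕ → ℝ}
    {u : ℕ → ControlSpace T Ω} {w : ℕ → L2 Ω}
    (hJ : EnergyModel (fracSobolev Ω s κ) J)
    (hn : ∀ z : fracSobolev Ω s κ, wNorm Ω s κ z = ‖J z‖)
    (hf_lsc : WeaklyLSC f)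
    (hf_below : ∃ (g : StrongDual ℝ (ControlSpace T Ω)) (c : ℝ), ∀ u, g u + c ≤ f u)
    (hf_diff : ContDiff ℝ 1 f)
    (hα : 0 < α) (hβ : 0 < β) (hγ : 0 < γ) (hp0 : 0 < p) (hp1 : p < 1) (hρ : 0 < ρ)
    (hloc : IsLocalSolution T Ω s κ f α β γ p ρ ubar wbar)
    (hε_pos : ∀ k, 0 < ε k) (hε_lim : Tendsto ε atTop (𝓝 0))
    (hsol : ∀ k, IsAuxSolution T Ω s κ f α β γ p (ε k) ρ ubar wbar (u k) (w k)) :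
    ∃ C : ℝ, ∀ k, ∫ x in Ω, |multiplier Ω p (ε k) (w k) x| ≤ C := by
  have hlim := tendsto_auxSolution hJ hn hf_lsc hf_below hα hβ hγ hp0 hp1 hloc hε_pos hε_lim hsol
  have hw0 (k : ℕ) : 0 ≤ wNorm Ω s κ (w k - wbar) := Real.sqrt_nonneg _
  have hu : Tendsto u atTop (𝓝 ubar) := by
    rw [tendsto_iff_norm_sub_tendsto_zero]
    exact squeeze_zero (fun k => norm_nonneg _) (fun k => le_add_of_nonneg_right (hw0 k)) hlim
  have hfd : Tendsto (fun k => ‖fderiv ℝ f (u k)‖) atTop (𝓝 ‖fderiv ℝ f ubar‖) :=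
    (((hf_diff.continuous_fderiv one_ne_zero).norm).tendsto ubar).comp hu
  obtain ⟨F, hF⟩ := hfd.bddAbove_range
  obtain ⟨c, hc⟩ := hJ.bound
  have hpi : 0 < γ * (Real.pi / 2) := by positivity
  set B : ℝ := (2 * (volume.real Ω + (|c| * ρ) ^ 2)
      + 2 * ((cylMeasure T Ω).real univ + (F + α * (ρ + ‖ubar‖) + ρ) ^ 2))
        / (γ * (Real.pi / 2)) with hB
  have hev : ∀ᶠ k in atTop, ∫ x in Ω, |multiplier Ω p (ε k) (w k) x| ≤ B := by
    filter_upwards [hlim.eventually (gt_mem_nhds hρ)] with k hk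
    have hk1 : ‖u k - ubar‖ < ρ := lt_of_le_of_lt (le_add_of_nonneg_right (hw0 k)) hk
    have hk2 : wNorm Ω s κ (w k - wbar) < ρ :=
      lt_of_le_of_lt (le_add_of_nonneg_left (norm_nonneg _)) hk
    have h1 := integral_abs_multiplier_le hJ hn (hε_pos k) hβ hp0 hp1 hγ hloc.1.1 (hsol k) hk2
    have h2 := norm_penaltyMultiplier_le (hε_pos k) hα (hf_diff.differentiable one_ne_zero)
      (hsol k) hk1
    have h3 : ‖w k - wbar‖ ≤ |c| * ρ := by
      set z : fracSobolev Ω s κ := ⟨w k, (hsol k).1.1⟩ - ⟨wbar, hloc.1.1⟩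
      have e : (z : L2 Ω) = w k - wbar := rfl
      rw [← e] at hk2 ⊢
      rw [hn] at hk2
      calc ‖(z : L2 Ω)‖ ≤ c * ‖J z‖ := hc z
        _ ≤ |c| * ‖J z‖ := by gcongr; exact le_abs_self c
        _ ≤ |c| * ρ := by gcongr
    have h4 : ‖u k‖ ≤ ρ + ‖ubar‖ := by
      have := norm_add_le (u k - ubar) ubar
      rw [sub_add_cancel] at this
      linarith
    have h5 : ‖fderiv ℝ f (u k)‖ ≤ F := hF (mem_range_self k)
    have h6 : ‖penaltyMultiplier (ε k) (u k) (w k)‖ ≤ F + α * (ρ + ‖ubar‖) + ρ := by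
      refine h2.trans ?_
      gcongr
    rw [hB, le_div_iff₀ hpi, mul_comm]
    refine h1.trans ?_
    gcongr
  obtain ⟨N, hN⟩ := eventually_atTop.mp hev
  refine ⟨B + ∑ k ∈ Finset.range N, ∫ x in Ω, |multiplier Ω p (ε k) (w k) x|, fun k => ?_⟩
  have hnn (k : ℕ) : 0 ≤ ∫ x in Ω, |multiplier Ω p (ε k) (w k) x| :=
    integral_nonneg fun x => abs_nonneg _
  rcases le_or_gt N k with h | h
  · have := Finset.sum_nonneg fun k (_ : k ∈ Finset.range N) => hnn k
    linarith [hN k h]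
  · have h1 := Finset.single_le_sum (fun k (_ : k ∈ Finset.range N) => hnn k)
      (Finset.mem_range.mpr h)
    have h2 : 0 ≤ B := by positivity
    linarith

end SparseControl

theorem mainTheorem6 {d : ℕ} (hd : 0 < d) (Ω : Set (SparseControl.Space d))
    (hΩ : SparseControl.IsBoundedLipschitzDomain Ω) (T : ℝ) (hT : 0 < T)
    (s : ℝ) (hs0 : 0 < s) (hs1 : s < 1) (κ : SparseControl.SobolevType)
    (f : SparseControl.ControlSpace T Ω → ℝ) (hf_lsc : SparseControl.WeaklyLSC f)
    (hf_below : ∃ (g : StrongDual ℝ (SparseControl.ControlSpace T Ω)) (c : ℝ),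
      ∀ u, g u + c ≤ f u)
    (hf_diff : ContDiff ℝ 1 f)
    (α β γ p : ℝ) (hα : 0 < α) (hβ : 0 < β) (hγ : 0 < γ) (hp0 : 0 < p) (hp1 : p < 1)
    (ubar : SparseControl.ControlSpace T Ω) (wbar : SparseControl.L2 Ω) (ρ : ℝ) (hρ : 0 < ρ)
    (hloc : SparseControl.IsLocalSolution T Ω s κ f α β γ p ρ ubar wbar)
    (ε : ℕ → ℝ) (hε_pos : ∀ k, 0 < ε k) (hε_lim : Tendsto ε atTop (𝓝 0))
    (u : ℕ → SparseControl.ControlSpace T Ω) (w : ℕ → SparseControl.L2 Ω)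
    (hsol : ∀ k, SparseControl.IsAuxSolution T Ω s κ f α β γ p (ε k) ρ ubar wbar (u k) (w k)) :
    (∃ C : ℝ, ∀ k, eLpNorm (SparseControl.multiplier Ω p (ε k) (w k)) 1 (volume.restrict Ω)
      ≤ ENNReal.ofReal C) ∧
    ∀ lam : Module.Dual ℝ (SparseControl.fracSobolev Ω s κ),
      SparseControl.dualNorm Ω s κ lam < ⊤ →
      Tendsto (fun k => SparseControl.dualNorm Ω s κ
        (SparseControl.toFunctional Ω s κ (SparseControl.multiplier Ω p (ε k) (w k)) - lam))
        atTop (𝓝 0) →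
      ∃! ν : SignedMeasure Ω, SparseControl.IsIdentifiedWith Ω s κ lam ν := by
  have hfin : IsFiniteMeasure (volume.restrict Ω) :=
    isFiniteMeasure_restrict.mpr hΩ.isBounded.measure_lt_top.ne
  obtain ⟨H, _, _, _, J, hJ, hn⟩ :=
    SparseControl.exists_energyModel hd hΩ.isOpen hΩ.isBounded hs0 hs1 κ
  obtain ⟨C, hC⟩ := SparseControl.exists_bound_multiplier hJ hn hf_lsc hf_below hf_diff hα hβ hγ
    hp0 hp1 hρ hloc hε_pos hε_lim hsol
  refine ⟨⟨C, fun k => ?_⟩, fun lam _ hlam => ?_⟩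
  · rw [SparseControl.eLpNorm_one_eq_ofReal]
    exact ENNReal.ofReal_le_ofReal (hC k)
  · exact SparseControl.existsUnique_identified hΩ.isOpen hJ hn _ hC lam hlam
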